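/- Let $k$ be a field. For finite-dimensional $k$-algebras $R$, $S$ and a finite-dimensional $R$-$S$-bimodule $M$ on which $k$ acts centrally, let $\Lambda=\begin{pmatrix} R & M\\ 0 & S\end{pmatrix}$ be the triangular matrix algebra and let $\widetilde\Lambda=\begin{pmatrix} S & DM\\ 0 & R\end{pmatrix}$ be its \emph{mate}, where $DM=\operatorname{Hom}_k(M,k)$ with the $S$-$R$-bimodule structure $(s\varphi r)(m)=\varphi(rms)$. Two rings are \emph{derived equivalent} if the bounded derived categories of their categories of all right modules are equivalent as triangulated categories. The \emph{repetitive algebra} $\widehat A$ of a finite-dimensional $k$-algebra $A$ is the non-unital $k$-algebra of $\mathbb{Z}\times\mathbb{Z}$-matrices with finitely many nonzero entries, with entries of $A$ in the positions $(i,i)$, entries of $DA$ in the positions $(i,i+1)$ and zeros elsewhere; the multiplication is given by the multiplication of $A$, the $A$-bimodule structure of $DA$ and the zero map $DA\otimes_A DA\to 0$. The \emph{Cartan matrix} of a finite-dimensional $k$-algebra $A$ with respect to a complete list $P_1,\dots,P_n$ of pairwise non-isomorphic indecomposable finitely generated projective right $A$-modules is $(\dim_k\operatorname{Hom}_A(P_i,P_j))_{i,j}$.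 Integer matrices $C,C'$ are \emph{congruent over $\mathbb{Z}$} if $P^tCP=C'$ for some $P$ invertible over $\mathbb{Z}$. Let $R=k[x]/(x^2)$, $S=k[y]/(y^3)$ and $M=k$, with $x$ and $y$ acting on $k$ as zero. Then: (1) $\Lambda$ and its mate $\widetilde\Lambda$ are not derived equivalent; (2) the repetitive algebras of $\Lambda$ and $\widetilde\Lambda$ are isomorphic as $k$-algebras; (3) $\widetilde\Lambda$ is isomorphic as a $k$-algebra to $\begin{pmatrix} k[y]/(y^3) & k\\ 0 & k[x]/(x^2)\end{pmatrix}$, with $x$ and $y$ acting on $k$ as zero; (4) for suitable orderings of the indecomposable projectives, the Cartan matrices of $\Lambda$ and $\widetilde\Lambda$ are $\begin{pmatrix} 2&0\\1&3\end{pmatrix}$ and $\begin{pmatrix} 3&0\\1&2\end{pmatrix}$, and these two matrices are not congruent over $\mathbb{Z}$; (5) $R$ and $S$ are self-injective (injective as right modules over themselves), and the right $S$-module $M$ has infinite projective dimension, that is, it has no finite projective resolution. -/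

import Mathlib

open CategoryTheory MulOpposite

universe u

/-! ### Triangular matrix rings -/

/-- The triangular matrix ring `(R M; 0 S)` of an `R`-`S`-bimodule `M`. The right action of `S`
on `M` is a module structure over `Sᵐᵒᵖ`. -/
@[ext]
structure TriMat (R S M : Type u) where
  /-- the upper left entry -/
  a : R
  /-- the upper right entry -/
  m : M
  /-- the lower right entry -/
  b : S

namespace TriMat

section Additive

variable {R S M : Type u} [AddCommGroup R] [AddCommGroup S] [AddCommGroup M]

instance : Zero (TriMat R S M) := ⟨⟨0, 0, 0⟩⟩
instance : Add (TriMat R S M) := ⟨fun x y => ⟨x.a + y.a, x.m + y.m, x.b + y.b⟩⟩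
instance : Neg (TriMat R S M) := ⟨fun x => ⟨-x.a, -x.m, -x.b⟩⟩
instance : Sub (TriMat R S M) := ⟨fun x y => ⟨x.a - y.a, x.m - y.m, x.b - y.b⟩⟩
instance {k : Type*} [SMul k R] [SMul k S] [SMul k M] : SMul k (TriMat R S M) :=
  ⟨fun c x => ⟨c • x.a, c • x.m, c • x.b⟩⟩

@[simp] lemma zero_a : (0 : TriMat R S M).a = 0 := rfl
@[simp] lemma zero_m : (0 : TriMat R S M).m = 0 := rfl
@[simp] lemma zero_b : (0 : TriMat R S M).b = 0 := rfl
@[simp] lemma add_a (x y : TriMat R S M) : (x + y).a = x.a + y.a := rfl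
@[simp] lemma add_m (x y : TriMat R S M) : (x + y).m = x.m + y.m := rfl
@[simp] lemma add_b (x y : TriMat R S M) : (x + y).b = x.b + y.b := rfl
@[simp] lemma smul_a {k : Type*} [SMul k R] [SMul k S] [SMul k M] (c : k) (x : TriMat R S M) :
    (c • x).a = c • x.a := rfl
@[simp] lemma smul_m {k : Type*} [SMul k R] [SMul k S] [SMul k M] (c : k) (x : TriMat R S M) :
    (c • x).m = c • x.m := rfl
@[simp] lemma smul_b {k : Type*} [SMul k R] [SMul k S] [SMul k M] (c : k) (x : TriMat R S M) :
    (c • x).b = c • x.b := rfl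

/-- The entries of a triangular matrix. -/
def toProd (x : TriMat R S M) : R × M × S := (x.a, x.m, x.b)

lemma toProd_injective : Function.Injective (toProd : TriMat R S M → R × M × S) := by
  intro x y h
  simp only [toProd, Prod.mk.injEq] at h
  exact TriMat.ext h.1 h.2.1 h.2.2

instance : AddCommGroup (TriMat R S M) :=
  toProd_injective.addCommGroup toProd rfl (fun _ _ => rfl) (fun _ => rfl) (fun _ _ => rfl)
    (fun _ _ => rfl) (fun _ _ => rfl)

instance {k : Type*} [Semiring k] [Module k R] [Module k S] [Module k M] :
    Module k (TriMat R S M) :=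
  toProd_injective.module k
    { toFun := toProd, map_zero' := rfl, map_add' := fun _ _ => rfl } (fun _ _ => rfl)

end Additive

section Ring

variable {R S M : Type u} [Ring R] [Ring S] [AddCommGroup M] [Module R M] [Module Sᵐᵒᵖ M]

instance : One (TriMat R S M) := ⟨⟨1, 0, 1⟩⟩
instance : Mul (TriMat R S M) :=
  ⟨fun x y => ⟨x.a * y.a, x.a • y.m + op y.b • x.m, x.b * y.b⟩⟩

@[simp] lemma one_a : (1 : TriMat R S M).a = 1 := rfl
@[simp] lemma one_m : (1 : TriMat R S M).m = 0 := rfl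
@[simp] lemma one_b : (1 : TriMat R S M).b = 1 := rfl
@[simp] lemma mul_a (x y : TriMat R S M) : (x * y).a = x.a * y.a := rfl
@[simp] lemma mul_m (x y : TriMat R S M) : (x * y).m = x.a • y.m + op y.b • x.m := rfl
@[simp] lemma mul_b (x y : TriMat R S M) : (x * y).b = x.b * y.b := rfl

instance [SMulCommClass R Sᵐᵒᵖ M] : Ring (TriMat R S M) where
  __ := (inferInstance : AddCommGroup (TriMat R S M))
  left_distrib x y z := by
    ext
    · simp [mul_add]
    · simp only [mul_m, add_m, add_b, smul_add, MulOpposite.op_add, add_smul]; abel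
    · simp [mul_add]
  right_distrib x y z := by
    ext
    · simp [add_mul]
    · simp only [mul_m, add_m, add_a, smul_add, add_smul]; abel
    · simp [add_mul]
  zero_mul x := by ext <;> simp
  mul_zero x := by ext <;> simp
  mul_assoc x y z := by
    ext
    · simp [mul_assoc]
    · simp only [mul_m, mul_a, mul_b, smul_add, op_mul, mul_smul, smul_comm x.a (op z.b) y.m]
      abel
    · simp [mul_assoc]
  one_mul x := by ext <;> simp
  mul_one x := by ext <;> simp
  neg_add_cancel x := neg_add_cancel x
  zsmul := fun n x => n • x
  zsmul_zero' x := zero_zsmul x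
  zsmul_succ' n x := SubNegMonoid.zsmul_succ' n x
  zsmul_neg' n x := SubNegMonoid.zsmul_neg' n x

variable {k : Type u} [Field k] [Algebra k R] [Algebra k S] [Module k M]

instance [SMulCommClass R Sᵐᵒᵖ M] [IsScalarTower k R M] [IsScalarTower k Sᵐᵒᵖ M] :
    Algebra k (TriMat R S M) :=
  Algebra.ofModule
    (fun c x y => by
      ext
      · simp
      · simp only [mul_m, smul_m, smul_a, smul_assoc, smul_add, smul_comm (op y.b) c x.m]
      · simp)
    (fun c x y => by
      ext
      · simp
      · simp only [mul_m, smul_m, smul_b, op_smul, smul_assoc, smul_add, smul_comm x.a c y.m]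
      · simp)

instance [Module.Finite k R] [Module.Finite k S] [Module.Finite k M] :
    Module.Finite k (TriMat R S M) :=
  Module.Finite.of_injective
    ({ toFun := toProd, map_add' := fun _ _ => rfl, map_smul' := fun _ _ => rfl } :
      TriMat R S M →ₗ[k] R × M × S) toProd_injective

end Ring

end TriMat

/-! ### Dual bimodules and mates -/

/-- The `k`-dual `DM = Hom_k(M, k)` of a bimodule `M`. If `M` is an `R`-`S`-bimodule, then `DM` is
an `S`-`R`-bimodule by `(s φ)(m) = φ(m s)` and `(φ r)(m) = φ(r m)`. -/
def DualBimod (k M : Type u) [Field k] [AddCommGroup M] [Module k M] : Type u := Module.Dual k M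

namespace DualBimod

variable {k R S M : Type u} [Field k] [Ring R] [Ring S] [AddCommGroup M] [Module k M]

instance : AddCommGroup (DualBimod k M) := inferInstanceAs (AddCommGroup (Module.Dual k M))
instance : Module k (DualBimod k M) := inferInstanceAs (Module k (Module.Dual k M))
instance : FunLike (DualBimod k M) M k := inferInstanceAs (FunLike (Module.Dual k M) M k)
instance : LinearMapClass (DualBimod k M) k M k :=
  inferInstanceAs (LinearMapClass (Module.Dual k M) k M k)
instance [Module.Finite k M] : Module.Finite k (DualBimod k M) :=
  inferInstanceAs (Module.Finite k (Module.Dual k M))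

@[ext] lemma ext {φ ψ : DualBimod k M} (h : ∀ m, φ m = ψ m) : φ = ψ := DFunLike.ext _ _ h

@[simp] lemma zero_apply (m : M) : (0 : DualBimod k M) m = 0 := rfl
@[simp] lemma add_apply (φ ψ : DualBimod k M) (m : M) : (φ + ψ) m = φ m + ψ m := rfl
@[simp] lemma smul_apply (c : k) (φ : DualBimod k M) (m : M) : (c • φ) m = c • φ m := rfl

section Left

variable [Algebra k S] [Module Sᵐᵒᵖ M] [IsScalarTower k Sᵐᵒᵖ M]

instance : SMul S (DualBimod k M) :=
  ⟨fun s φ => (φ : Module.Dual k M) ∘ₗ (DistribSMul.toLinearMap k M (op s))⟩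

@[simp] lemma left_smul_apply (s : S) (φ : DualBimod k M) (m : M) : (s • φ) m = φ (op s • m) := rfl

instance : Module S (DualBimod k M) where
  one_smul φ := by ext m; simp
  mul_smul s t φ := by ext m; simp [mul_smul]
  smul_zero s := by ext m; simp
  smul_add s φ ψ := by ext m; simp
  add_smul s t φ := by ext m; simp [add_smul, map_add]
  zero_smul φ := by ext m; simp

instance : IsScalarTower k S (DualBimod k M) :=
  ⟨fun c s φ => by ext m; simp [op_smul, smul_assoc, map_smul]⟩

end Left

section Right

variable [Algebra k R] [Module R M] [IsScalarTower k R M]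

instance : SMul Rᵐᵒᵖ (DualBimod k M) :=
  ⟨fun r φ => (φ : Module.Dual k M) ∘ₗ (DistribSMul.toLinearMap k M (unop r))⟩

@[simp] lemma right_smul_apply (r : Rᵐᵒᵖ) (φ : DualBimod k M) (m : M) :
    (r • φ) m = φ (unop r • m) := rfl

instance : Module Rᵐᵒᵖ (DualBimod k M) where
  one_smul φ := by ext m; simp
  mul_smul s t φ := by ext m; simp [mul_smul]
  smul_zero s := by ext m; simp
  smul_add s φ ψ := by ext m; simp
  add_smul s t φ := by ext m; simp [add_smul, map_add]
  zero_smul φ := by ext m; simp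

instance : IsScalarTower k Rᵐᵒᵖ (DualBimod k M) :=
  ⟨fun c s φ => by ext m; simp [smul_assoc, map_smul]⟩

end Right

instance [Algebra k R] [Algebra k S] [Module R M] [Module Sᵐᵒᵖ M] [IsScalarTower k R M]
    [IsScalarTower k Sᵐᵒᵖ M] [SMulCommClass R Sᵐᵒᵖ M] : SMulCommClass S Rᵐᵒᵖ (DualBimod k M) :=
  ⟨fun s r φ => by ext m; simp [smul_comm (unop r) (op s) m]⟩

end DualBimod

/-- The mate `(S DM; 0 R)` of the triangular matrix algebra `(R M; 0 S)`. -/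
abbrev Mate (k R S M : Type u) [Field k] [AddCommGroup M] [Module k M] : Type u :=
  TriMat S R (DualBimod k M)

/-! ### Derived equivalence -/

/-- Two rings are derived equivalent if the bounded derived categories of their right modules are
equivalent as triangulated categories. -/
def DerivedEquivalent (A B : Type u) [Ring A] [Ring B] : Prop :=
  letI := HasDerivedCategory.standard (ModuleCat.{u} Aᵐᵒᵖ)
  letI := HasDerivedCategory.standard (ModuleCat.{u} Bᵐᵒᵖ)
  ∃ (F : DerivedCategory.Bounded (ModuleCat.{u} Aᵐᵒᵖ) ⥤
      DerivedCategory.Bounded (ModuleCat.{u} Bᵐᵒᵖ)) (_ : F.CommShift ℤ),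
    F.IsTriangulated ∧ F.IsEquivalence

/-! ### Repetitive algebras -/

/-- The repetitive algebra of a `k`-algebra `A`: the `ℤ × ℤ`-matrices with finitely many nonzero
entries, whose entry at `(i, i)` is `diag i ∈ A`, whose entry at `(i, i + 1)` is `off i ∈ DA`, and
whose other entries vanish. -/
@[ext]
structure RepetitiveAlgebra (k A : Type u) [Field k] [Ring A] [Algebra k A] where
  /-- the diagonal entries -/
  diag : ℤ →₀ A
  /-- the entries above the diagonal -/
  off : ℤ →₀ DualBimod k A

namespace RepetitiveAlgebra

variable {k A : Type u} [Field k] [Ring A] [Algebra k A]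

instance : Zero (RepetitiveAlgebra k A) := ⟨⟨0, 0⟩⟩
noncomputable instance : Add (RepetitiveAlgebra k A) := ⟨fun x y => ⟨x.diag + y.diag, x.off + y.off⟩⟩
noncomputable instance : Neg (RepetitiveAlgebra k A) := ⟨fun x => ⟨-x.diag, -x.off⟩⟩
noncomputable instance : Sub (RepetitiveAlgebra k A) := ⟨fun x y => ⟨x.diag - y.diag, x.off - y.off⟩⟩
noncomputable instance : SMul ℕ (RepetitiveAlgebra k A) := ⟨fun n x => ⟨n • x.diag, n • x.off⟩⟩
noncomputable instance : SMul ℤ (RepetitiveAlgebra k A) := ⟨fun n x => ⟨n • x.diag, n • x.off⟩⟩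
noncomputable instance : SMul k (RepetitiveAlgebra k A) := ⟨fun c x => ⟨c • x.diag, c • x.off⟩⟩

/-- Matrix multiplication, with the products `A × DA → DA` and `DA × A → DA` given by the bimodule
structure of `DA`, and the product `DA × DA → 0`. -/
noncomputable instance : Mul (RepetitiveAlgebra k A) where
  mul x y :=
    { diag := x.diag * y.diag
      off := Finsupp.ofSupportFinite
        (fun i => x.diag i • y.off i + op (y.diag (i + 1)) • x.off i)
        ((x.off.support ∪ y.off.support).finite_toSet.subset (by
          intro i hi
          by_contra h
          simp only [Finset.coe_union, Set.mem_union, Finset.mem_coe, Finsupp.mem_support_iff,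
            not_or, not_not] at h
          exact hi (by simp [h.1, h.2]))) }

@[simp] lemma zero_diag : (0 : RepetitiveAlgebra k A).diag = 0 := rfl
@[simp] lemma zero_off : (0 : RepetitiveAlgebra k A).off = 0 := rfl
@[simp] lemma add_diag (x y : RepetitiveAlgebra k A) : (x + y).diag = x.diag + y.diag := rfl
@[simp] lemma add_off (x y : RepetitiveAlgebra k A) : (x + y).off = x.off + y.off := rfl
@[simp] lemma smul_diag (c : k) (x : RepetitiveAlgebra k A) : (c • x).diag = c • x.diag := rfl
@[simp] lemma smul_off (c : k) (x : RepetitiveAlgebra k A) : (c • x).off = c • x.off := rfl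
@[simp] lemma mul_diag (x y : RepetitiveAlgebra k A) : (x * y).diag = x.diag * y.diag := rfl
@[simp] lemma mul_off_apply (x y : RepetitiveAlgebra k A) (i : ℤ) :
    (x * y).off i = x.diag i • y.off i + op (y.diag (i + 1)) • x.off i := rfl

/-- The entries of a matrix in the repetitive algebra. -/
def toProd (x : RepetitiveAlgebra k A) : (ℤ →₀ A) × (ℤ →₀ DualBimod k A) := (x.diag, x.off)

lemma toProd_injective : Function.Injective (toProd (k := k) (A := A)) := by
  intro x y h
  simp only [toProd, Prod.mk.injEq] at h
  exact RepetitiveAlgebra.ext h.1 h.2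

noncomputable instance : AddCommGroup (RepetitiveAlgebra k A) :=
  toProd_injective.addCommGroup toProd rfl (fun _ _ => rfl) (fun _ => rfl) (fun _ _ => rfl)
    (fun _ _ => rfl) (fun _ _ => rfl)

noncomputable instance : Module k (RepetitiveAlgebra k A) :=
  toProd_injective.module k
    { toFun := toProd, map_zero' := rfl, map_add' := fun _ _ => rfl } (fun _ _ => rfl)

noncomputable instance : NonUnitalRing (RepetitiveAlgebra k A) where
  __ := (inferInstance : AddCommGroup (RepetitiveAlgebra k A))
  left_distrib x y z := by
    apply RepetitiveAlgebra.ext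
    · simp [mul_add]
    · apply Finsupp.ext
      intro i
      simp only [mul_off_apply, add_off, add_diag, Finsupp.add_apply, smul_add,
        MulOpposite.op_add, add_smul]
      abel
  right_distrib x y z := by
    apply RepetitiveAlgebra.ext
    · simp [add_mul]
    · apply Finsupp.ext
      intro i
      simp only [mul_off_apply, add_off, add_diag, Finsupp.add_apply, smul_add, add_smul]
      abel
  zero_mul x := by
    apply RepetitiveAlgebra.ext
    · simp
    · apply Finsupp.ext; intro i; simp
  mul_zero x := by
    apply RepetitiveAlgebra.ext
    · simp
    · apply Finsupp.ext; intro i; simp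
  mul_assoc x y z := by
    apply RepetitiveAlgebra.ext
    · simp [mul_assoc]
    · apply Finsupp.ext
      intro i
      simp only [mul_off_apply, mul_diag, Finsupp.mul_apply, smul_add, op_mul, mul_smul,
        smul_comm (x.diag i) (op (z.diag (i + 1))) (y.off i)]
      abel

instance : IsScalarTower k (RepetitiveAlgebra k A) (RepetitiveAlgebra k A) where
  smul_assoc c x y := by
    simp only [smul_eq_mul]
    apply RepetitiveAlgebra.ext
    · apply Finsupp.ext; intro i; simp
    · apply Finsupp.ext
      intro i
      simp only [mul_off_apply, smul_off, smul_diag, Finsupp.smul_apply, smul_add, smul_assoc,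
        smul_comm (op (y.diag (i + 1))) c]

instance : SMulCommClass k (RepetitiveAlgebra k A) (RepetitiveAlgebra k A) where
  smul_comm c x y := by
    simp only [smul_eq_mul]
    apply RepetitiveAlgebra.ext
    · apply Finsupp.ext; intro i; simp
    · apply Finsupp.ext
      intro i
      simp only [mul_off_apply, smul_off, smul_diag, Finsupp.smul_apply, smul_add, op_smul,
        smul_assoc, smul_comm (x.diag i) c]

end RepetitiveAlgebra

/-! ### Cartan matrices -/

/-- `C` is the Cartan matrix `C i j = dim_k Hom(P i, P j)` of the finite dimensional `k`-algebra `A`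
for some numbering `P` of the isomorphism classes of indecomposable projectives in the category of
finitely generated right `A`-modules. -/
def IsCartanMatrix (k A : Type u) [Field k] [Ring A] [Algebra k A] [Module.Finite k A] {n : ℕ}
    (C : Matrix (Fin n) (Fin n) ℤ) : Prop :=
  ∃ P : Fin n → ModuleCat.{u} Aᵐᵒᵖ,
    (∀ i, Module.Finite Aᵐᵒᵖ (P i) ∧ Projective (P i) ∧ Indecomposable (P i)) ∧
    (∀ i j, Nonempty (P i ≅ P j) → i = j) ∧
    (∀ Q : ModuleCat.{u} Aᵐᵒᵖ, Module.Finite Aᵐᵒᵖ Q → Projective Q → Indecomposable Q →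
      ∃ i, Nonempty (Q ≅ P i)) ∧
    ∀ i j, C i j = (Module.finrank k (P i ⟶ P j) : ℤ)

/-- Congruence of square matrices over `ℤ`. -/
def IntCongruent {n : ℕ} (C C' : Matrix (Fin n) (Fin n) ℤ) : Prop :=
  ∃ P : Matrix (Fin n) (Fin n) ℤ, IsUnit P ∧ P.transpose * C * P = C'

/-! ### The truncated polynomial algebras and their simple bimodule -/

/-- The algebra `k[x]/(x^n)`. -/
abbrev TruncPoly (k : Type u) [Field k] (n : ℕ) : Type u :=
  Polynomial k ⧸ Ideal.span {(Polynomial.X : Polynomial k) ^ n}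

/-- The algebra homomorphism `k[x]/(x^n) → k` that sends `x` to zero. -/
noncomputable def TruncPoly.aug (k : Type u) [Field k] (n : ℕ) [NeZero n] : TruncPoly k n →ₐ[k] k :=
  Ideal.Quotient.liftₐ _ (Polynomial.aeval (0 : k)) (by
    intro p hp
    obtain ⟨q, rfl⟩ := Ideal.mem_span_singleton.mp hp
    simp [NeZero.ne n])

instance (k : Type u) [Field k] (n : ℕ) : Module.Finite k (TruncPoly k n) :=
  (Polynomial.monic_X_pow n).finite_quotient

/-- The one-dimensional `k[x]/(x^n)`-`k[y]/(y^m)`-bimodule `k`, with `x` and `y` acting as zero. -/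
def SimpleBimod (k : Type u) (_n _m : ℕ) : Type u := k

namespace SimpleBimod

variable {k : Type u} [Field k] {n m : ℕ}

instance : AddCommGroup (SimpleBimod k n m) := inferInstanceAs (AddCommGroup k)
instance : Module k (SimpleBimod k n m) := inferInstanceAs (Module k k)
instance : Module.Finite k (SimpleBimod k n m) := inferInstanceAs (Module.Finite k k)

noncomputable instance [NeZero n] : Module (TruncPoly k n) (SimpleBimod k n m) :=
  Module.compHom k (TruncPoly.aug k n).toRingHom

noncomputable instance [NeZero m] : Module (TruncPoly k m)ᵐᵒᵖ (SimpleBimod k n m) :=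
  Module.compHom k ((TruncPoly.aug k m).toRingHom.fromOpposite fun _ _ => mul_comm _ _)

lemma left_smul_def [NeZero n] (r : TruncPoly k n) (c : SimpleBimod k n m) :
    r • c = TruncPoly.aug k n r • c := rfl

lemma right_smul_def [NeZero m] (s : (TruncPoly k m)ᵐᵒᵖ) (c : SimpleBimod k n m) :
    s • c = TruncPoly.aug k m (unop s) • c := rfl

instance [NeZero n] : IsScalarTower k (TruncPoly k n) (SimpleBimod k n m) :=
  ⟨fun c r v => by simp only [left_smul_def, map_smul, smul_assoc]⟩

instance [NeZero m] : IsScalarTower k (TruncPoly k m)ᵐᵒᵖ (SimpleBimod k n m) :=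
  ⟨fun c r v => by simp only [right_smul_def, unop_smul, map_smul, smul_assoc]⟩

instance [NeZero n] [NeZero m] :
    SMulCommClass (TruncPoly k n) (TruncPoly k m)ᵐᵒᵖ (SimpleBimod k n m) :=
  ⟨fun r s v => by rw [left_smul_def, right_smul_def, right_smul_def, left_smul_def, smul_comm]⟩

end SimpleBimod

/-- The triangular matrix algebra of `R = k[x]/(x^2)`, `S = k[y]/(y^3)` and `M = k`. -/
abbrev ExLambda (k : Type u) [Field k] : Type u :=
  TriMat (TruncPoly k 2) (TruncPoly k 3) (SimpleBimod k 2 3)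

/-- The mate of `ExLambda k`. -/
abbrev ExMate (k : Type u) [Field k] : Type u :=
  Mate k (TruncPoly k 2) (TruncPoly k 3) (SimpleBimod k 2 3)


/-!
The delicate point is that a derived equivalence `F` is only assumed to be triangulated, not
`k`-linear, so it does not visibly preserve dimensions. Let `P_i` be the indecomposable projectives
of `A = Λ`, let `T_i = F(P_i)`, and let `S_j`, `I_j` be the simple modules of the mate `B` and
their injective hulls. Since the `P_i` are small, `T_i` has finite-dimensional cohomology, and
dévissage over the simple modules expands the Euler form of `B` as
`χ(T_i, T_l) = ∑_{j, m} w_ij w_lm C_B(j, m)` with `w_ij = χ(T_i, S_j)`. On the other side,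
`Hom(T_i, Y)` is a module over the local ring `End(T_i) ≅ End(P_i)`, so its dimension is its
length, which `F` does preserve, times the dimension `δ_i` of the residue division ring of
`End(T_i)`. As the residue division rings of the `End(P_i)` are `k`, this gives
`dim Hom(T_i, T_l) = δ_i C_A(i, l)` and `w_ij = δ_i v_ij`, hence
`C_A(i, l) = δ_l ∑_{j, m} v_ij v_lm C_B(j, m)`.
For the two given matrices the off-diagonal entry `1` forces `δ_0 = 1`, so that `2` and `3 / δ_1`
are values of the form `3a² + ab + 2b²`. This form does not represent `1`, so `δ_1 = 1`, and it
represents `2` and `3` only trivially, which is incompatible with the off-diagonal entry `0`.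

The repetitive algebras agree because regrouping the `2 × 2` blocks of the bi-infinite matrix after
a shift by one vertex turns the entries `R, S, M, DR, DS, DM` over `Λ` into those over its mate.
-/
/-! ### Morphisms from projectives and to injectives in the derived category -/

section SingleComplex

open DerivedCategory CochainComplex.HomComplex

universe w v' u'

variable {C : Type u'} [Category.{v'} C] [Abelian C]

instance isKInjective_singleFunctor_obj (I : C) [Injective I] :
    ((CochainComplex.singleFunctor C 0).obj I).IsKInjective := by
  have injective_X (n : ℤ) : Injective (((CochainComplex.singleFunctor C 0).obj I).X n) := by
    by_cases hn : n = 0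
    · subst hn
      exact Injective.of_iso (HomologicalComplex.singleObjXSelf (.up ℤ) 0 I).symm inferInstance
    · exact (HomologicalComplex.isZero_single_obj_X (.up ℤ) 0 I n hn).injective
  exact CochainComplex.isKInjective_of_injective _ 0

instance isKProjective_singleFunctor_obj (P : C) [Projective P] :
    ((CochainComplex.singleFunctor C 0).obj P).IsKProjective := by
  have projective_X (n : ℤ) : Projective (((CochainComplex.singleFunctor C 0).obj P).X n) := by
    by_cases hn : n = 0
    · subst hn
      exact Projective.of_iso (HomologicalComplex.singleObjXSelf (.up ℤ) 0 P).symm inferInstance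
    · exact (HomologicalComplex.isZero_single_obj_X (.up ℤ) 0 P n hn).projective
  exact CochainComplex.isKProjective_of_projective _ 0

/-- The identification of the degree zero entry of the complex `A` concentrated in degree zero. -/
noncomputable def singleFunctorXIso (A : C) :
    ((CochainComplex.singleFunctor C 0).obj A).X 0 ≅ A :=
  HomologicalComplex.singleObjXSelf (.up ℤ) 0 A

lemma singleFunctor_obj_d (A : C) (i j : ℤ) :
    ((CochainComplex.singleFunctor C 0).obj A).d i j = 0 :=
  HomologicalComplex.single_obj_d (.up ℤ) 0 A i j

lemma singleFunctorXIso_inv_naturality {A B : C} (f : A ⟶ B) :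
    (singleFunctorXIso A).inv ≫ ((CochainComplex.singleFunctor C 0).map f).f 0 =
      f ≫ (singleFunctorXIso B).inv := by
  rw [Iso.inv_comp_eq]
  exact HomologicalComplex.single_map_f_self (.up ℤ) 0 f

instance isIso_pOpcycles_singleFunctor_obj (A : C) :
    IsIso (((CochainComplex.singleFunctor C 0).obj A).pOpcycles 0) :=
  HomologicalComplex.isIso_pOpcycles _ (-1) 0 (by simp) (singleFunctor_obj_d A _ _)

instance isIso_homologyπ_singleFunctor_obj (A : C) :
    IsIso (((CochainComplex.singleFunctor C 0).obj A).homologyπ 0) :=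
  HomologicalComplex.isIso_homologyπ _ (-1) 0 (by simp) (singleFunctor_obj_d A _ _)

instance isIso_homologyι_singleFunctor_obj (A : C) :
    IsIso (((CochainComplex.singleFunctor C 0).obj A).homologyι 0) :=
  HomologicalComplex.isIso_homologyι _ 0 1 (by simp) (singleFunctor_obj_d A _ _)

lemma nonempty_homotopy_zero_of_toSingle {K : CochainComplex C ℤ} {A : C}
    (f : K ⟶ (CochainComplex.singleFunctor C 0).obj A) (g : K.X 1 ⟶ A)
    (hfg : f.f 0 ≫ (singleFunctorXIso A).hom = K.d 0 1 ≫ g) : Nonempty (Homotopy f 0) := by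
  refine ⟨(Cochain.equivHomotopy f 0).symm ⟨Cochain.toSingleMk g (by norm_num), ?_⟩⟩
  rw [Cochain.δ_toSingleMk g _ 0 0 (by norm_num)]
  apply (Cochain.toSingleEquiv (add_zero (0 : ℤ))).injective
  rw [← hfg]
  simp only [Int.negOnePow_zero, one_smul, Cochain.ofHom_zero, add_zero,
    Cochain.toSingleEquiv_toSingleMk]
  exact congrArg (· ≫ (singleFunctorXIso A).hom) (Cochain.ofHom_v f 0)

lemma nonempty_homotopy_zero_of_fromSingle {K : CochainComplex C ℤ} {A : C}
    (f : (CochainComplex.singleFunctor C 0).obj A ⟶ K) (g : A ⟶ K.X (-1))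
    (hfg : (singleFunctorXIso A).inv ≫ f.f 0 = g ≫ K.d (-1) 0) : Nonempty (Homotopy f 0) := by
  refine ⟨(Cochain.equivHomotopy f 0).symm ⟨Cochain.fromSingleMk g (by norm_num), ?_⟩⟩
  rw [Cochain.δ_fromSingleMk g _ 0 0 (by norm_num)]
  apply (Cochain.fromSingleEquiv (add_zero (0 : ℤ))).injective
  rw [← hfg]
  simp only [Cochain.ofHom_zero, add_zero, Cochain.fromSingleEquiv_fromSingleMk]
  exact congrArg ((singleFunctorXIso A).inv ≫ ·) (Cochain.ofHom_v f 0)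

lemma nonempty_homotopy_zero_of_homologyMap_eq_zero_of_injective {K : CochainComplex C ℤ} {I : C}
    [Injective I] (f : K ⟶ (CochainComplex.singleFunctor C 0).obj I)
    (hf : HomologicalComplex.homologyMap f 0 = 0) : Nonempty (Homotopy f 0) := by
  have cyclesMap_eq_zero : HomologicalComplex.cyclesMap f 0 = 0 := by
    rw [← cancel_mono (((CochainComplex.singleFunctor C 0).obj I).homologyπ 0),
      ← HomologicalComplex.homologyπ_naturality, hf, Limits.comp_zero, Limits.zero_comp]
  let S : ShortComplex C := ShortComplex.mk (K.iCycles 0) (K.d 0 1) (by simp)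
  have hS : S.Exact := S.exact_of_f_is_kernel (K.cyclesIsKernel 0 1 (by simp))
  have vanishes_on_cycles : S.f ≫ f.f 0 ≫ (singleFunctorXIso I).hom = 0 := by
    change K.iCycles 0 ≫ _ = 0
    rw [← HomologicalComplex.cyclesMap_i_assoc, cyclesMap_eq_zero, Limits.zero_comp]
  exact nonempty_homotopy_zero_of_toSingle f (hS.descToInjective _ vanishes_on_cycles)
    (hS.comp_descToInjective _ vanishes_on_cycles).symm

lemma nonempty_homotopy_zero_of_homologyMap_eq_zero_of_projective {K : CochainComplex C ℤ} {P : C}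
    [Projective P] (f : (CochainComplex.singleFunctor C 0).obj P ⟶ K)
    (hf : HomologicalComplex.homologyMap f 0 = 0) : Nonempty (Homotopy f 0) := by
  have opcyclesMap_eq_zero : HomologicalComplex.opcyclesMap f 0 = 0 := by
    rw [← cancel_epi (((CochainComplex.singleFunctor C 0).obj P).homologyι 0),
      ← HomologicalComplex.homologyι_naturality, hf, Limits.comp_zero, Limits.zero_comp]
  let S : ShortComplex C := ShortComplex.mk (K.d (-1) 0) (K.pOpcycles 0) (by simp)
  have hS : S.Exact := S.exact_of_g_is_cokernel (K.opcyclesIsCokernel (-1) 0 (by simp))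
  have vanishes_in_opcycles : ((singleFunctorXIso P).inv ≫ f.f 0) ≫ S.g = 0 := by
    change (_ ≫ f.f 0) ≫ K.pOpcycles 0 = 0
    rw [Category.assoc, ← HomologicalComplex.p_opcyclesMap, opcyclesMap_eq_zero,
      Limits.comp_zero, Limits.comp_zero]
  exact nonempty_homotopy_zero_of_fromSingle f (hS.liftFromProjective _ vanishes_in_opcycles)
    (hS.liftFromProjective_comp _ vanishes_in_opcycles).symm

lemma exists_f_zero_eq_pOpcycles_comp {K : CochainComplex C ℤ} {A : C}
    (h : K.opcycles 0 ⟶ ((CochainComplex.singleFunctor C 0).obj A).X 0) :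
    ∃ f : K ⟶ (CochainComplex.singleFunctor C 0).obj A, f.f 0 = K.pOpcycles 0 ≫ h := by
  refine ⟨HomologicalComplex.mkHomToSingle (K.pOpcycles 0 ≫ h ≫ (singleFunctorXIso A).hom)
    (fun i _ => by simp), (HomologicalComplex.mkHomToSingle_f _ _).trans ?_⟩
  change (_ ≫ _ ≫ (singleFunctorXIso A).hom) ≫ (singleFunctorXIso A).inv = _
  simp

lemma exists_homologyMap_eq_of_injective {K : CochainComplex C ℤ} {I : C} [Injective I]
    (ψ : K.homology 0 ⟶ ((CochainComplex.singleFunctor C 0).obj I).homology 0) :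
    ∃ f : K ⟶ (CochainComplex.singleFunctor C 0).obj I,
      HomologicalComplex.homologyMap f 0 = ψ := by
  let L := (CochainComplex.singleFunctor C 0).obj I
  have : Injective (L.X 0) := Injective.of_iso (singleFunctorXIso I).symm inferInstance
  obtain ⟨h, hh⟩ : ∃ h : K.opcycles 0 ⟶ L.X 0,
      K.homologyι 0 ≫ h = ψ ≫ L.homologyι 0 ≫ inv (L.pOpcycles 0) :=
    ⟨_, Injective.comp_factorThru _ _⟩
  obtain ⟨f, hf⟩ := exists_f_zero_eq_pOpcycles_comp h
  have opcyclesMap_eq : HomologicalComplex.opcyclesMap f 0 = h ≫ L.pOpcycles 0 := by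
    rw [← cancel_epi (K.pOpcycles 0), HomologicalComplex.p_opcyclesMap, hf, Category.assoc]
  refine ⟨f, ?_⟩
  rw [← cancel_mono (L.homologyι 0), HomologicalComplex.homologyι_naturality, opcyclesMap_eq,
    reassoc_of% hh]
  simp

variable [HasDerivedCategory.{w} C]

lemma exists_Q_map_eq_of_Qh_map_surjective {K L : CochainComplex C ℤ}
    (h : Function.Surjective (Qh.map (C := HomotopyCategory C (.up ℤ))
      (X := (HomotopyCategory.quotient _ _).obj K) (Y := (HomotopyCategory.quotient _ _).obj L)))
    (g : Q.obj K ⟶ Q.obj L) : ∃ f : K ⟶ L, Q.map f = g := by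
  obtain ⟨g', hg'⟩ := h ((quotientCompQhIso C).hom.app K ≫ g ≫ (quotientCompQhIso C).inv.app L)
  obtain ⟨f, rfl⟩ := (HomotopyCategory.quotient _ _).map_surjective g'
  refine ⟨f, ?_⟩
  have naturality := (quotientCompQhIso C).hom.naturality f
  rw [Functor.comp_map, hg'] at naturality
  simpa using naturality.symm

lemma exists_Q_map_eq_of_isKInjective {K L : CochainComplex C ℤ} [L.IsKInjective]
    (g : Q.obj K ⟶ Q.obj L) : ∃ f : K ⟶ L, Q.map f = g :=
  exists_Q_map_eq_of_Qh_map_surjective (CochainComplex.IsKInjective.Qh_map_bijective _ L).2 g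

lemma exists_Q_map_eq_of_isKProjective {K L : CochainComplex C ℤ} [K.IsKProjective]
    (g : Q.obj K ⟶ Q.obj L) : ∃ f : K ⟶ L, Q.map f = g :=
  exists_Q_map_eq_of_Qh_map_surjective (CochainComplex.IsKProjective.Qh_map_bijective K _).2 g

/-- The cohomology of the image of a complex in the derived category. -/
noncomputable def homologyQIso (K : CochainComplex C ℤ) (n : ℤ) :
    (homologyFunctor C n).obj (Q.obj K) ≅ K.homology n :=
  (homologyFunctorFactors C n).app K

lemma homologyFunctor_map_Q_map {K L : CochainComplex C ℤ} (f : K ⟶ L) (n : ℤ) :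
    (homologyFunctor C n).map (Q.map f) =
      (homologyQIso K n).hom ≫ HomologicalComplex.homologyMap f n ≫ (homologyQIso L n).inv :=
  (NatIso.naturality_2 (homologyFunctorFactors C n) f).symm

lemma homologyMap_eq_zero_of_homologyFunctor_map_Q_map {K L : CochainComplex C ℤ} {f : K ⟶ L}
    {n : ℤ} (hf : (homologyFunctor C n).map (Q.map f) = 0) :
    HomologicalComplex.homologyMap f n = 0 := by
  simpa [homologyFunctor_map_Q_map] using hf

lemma eq_zero_of_homologyFunctor_map_eq_zero_of_injective {Y : DerivedCategory C} {I : C}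
    [Injective I] (g : Y ⟶ (singleFunctor C 0).obj I) (hg : (homologyFunctor C 0).map g = 0) :
    g = 0 := by
  let e := Q.objObjPreimageIso Y
  let ε : (singleFunctor C 0).obj I ≅ Q.obj ((CochainComplex.singleFunctor C 0).obj I) :=
    (singleFunctorIsoCompQ C 0).app I
  obtain ⟨f, hf⟩ := exists_Q_map_eq_of_isKInjective (e.hom ≫ g ≫ ε.hom)
  have homologyMap_f : HomologicalComplex.homologyMap f 0 = 0 :=
    homologyMap_eq_zero_of_homologyFunctor_map_Q_map (by simp [hf, hg])
  obtain ⟨h⟩ := nonempty_homotopy_zero_of_homologyMap_eq_zero_of_injective f homologyMap_f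
  have hf_zero : e.hom ≫ g ≫ ε.hom = 0 := by
    rw [← hf, DerivedCategory.Q_map_eq_of_homotopy C h, Functor.map_zero]
  simpa using hf_zero

lemma eq_zero_of_homologyFunctor_map_eq_zero_of_projective {Y : DerivedCategory C} {P : C}
    [Projective P] (g : (singleFunctor C 0).obj P ⟶ Y) (hg : (homologyFunctor C 0).map g = 0) :
    g = 0 := by
  let e := Q.objObjPreimageIso Y
  let ε : (singleFunctor C 0).obj P ≅ Q.obj ((CochainComplex.singleFunctor C 0).obj P) :=
    (singleFunctorIsoCompQ C 0).app P
  obtain ⟨f, hf⟩ := exists_Q_map_eq_of_isKProjective (ε.inv ≫ g ≫ e.inv)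
  have homologyMap_f : HomologicalComplex.homologyMap f 0 = 0 :=
    homologyMap_eq_zero_of_homologyFunctor_map_Q_map (by simp [hf, hg])
  obtain ⟨h⟩ := nonempty_homotopy_zero_of_homologyMap_eq_zero_of_projective f homologyMap_f
  have hf_zero : ε.inv ≫ g ≫ e.inv = 0 := by
    rw [← hf, DerivedCategory.Q_map_eq_of_homotopy C h, Functor.map_zero]
  simpa using hf_zero

lemma exists_homologyFunctor_map_eq_of_injective {Y : DerivedCategory C} {I : C} [Injective I]
    (φ : (homologyFunctor C 0).obj Y ⟶ (homologyFunctor C 0).obj ((singleFunctor C 0).obj I)) :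
    ∃ g : Y ⟶ (singleFunctor C 0).obj I, (homologyFunctor C 0).map g = φ := by
  let e := Q.objObjPreimageIso Y
  let ε : (singleFunctor C 0).obj I ≅ Q.obj ((CochainComplex.singleFunctor C 0).obj I) :=
    (singleFunctorIsoCompQ C 0).app I
  obtain ⟨f, hf⟩ := exists_homologyMap_eq_of_injective
    ((homologyQIso _ 0).inv ≫ ((homologyFunctor C 0).map e.hom ≫ φ ≫
      (homologyFunctor C 0).map ε.hom) ≫ (homologyQIso _ 0).hom)
  refine ⟨e.inv ≫ Q.map f ≫ ε.inv, ?_⟩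
  rw [Functor.map_comp, Functor.map_comp, homologyFunctor_map_Q_map, hf]
  simp only [Category.assoc, Iso.hom_inv_id_assoc]
  rw [← Functor.map_comp, ← Functor.map_comp_assoc]
  simp

end SingleComplex
/-! ### Coinduced modules -/

/-- The coinduced module `Hom_k(R, V)` of a `k`-vector space `V`. It is injective, and every
`R`-module `N` embeds into `Coind k R N`. -/
def Coind (k R V : Type u) [Field k] [Ring R] [Algebra k R] [AddCommGroup V] [Module k V] :
    Type u := R →ₗ[k] V

namespace Coind

variable {k R V W : Type u} [Field k] [Ring R] [Algebra k R] [AddCommGroup V] [Module k V]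
  [AddCommGroup W] [Module k W]

instance : AddCommGroup (Coind k R V) := inferInstanceAs (AddCommGroup (R →ₗ[k] V))
instance : Module k (Coind k R V) := inferInstanceAs (Module k (R →ₗ[k] V))
instance : FunLike (Coind k R V) R V := inferInstanceAs (FunLike (R →ₗ[k] V) R V)
instance : LinearMapClass (Coind k R V) k R V :=
  inferInstanceAs (LinearMapClass (R →ₗ[k] V) k R V)
instance [Module.Finite k R] [Module.Finite k V] : Module.Finite k (Coind k R V) :=
  inferInstanceAs (Module.Finite k (R →ₗ[k] V))

@[ext] lemma ext {φ ψ : Coind k R V} (h : ∀ x, φ x = ψ x) : φ = ψ := DFunLike.ext _ _ h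

@[simp] lemma zero_apply (x : R) : (0 : Coind k R V) x = 0 := rfl
@[simp] lemma add_apply (φ ψ : Coind k R V) (x : R) : (φ + ψ) x = φ x + ψ x := rfl
@[simp] lemma base_smul_apply (c : k) (φ : Coind k R V) (x : R) : (c • φ) x = c • φ x := rfl
lemma sum_apply {ι : Type*} (s : Finset ι) (φ : ι → Coind k R V) (x : R) :
    (∑ i ∈ s, φ i) x = ∑ i ∈ s, φ i x :=
  LinearMap.sum_apply s (fun i => (φ i : R →ₗ[k] V)) x

instance : SMul R (Coind k R V) := ⟨fun r φ => (φ : R →ₗ[k] V) ∘ₗ LinearMap.mulRight k r⟩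

@[simp] lemma smul_apply (r : R) (φ : Coind k R V) (x : R) : (r • φ) x = φ (x * r) := rfl

instance : Module R (Coind k R V) where
  one_smul φ := by ext; simp
  mul_smul r s φ := by ext; simp [mul_assoc]
  smul_zero r := by ext; simp
  smul_add r φ ψ := by ext; simp
  add_smul r s φ := by ext; simp [mul_add]
  zero_smul φ := by ext; simp

instance : IsScalarTower k R (Coind k R V) := ⟨fun c r φ => by ext; simp⟩

/-- The adjunct `n ↦ (x ↦ ψ (x n))` of a `k`-linear map `ψ`. -/
def lift {N : Type*} [AddCommGroup N] [Module k N] [Module R N] [IsScalarTower k R N]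
    (ψ : N →ₗ[k] V) : N →ₗ[R] Coind k R V where
  toFun n := ψ ∘ₗ (LinearMap.toSpanSingleton R N n).restrictScalars k
  map_add' m n := by ext x; exact (congrArg ψ (smul_add x m n)).trans (map_add ψ _ _)
  map_smul' r n := by ext x; exact congrArg ψ (smul_smul x r n)

@[simp] lemma lift_apply {N : Type*} [AddCommGroup N] [Module k N] [Module R N]
    [IsScalarTower k R N] (ψ : N →ₗ[k] V) (n : N) (x : R) : lift ψ n x = ψ (x • n) := rfl

lemma lift_id_injective {N : Type u} [AddCommGroup N] [Module k N] [Module R N]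
    [IsScalarTower k R N] :
    Function.Injective (lift (LinearMap.id : N →ₗ[k] N) : N →ₗ[R] Coind k R N) := by
  intro m n h
  simpa using DFunLike.congr_fun h (1 : R)

/-- Postcomposition with a `k`-linear map. -/
def map (f : V →ₗ[k] W) : Coind k R V →ₗ[R] Coind k R W where
  toFun φ := f ∘ₗ (φ : R →ₗ[k] V)
  map_add' φ ψ := by ext x; exact map_add f _ _
  map_smul' r φ := by ext x; rfl

variable (k R V) in
/-- The counit `φ ↦ φ 1` of the adjunction between restriction and coinduction. -/
def evalOne : Coind k R V →ₗ[k] V where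
  toFun φ := φ 1
  map_add' _ _ := rfl
  map_smul' _ _ := rfl

@[simp]
lemma evalOne_apply (φ : Coind k R V) : evalOne k R V φ = φ 1 := rfl

instance injective : Module.Injective R (Coind k R V) where
  out X Y _ _ _ _ f hf g := by
    let : Module k X := Module.compHom X (algebraMap k R)
    let : Module k Y := Module.compHom Y (algebraMap k R)
    have : IsScalarTower k R X := IsScalarTower.of_compHom k R X
    have : IsScalarTower k R Y := IsScalarTower.of_compHom k R Y
    obtain ⟨retraction, hretraction⟩ :=
      LinearMap.exists_leftInverse_of_injective (f.restrictScalars k) (LinearMap.ker_eq_bot.mpr hf)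
    refine ⟨lift (evalOne k R V ∘ₗ g.restrictScalars k ∘ₗ retraction), fun x => ?_⟩
    ext r
    have retraction_smul : retraction (r • f x) = r • x := by
      rw [← map_smul]
      exact LinearMap.congr_fun hretraction (r • x)
    simp [retraction_smul]

instance : Injective (ModuleCat.of R (Coind k R V)) :=
  Module.injective_object_of_injective_module R _

variable (k R) in
/-- The projection of `Hom_k(R, k^(ℕ))` to its `n`-th summand `Hom_k(R, k)`. -/
noncomputable def component (n : ℕ) : Module.End R (Coind k R (ℕ →₀ k)) :=
  map (Finsupp.lsingle n ∘ₗ Finsupp.lapply n)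

@[simp] lemma component_apply (n : ℕ) (φ : Coind k R (ℕ →₀ k)) (x : R) :
    component k R n φ x = Finsupp.single n (φ x n) := rfl

lemma orthogonalIdempotents_component : OrthogonalIdempotents (component k R) where
  idem n := by ext; simp
  ortho m n hmn := by ext; simp [hmn.symm]

variable [Module.Finite k R]

lemma exists_forall_support_subset (φ : Coind k R (ℕ →₀ k)) :
    ∃ s : Finset ℕ, ∀ x, (φ x).support ⊆ s := by
  classical
  obtain ⟨t, ht⟩ := (inferInstance : Module.Finite k R).fg_top
  refine ⟨t.biUnion fun x => (φ x).support, fun x => ?_⟩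
  have hx : x ∈ Submodule.span k (t : Set R) := ht ▸ Submodule.mem_top
  induction hx using Submodule.span_induction with
  | mem x hx => exact Finset.subset_biUnion_of_mem (fun x => (φ x).support) hx
  | zero => simp
  | add x y _ _ hx hy =>
    rw [map_add]
    exact Finsupp.support_add.trans (Finset.union_subset hx hy)
  | smul c x _ hx =>
    rw [map_smul]
    exact Finsupp.support_smul.trans hx

lemma finite_setOf_component_ne_zero (φ : Coind k R (ℕ →₀ k)) :
    {n | component k R n φ ≠ 0}.Finite := by
  obtain ⟨s, hs⟩ := exists_forall_support_subset φ
  refine s.finite_toSet.subset fun n hn => by_contra fun hns => hn ?_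
  ext1 x
  rw [component_apply, Finsupp.notMem_support_iff.1 fun h => hns (hs x h), Finsupp.single_zero,
    zero_apply]

lemma exists_eq_sum_component (φ : Coind k R (ℕ →₀ k)) :
    ∃ s : Finset ℕ, φ = ∑ n ∈ s, component k R n φ := by
  obtain ⟨s, hs⟩ := exists_forall_support_subset φ
  refine ⟨s, ?_⟩
  ext1 x
  rw [sum_apply]
  exact (Finsupp.sum_single _).symm.trans (Finsupp.sum_of_support_subset _ (hs x) _ (by simp))

lemma hom_eq_zero_of_forall_component {N : Type*} [AddCommGroup N] [Module R N]
    (t : Coind k R (ℕ →₀ k) →ₗ[R] N) (ht : ∀ n φ, t (component k R n φ) = 0) : t = 0 := by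
  ext φ
  obtain ⟨s, hs⟩ := exists_eq_sum_component φ
  rw [hs, map_sum]
  simp [ht]

end Coind

lemma exists_linearMap_comp_eq_of_locally_finite {R J N : Type*} [Ring R] [AddCommGroup J]
    [Module R J] [AddCommGroup N] [Module R N] {e : ℕ → Module.End R J}
    (he : OrthogonalIdempotents e) (hfin : ∀ x, {n | e n x ≠ 0}.Finite) (s : ℕ → (J →ₗ[R] N)) :
    ∃ t : J →ₗ[R] N, ∀ n x, t (e n x) = s n (e n x) := by
  have finite_support (x : J) : (Function.support fun n => s n (e n x)).Finite :=
    (hfin x).subset fun n hn h => hn (by simp only [h, map_zero])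
  refine ⟨{ toFun := fun x => ∑ᶠ n, s n (e n x), map_add' := ?_, map_smul' := ?_ }, ?_⟩
  · intro x y
    simp only [map_add]
    exact finsum_add_distrib (finite_support x) (finite_support y)
  · intro r x
    simp only [map_smul, RingHom.id_apply]
    exact (smul_finsum' r (finite_support x)).symm
  · intro n x
    have comp_eq_zero (m : ℕ) (hm : m ≠ n) : e m (e n x) = 0 :=
      LinearMap.congr_fun (he.ortho hm) x
    have comp_self : e n (e n x) = e n x := LinearMap.congr_fun (he.idem n) x
    change ∑ᶠ m, s m (e m (e n x)) = _
    rw [finsum_eq_single _ n (fun m hm => by rw [comp_eq_zero m hm, map_zero]), comp_self]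

lemma exists_linearMap_finsupp_apply_ne_zero {k V : Type*} [Field k] [AddCommGroup V] [Module k V]
    (hV : ¬ Module.Finite k V) : ∃ ψ : V →ₗ[k] (ℕ →₀ k), ∀ n, ∃ x, ψ x n ≠ 0 := by
  let b := Module.Basis.ofVectorSpace k V
  have : Infinite (Module.Basis.ofVectorSpaceIndex k V) := by
    rw [← not_finite_iff_infinite]
    exact fun _ => hV (Module.Finite.of_basis b)
  let ι := Infinite.natEmbedding (Module.Basis.ofVectorSpaceIndex k V)
  exact ⟨Finsupp.lcomapDomain ι ι.injective ∘ₗ b.repr.toLinearMap, fun n => ⟨b (ι n), by simp⟩⟩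

/-! ### Small objects -/

section SmallObject

variable {D D' : Type*} [Category D] [Category D'] [Preadditive D] [Preadditive D']

/-- The ring homomorphism on endomorphisms induced by an additive functor. -/
def mapEndRingHom (F : D ⥤ D') [F.Additive] (X : D) : End X →+* End (F.obj X) where
  __ := F.mapEnd X
  map_zero' := F.map_zero X X
  map_add' _ _ := F.map_add

lemma mapEndRingHom_bijective (F : D ⥤ D') [F.Additive] [F.Full] [F.Faithful] (X : D) :
    Function.Bijective (mapEndRingHom F X) :=
  ⟨F.map_injective, F.map_surjective⟩

/-- Endomorphisms `e n` of `Y` are jointly epic if a morphism from `Y` vanishes as soon as its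
composites with all `e n` do. Orthogonal idempotents with this property make `Y` resemble the
coproduct of their images, which need not exist in a bounded derived category. -/
def IsJointlyEpic {Y : D} (e : ℕ → End Y) : Prop :=
  ∀ ⦃Z : D⦄ (g : Y ⟶ Z), (∀ n, e n ≫ g = 0) → g = 0

/-- An object `X` is small if every morphism from `X` to an object which resembles a countable
coproduct has only finitely many nonzero components. -/
def IsSmallObject (X : D) : Prop :=
  ∀ ⦃Y : D⦄ (e : ℕ → End Y), OrthogonalIdempotents e → IsJointlyEpic e →
    ∀ f : X ⟶ Y, {n | f ≫ e n ≠ 0}.Finite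

lemma IsSmallObject.map (F : D ⥤ D') [F.IsEquivalence] [F.Additive] {X : D}
    (hX : IsSmallObject X) : IsSmallObject (F.obj X) := by
  intro Y e he hepi f
  let ε : F.obj (F.objPreimage Y) ≅ Y := F.objObjPreimageIso Y
  let e' (n : ℕ) : End (F.objPreimage Y) := F.preimage (ε.hom ≫ e n ≫ ε.inv)
  have map_e' (n : ℕ) : F.map (e' n) = ε.hom ≫ e n ≫ ε.inv := F.map_preimage _
  have comp_self (n : ℕ) : e n ≫ e n = e n := he.idem n
  have comp_of_ne {m n : ℕ} (hmn : m ≠ n) : e n ≫ e m = 0 := he.ortho hmn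
  have he' : OrthogonalIdempotents e' :=
    { idem := fun n => F.map_injective (by simp [End.mul_def, map_e', reassoc_of% comp_self n])
      ortho := fun m n hmn =>
        F.map_injective (by simp [End.mul_def, map_e', reassoc_of% comp_of_ne hmn]) }
  have hepi' : IsJointlyEpic e' := by
    intro Z g hg
    have comp_map_g (n : ℕ) : e n ≫ ε.inv ≫ F.map g = 0 := by
      rw [← cancel_epi ε.hom, ← Category.assoc (e n), ← Category.assoc, ← map_e', ← F.map_comp,
        hg, F.map_zero, Limits.comp_zero]
    exact F.map_injective (by simpa using hepi _ comp_map_g)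
  refine (hX e' he' hepi' (F.preimage (f ≫ ε.inv))).subset fun n hn hn' => hn ?_
  have f_comp_e_comp : (f ≫ e n) ≫ ε.inv = 0 := by simpa [map_e'] using congrArg F.map hn'
  rwa [← cancel_mono ε.inv, Limits.zero_comp]

end SmallObject

section BoundedDerived

open DerivedCategory

universe w v' u'

variable {C : Type u'} [Category.{v'} C] [Abelian C] [HasDerivedCategory.{w} C]

variable (C) in
/-- The embedding of an abelian category in its bounded derived category as the complexes
concentrated in degree zero. -/
noncomputable def boundedSingleFunctor : C ⥤ Bounded C :=
  TStructure.t.bounded.lift (singleFunctor C 0) fun _ => ⟨⟨0, inferInstance⟩, ⟨0, inferInstance⟩⟩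

instance : (boundedSingleFunctor C).Full where
  map_surjective g := by
    obtain ⟨f, hf⟩ := (singleFunctor C 0).map_surjective g.hom
    exact ⟨f, ObjectProperty.hom_ext _ hf⟩

instance : (boundedSingleFunctor C).Faithful where
  map_injective h := (singleFunctor C 0).map_injective (congrArg (fun f => f.hom) h)

instance : (boundedSingleFunctor C).Additive where
  map_add := ObjectProperty.hom_ext _ (singleFunctor C 0).map_add

lemma exists_comp_d_of_Q_map_eq_zero {K : CochainComplex C ℤ} [K.IsKInjective] {A : C}
    {f : (CochainComplex.singleFunctor C 0).obj A ⟶ K} (hf : Q.map f = 0) :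
    ∃ g : A ⟶ K.X (-1), (singleFunctorXIso A).inv ≫ f.f 0 = g ≫ K.d (-1) 0 := by
  have quotient_map_f : (HomotopyCategory.quotient C (.up ℤ)).map f =
      (HomotopyCategory.quotient C (.up ℤ)).map 0 := by
    apply (CochainComplex.IsKInjective.Qh_map_bijective _ K).1
    have naturality := (quotientCompQhIso C).hom.naturality f
    rw [Functor.comp_map, hf, Limits.comp_zero] at naturality
    rw [Functor.map_zero, Functor.map_zero,
      ← cancel_mono ((quotientCompQhIso C).hom.app K), Limits.zero_comp]
    exact naturality
  have h := HomotopyCategory.homotopyOfEq _ _ quotient_map_f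
  refine ⟨(singleFunctorXIso A).inv ≫ h.hom 0 (-1), ?_⟩
  rw [h.comm 0, dNext_eq h.hom (show (ComplexShape.up ℤ).Rel 0 1 by simp),
    prevD_eq h.hom (show (ComplexShape.up ℤ).Rel (-1) 0 by simp), singleFunctor_obj_d]
  simp

lemma exists_iso_Q_obj_of_isGE_of_enoughInjectives [EnoughInjectives C] (Z : DerivedCategory C)
    (a : ℤ) [Z.IsGE a] : ∃ L : CochainComplex C ℤ, L.IsKInjective ∧ Nonempty (Z ≅ Q.obj L) := by
  obtain ⟨K, _, ⟨i⟩⟩ := exists_iso_Q_obj_of_isGE Z a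
  obtain ⟨L, q, _, _, _⟩ :=
    CochainComplex.Plus.modelCategoryQuillen.exists_quasiIso_injective K a
  exact ⟨L, CochainComplex.isKInjective_of_injective L a, ⟨i ≪≫ asIso (Q.map q)⟩⟩

lemma isJointlyEpic_boundedSingleFunctor_map [EnoughInjectives C] {J : C} {e : ℕ → End J}
    (idem : ∀ n, IsIdempotentElem (e n)) (hepi : IsJointlyEpic e)
    (hdesc : ∀ ⦃N : C⦄ (s : ℕ → (J ⟶ N)), ∃ t : J ⟶ N, ∀ n, e n ≫ t = e n ≫ s n) :
    IsJointlyEpic fun n => mapEndRingHom (boundedSingleFunctor C) J (e n) := by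
  intro Z g hg
  obtain ⟨a, _⟩ : ∃ a : ℤ, Z.obj.IsGE a := Z.property.1
  obtain ⟨L, _, ⟨i⟩⟩ := exists_iso_Q_obj_of_isGE_of_enoughInjectives Z.obj a
  let ε : (singleFunctor C 0).obj J ≅ Q.obj ((CochainComplex.singleFunctor C 0).obj J) :=
    (singleFunctorIsoCompQ C 0).app J
  let g' : (singleFunctor C 0).obj J ⟶ Z.obj := g.hom
  have e_comp_g (n : ℕ) : (singleFunctor C 0).map (e n) ≫ g' = 0 :=
    congrArg (fun t => t.hom) (hg n)
  have ε_naturality (n : ℕ) : Q.map ((CochainComplex.singleFunctor C 0).map (e n)) ≫ ε.inv =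
      ε.inv ≫ (singleFunctor C 0).map (e n) :=
    (singleFunctorIsoCompQ C 0).inv.naturality (e n)
  obtain ⟨f, hf⟩ := exists_Q_map_eq_of_isKInjective (ε.inv ≫ g' ≫ i.hom)
  have Q_map_e_comp_f (n : ℕ) : Q.map ((CochainComplex.singleFunctor C 0).map (e n) ≫ f) = 0 := by
    rw [Q.map_comp, hf, reassoc_of% ε_naturality n, reassoc_of% e_comp_g n, Limits.zero_comp,
      Limits.comp_zero]
  choose s hs using fun n => exists_comp_d_of_Q_map_eq_zero (Q_map_e_comp_f n)
  have e_comp_f (n : ℕ) : e n ≫ (singleFunctorXIso J).inv ≫ f.f 0 = s n ≫ L.d (-1) 0 := by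
    rw [← hs n, HomologicalComplex.comp_f, ← Category.assoc, ← Category.assoc,
      ← singleFunctorXIso_inv_naturality]
  obtain ⟨t, ht⟩ := hdesc s
  have f_eq : (singleFunctorXIso J).inv ≫ f.f 0 = t ≫ L.d (-1) 0 := by
    refine sub_eq_zero.1 (hepi _ fun n => ?_)
    have idem_comp : e n ≫ e n = e n := idem n
    rw [Preadditive.comp_sub, e_comp_f, ← Category.assoc (e n) t, ht, Category.assoc, ← e_comp_f,
      reassoc_of% idem_comp, sub_self]
  obtain ⟨h⟩ := nonempty_homotopy_zero_of_fromSingle f t f_eq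
  rw [DerivedCategory.Q_map_eq_of_homotopy C h, Functor.map_zero] at hf
  have g'_eq_zero : g' = 0 := by
    rw [← cancel_mono i.hom, ← cancel_epi ε.inv, ← hf, Limits.zero_comp, Limits.comp_zero]
  exact ObjectProperty.hom_ext _ g'_eq_zero

end BoundedDerived

section BoundedModules

open DerivedCategory

universe w

variable {R : Type u} [Ring R] [HasDerivedCategory.{w} (ModuleCat.{u} R)]

lemma iSup_range_homologyFunctor_map_eq_top {Y : Bounded (ModuleCat.{u} R)} {e : ℕ → End Y}
    (hepi : IsJointlyEpic e) :
    ⨆ n, LinearMap.range ((Bounded.ι ⋙ homologyFunctor (ModuleCat.{u} R) 0).map (e n)).hom = ⊤ := by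
  let H := homologyFunctor (ModuleCat.{u} R) 0
  let N : Submodule R (H.obj Y.obj) := ⨆ n, LinearMap.range (H.map (e n).hom).hom
  let q : H.obj Y.obj ⟶ ModuleCat.of R (H.obj Y.obj ⧸ N) := ModuleCat.ofHom N.mkQ
  let I := Injective.under (ModuleCat.of R (H.obj Y.obj ⧸ N))
  let j : I ≅ H.obj ((singleFunctor _ 0).obj I) :=
    ((singleFunctorCompHomologyFunctorIso (ModuleCat.{u} R) 0).app I).symm
  obtain ⟨g, hg⟩ := exists_homologyFunctor_map_eq_of_injective (q ≫ Injective.ι _ ≫ j.hom)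
  have e_comp_q (n : ℕ) : H.map (e n).hom ≫ q = 0 := by
    ext x
    exact (Submodule.Quotient.mk_eq_zero N).2
      (Submodule.mem_iSup_of_mem n ⟨x, rfl⟩)
  have g_eq_zero : (ObjectProperty.homMk g : Y ⟶ (boundedSingleFunctor _).obj I) = 0 := by
    refine hepi _ fun n => ObjectProperty.hom_ext _ ?_
    refine eq_zero_of_homologyFunctor_map_eq_zero_of_injective _ ?_
    refine (H.map_comp _ g).trans ?_
    rw [hg]
    exact (reassoc_of% e_comp_q n) _ |>.trans Limits.zero_comp
  have q_eq_zero : q = 0 := by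
    rw [← cancel_mono (Injective.ι _ ≫ j.hom), ← hg, show g = 0 from congrArg (·.hom) g_eq_zero,
      Functor.map_zero, Limits.zero_comp]
  have mkQ_eq_zero : N.mkQ = 0 := congrArg ModuleCat.Hom.hom q_eq_zero
  exact N.ker_mkQ.symm.trans (mkQ_eq_zero ▸ LinearMap.ker_zero)

lemma isSmallObject_boundedSingleFunctor_obj (P : ModuleCat.{u} R) [Projective P]
    [Module.Finite R P] : IsSmallObject ((boundedSingleFunctor _).obj P) := by
  intro Y e he hepi f
  let H := Bounded.ι ⋙ homologyFunctor (ModuleCat.{u} R) 0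
  have : Module.Finite R (H.obj ((boundedSingleFunctor _).obj P)) :=
    Module.Finite.equiv (M := P)
      ((singleFunctorCompHomologyFunctorIso (ModuleCat.{u} R) 0).app P).symm.toLinearEquiv
  have range_fg : (LinearMap.range (H.map f).hom).FG :=
    LinearMap.range_eq_map (H.map f).hom ▸ Module.Finite.fg_top.map _
  obtain ⟨s, hs⟩ := CompleteLattice.IsCompactElement.exists_finset_of_le_iSup _
    ((Submodule.fg_iff_compact _).1 range_fg) (fun n => LinearMap.range (H.map (e n)).hom)
    (le_top.trans (iSup_range_homologyFunctor_map_eq_top hepi).ge)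
  refine s.finite_toSet.subset fun n hn => by_contra fun hns => hn ?_
  have iSup_le_ker :
      ⨆ m ∈ s, LinearMap.range (H.map (e m)).hom ≤ LinearMap.ker (H.map (e n)).hom := by
    refine iSup₂_le fun m hm => LinearMap.range_le_ker_iff.2 ?_
    have comp_eq_zero : e m ≫ e n = 0 := he.ortho fun h => hns (h ▸ hm)
    exact congrArg ModuleCat.Hom.hom
      ((H.map_comp _ _).symm.trans ((congrArg H.map comp_eq_zero).trans (H.map_zero _ _)))
  have map_comp_eq_zero : H.map (f ≫ e n) = 0 := by
    rw [H.map_comp]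
    exact ModuleCat.hom_ext (LinearMap.range_le_ker_iff.1 (hs.trans iSup_le_ker))
  exact ObjectProperty.hom_ext _
    (eq_zero_of_homologyFunctor_map_eq_zero_of_projective (f ≫ e n).hom map_comp_eq_zero)

end BoundedModules

section Coinduced

variable (k R : Type u) [Field k] [Ring R] [Algebra k R]

/-- The injective `R`-module `Hom_k(R, k^(ℕ))`, which resembles a countable coproduct of copies of
`Hom_k(R, k)` also in the bounded derived category. -/
noncomputable abbrev coindFinsupp : ModuleCat.{u} R := ModuleCat.of R (Coind k R (ℕ →₀ k))

/-- The projections of `coindFinsupp k R` to its summands. -/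
noncomputable def coindFinsuppProj (n : ℕ) : End (coindFinsupp k R) :=
  ModuleCat.ofHom (Coind.component k R n)

variable {k R} [Module.Finite k R]

omit [Module.Finite k R] in
lemma orthogonalIdempotents_coindFinsuppProj : OrthogonalIdempotents (coindFinsuppProj k R) :=
  (Coind.orthogonalIdempotents_component (k := k) (R := R)).map
    (ModuleCat.endRingEquiv (coindFinsupp k R)).symm.toRingHom

lemma isJointlyEpic_coindFinsuppProj : IsJointlyEpic (coindFinsuppProj k R) :=
  fun _ t ht => ModuleCat.hom_ext (Coind.hom_eq_zero_of_forall_component t.hom fun n φ =>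
    congrArg (fun f => f.hom φ) (ht n))

lemma exists_coindFinsuppProj_comp_eq ⦃N : ModuleCat.{u} R⦄ (s : ℕ → (coindFinsupp k R ⟶ N)) :
    ∃ t : coindFinsupp k R ⟶ N, ∀ n, coindFinsuppProj k R n ≫ t = coindFinsuppProj k R n ≫ s n := by
  obtain ⟨t, ht⟩ := exists_linearMap_comp_eq_of_locally_finite
    (Coind.orthogonalIdempotents_component (k := k) (R := R))
    Coind.finite_setOf_component_ne_zero (fun n => (s n).hom)
  exact ⟨ModuleCat.ofHom t, fun n => by ext φ : 2; exact ht n φ⟩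

end Coinduced

section FiniteCohomology

open DerivedCategory

universe w

lemma finite_homologyFunctor_obj_of_isSmallObject (k : Type u) {R : Type u} [Field k] [Ring R]
    [Algebra k R] [Module.Finite k R] [HasDerivedCategory.{w} (ModuleCat.{u} R)]
    {X : Bounded (ModuleCat.{u} R)} (hX : IsSmallObject X) :
    Module.Finite R ((homologyFunctor (ModuleCat.{u} R) 0).obj X.obj) := by
  let H := homologyFunctor (ModuleCat.{u} R) 0
  let : Module k (H.obj X.obj) := ModuleCat.moduleOfAlgebraModule _
  have : IsScalarTower k R (H.obj X.obj) := ModuleCat.isScalarTower_of_algebra_moduleCat _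
  suffices Module.Finite k (H.obj X.obj) from Module.Finite.of_restrictScalars_finite k R _
  by_contra infinite
  obtain ⟨ψ, hψ⟩ := exists_linearMap_finsupp_apply_ne_zero infinite
  let S := singleFunctor (ModuleCat.{u} R) 0
  let j : coindFinsupp k R ≅ H.obj (S.obj (coindFinsupp k R)) :=
    ((singleFunctorCompHomologyFunctorIso (ModuleCat.{u} R) 0).app _).symm
  have j_naturality (n : ℕ) :
      j.hom ≫ H.map (S.map (coindFinsuppProj k R n)) = coindFinsuppProj k R n ≫ j.hom :=
    ((singleFunctorCompHomologyFunctorIso (ModuleCat.{u} R) 0).inv.naturality _).symm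
  let φ : H.obj X.obj ⟶ coindFinsupp k R := ModuleCat.ofHom (Coind.lift ψ)
  obtain ⟨g, hg⟩ := exists_homologyFunctor_map_eq_of_injective (φ ≫ j.hom)
  have finite_components := hX _
    (orthogonalIdempotents_coindFinsuppProj.map (mapEndRingHom (boundedSingleFunctor _) _))
    (isJointlyEpic_boundedSingleFunctor_map orthogonalIdempotents_coindFinsuppProj.idem
      isJointlyEpic_coindFinsuppProj exists_coindFinsuppProj_comp_eq) (ObjectProperty.homMk g)
  refine Set.infinite_univ (finite_components.subset fun n _ h => ?_)
  have g_comp_eq_zero : g ≫ S.map (coindFinsuppProj k R n) = 0 := congrArg (fun t => t.hom) h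
  have φ_comp_eq_zero : φ ≫ coindFinsuppProj k R n = 0 := by
    rw [← cancel_mono j.hom, Category.assoc, ← j_naturality n, ← Category.assoc, ← hg,
      ← H.map_comp, g_comp_eq_zero, H.map_zero, Limits.zero_comp]
  obtain ⟨x, hx⟩ := hψ n
  have component_eq_zero : Coind.component k R n (Coind.lift ψ x) = 0 :=
    congrArg (fun f => f.hom x) φ_comp_eq_zero
  exact hx (by simpa using DFunLike.congr_fun (DFunLike.congr_fun component_eq_zero 1) n)

end FiniteCohomology

/-! ### Euler forms of triangulated categories -/

section AlternatingSum

/-- The finitely supported sequence `a` of dimensions of a graded vector space has alternating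
sum `s`. -/
def HasAltSum (a : ℤ → ℕ) (s : ℤ) : Prop :=
  a.support.Finite ∧ ∑ᶠ n : ℤ, (n.negOnePow : ℤ) * (a n : ℤ) = s

variable {a b c r : ℤ → ℕ} {s t : ℤ}

lemma HasAltSum.unique (hs : HasAltSum a s) (ht : HasAltSum a t) : s = t :=
  hs.2.symm.trans ht.2

lemma HasAltSum.finite_support_mul (hs : HasAltSum a s) :
    (Function.support fun n : ℤ => (n.negOnePow : ℤ) * (a n : ℤ)).Finite :=
  hs.1.subset fun n hn h => hn (by simp [h])

lemma HasAltSum.shift (hs : HasAltSum a s) (m : ℤ) :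
    HasAltSum (fun n => a (n + m)) ((m.negOnePow : ℤ) * s) := by
  refine ⟨(hs.1.preimage (add_left_injective m).injOn).subset fun _ hn => hn, ?_⟩
  rw [← hs.2, ← finsum_comp_equiv (Equiv.addRight m) (f := fun n : ℤ => (n.negOnePow : ℤ) * a n)]
  rcases Int.units_eq_one_or m.negOnePow with hm | hm
  · simp [Int.negOnePow_add, hm]
  · simp [Int.negOnePow_add, hm, finsum_neg_distrib]

lemma HasAltSum.exists_of_le (hs : HasAltSum a s) (hba : ∀ n, b n ≤ a n) : ∃ t, HasAltSum b t :=
  ⟨_, hs.1.subset fun n hn h => hn (Nat.le_zero.1 (h ▸ hba n)), rfl⟩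

lemma HasAltSum.dvd (hs : HasAltSum a s) {d : ℕ} (h : ∀ n, d ∣ a n) : (d : ℤ) ∣ s :=
  hs.2 ▸ finsum_induction ((d : ℤ) ∣ ·) (dvd_zero _) (fun _ _ => dvd_add)
    fun n => (Int.natCast_dvd_natCast.2 (h n)).mul_left _

lemma HasAltSum.of_add_eq_add (ha : HasAltSum a s) (hc : HasAltSum c t) (hra : ∀ n, r n ≤ a n)
    (h : ∀ n, b n + r n + r (n + 1) = a n + c n) : HasAltSum b (s + t) := by
  have finite_support : b.support.Finite := (ha.1.union hc.1).subset fun n hn => by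
    by_contra hac
    simp only [Set.mem_union, Function.mem_support, not_or, not_not] at hac
    exact hn (by have := h n; omega)
  obtain ⟨u, hr⟩ := ha.exists_of_le hra
  have hr' := hr.shift 1
  have hb : HasAltSum b _ := ⟨finite_support, rfl⟩
  refine ⟨finite_support, ?_⟩
  have sum_eq : (∑ᶠ n : ℤ, (n.negOnePow : ℤ) * (b n : ℤ)) + (u + -u) = s + t := by
    rw [← ha.2, ← hc.2, show -u = ((1 : ℤ).negOnePow : ℤ) * u by simp, ← hr'.2, ← hr.2,
      ← finsum_add_distrib hr.finite_support_mul hr'.finite_support_mul,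
      ← finsum_add_distrib ha.finite_support_mul hc.finite_support_mul,
      ← finsum_add_distrib hb.finite_support_mul
        ((hr.finite_support_mul.union hr'.finite_support_mul).subset (Function.support_add _ _))]
    refine finsum_congr fun n => ?_
    have dim_eq : (b n : ℤ) + r n + r (n + 1) = a n + c n := by exact_mod_cast h n
    linear_combination (n.negOnePow : ℤ) * dim_eq
  simpa using sum_eq

lemma hasAltSum_of_concentrated (h : ∀ n, n ≠ 0 → a n = 0) : HasAltSum a (a 0) := by
  refine ⟨(Set.finite_singleton (0 : ℤ)).subset fun n hn => by_contra fun h0 => hn (h n h0), ?_⟩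
  rw [finsum_eq_single _ 0 fun n hn => by simp [h n hn]]
  simp

end AlternatingSum

lemma finite_of_function_exact {R A B C : Type*} [Ring R] [IsNoetherianRing R] [AddCommGroup A]
    [AddCommGroup B] [AddCommGroup C] [Module R A] [Module R B] [Module R C] {f : A →ₗ[R] B}
    {g : B →ₗ[R] C} (h : Function.Exact f g) (_ : Module.Finite R A) (_ : Module.Finite R C) :
    Module.Finite R B :=
  .of_exact (g := g.rangeRestrict)
    (LinearMap.exact_iff.2 (g.ker_rangeRestrict.trans (LinearMap.exact_iff.1 h)))
    g.surjective_rangeRestrict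

lemma hasAltSum_finrank_of_exact {k : Type*} [Field k] {A B C : ℤ → Type*}
    [∀ n, AddCommGroup (A n)] [∀ n, AddCommGroup (B n)] [∀ n, AddCommGroup (C n)]
    [∀ n, Module k (A n)] [∀ n, Module k (B n)] [∀ n, Module k (C n)] {f : ∀ n, A n →ₗ[k] B n}
    {g : ∀ n, B n →ₗ[k] C n} {d : ∀ n, C n →ₗ[k] A (n + 1)}
    (hfg : ∀ n, Function.Exact (f n) (g n)) (hgd : ∀ n, Function.Exact (g n) (d n))
    (hdf : ∀ n, Function.Exact (d n) (f (n + 1))) [∀ n, Module.Finite k (A n)]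
    [∀ n, Module.Finite k (B n)] [∀ n, Module.Finite k (C n)] {s t : ℤ}
    (hA : HasAltSum (fun n => Module.finrank k (A n)) s)
    (hC : HasAltSum (fun n => Module.finrank k (C n)) t) :
    HasAltSum (fun n => Module.finrank k (B n)) (s + t) := by
  refine hA.of_add_eq_add (r := fun n => Module.finrank k (LinearMap.ker (f n))) hC
    (fun n => Submodule.finrank_le _) fun n => ?_
  have rank_nullity_f := (f n).finrank_range_add_finrank_ker
  have rank_nullity_g := (g n).finrank_range_add_finrank_ker
  have rank_nullity_d := (d n).finrank_range_add_finrank_ker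
  rw [LinearMap.exact_iff.1 (hfg n)] at rank_nullity_g
  rw [LinearMap.exact_iff.1 (hgd n), ← LinearMap.exact_iff.1 (hdf n)] at rank_nullity_d
  omega

section EulerForm

open Pretriangulated Limits

variable (k : Type*) [Field k] {D : Type*} [Category D] [Preadditive D] [Linear k D]
  [HasShift D ℤ]

/-- The morphisms from `X` to all shifts of `Y` form a finite dimensional graded vector space with
Euler characteristic `χ`. -/
def HasEulerChar (X Y : D) (χ : ℤ) : Prop :=
  (∀ n : ℤ, Module.Finite k (X ⟶ Y⟦n⟧)) ∧
    HasAltSum (fun n : ℤ => Module.finrank k (X ⟶ Y⟦n⟧)) χ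

variable {k} {X X' Y Y' : D} {χ : ℤ}

lemma HasEulerChar.unique {χ' : ℤ} (h : HasEulerChar k X Y χ) (h' : HasEulerChar k X Y χ') :
    χ = χ' :=
  HasAltSum.unique h.2 h'.2

lemma HasEulerChar.of_linearEquiv_shift (h : HasEulerChar k X Y χ) (m : ℤ)
    (e : ∀ n : ℤ, (X ⟶ Y⟦n + m⟧) ≃ₗ[k] (X' ⟶ Y'⟦n⟧)) :
    HasEulerChar k X' Y' ((m.negOnePow : ℤ) * χ) :=
  ⟨fun n => have := h.1 (n + m); Module.Finite.equiv (e n),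
    by simpa only [(e _).finrank_eq] using h.2.shift m⟩

lemma HasEulerChar.of_linearEquiv (h : HasEulerChar k X Y χ)
    (e : ∀ n : ℤ, (X ⟶ Y⟦n⟧) ≃ₗ[k] (X' ⟶ Y'⟦n⟧)) : HasEulerChar k X' Y' χ :=
  ⟨fun n => have := h.1 n; Module.Finite.equiv (e n),
    by simpa only [(e _).finrank_eq] using h.2⟩

lemma HasEulerChar.of_iso_right (h : HasEulerChar k X Y χ) (e : Y ≅ Y') : HasEulerChar k X Y' χ :=
  h.of_linearEquiv fun n => Linear.homCongr k (Iso.refl X) ((shiftFunctor D n).mapIso e)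

lemma HasEulerChar.of_iso_left (h : HasEulerChar k X Y χ) (e : X ≅ X') : HasEulerChar k X' Y χ :=
  h.of_linearEquiv fun _ => Linear.homCongr k e (Iso.refl _)

lemma HasEulerChar.shift_right (h : HasEulerChar k X Y χ) (m : ℤ) :
    HasEulerChar k X (Y⟦m⟧) ((m.negOnePow : ℤ) * χ) :=
  h.of_linearEquiv_shift m fun n => Linear.homCongr k (Iso.refl X)
    ((shiftFunctorAdd' D m n (n + m) (add_comm _ _)).app Y)

section

variable [∀ n : ℤ, (shiftFunctor D n).Additive] [∀ n : ℤ, (shiftFunctor D n).Linear k]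

variable (k) in
/-- Moving a shift from the target to the source of a morphism. -/
noncomputable def homShiftEquiv (X Y : D) {a m n : ℤ} (h : m + a = n) :
    (X ⟶ Y⟦m⟧) ≃ₗ[k] (X⟦a⟧ ⟶ Y⟦n⟧) :=
  LinearEquiv.ofBijective ((shiftFunctor D a).mapLinearMap k)
    ⟨(shiftFunctor D a).map_injective, (shiftFunctor D a).map_surjective⟩ ≪≫ₗ
    Linear.homCongr k (Iso.refl _) ((shiftFunctorAdd' D m a n h).symm.app Y)

lemma HasEulerChar.shift_left (h : HasEulerChar k X Y χ) (m : ℤ) :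
    HasEulerChar k (X⟦m⟧) Y ((m.negOnePow : ℤ) * χ) := by
  have := h.of_linearEquiv_shift (-m) fun n => homShiftEquiv k X Y (neg_add_cancel_right n m)
  rwa [Int.negOnePow_neg] at this

end

lemma hasEulerChar_of_concentrated (h : ∀ n : ℤ, n ≠ 0 → ∀ f : X ⟶ Y⟦n⟧, f = 0)
    [Module.Finite k (X ⟶ Y)] : HasEulerChar k X Y (Module.finrank k (X ⟶ Y)) := by
  let e : (X ⟶ Y) ≃ₗ[k] (X ⟶ Y⟦(0 : ℤ)⟧) :=
    Linear.homCongr k (Iso.refl X) ((shiftFunctorZero D ℤ).symm.app Y)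
  have subsingleton_hom (n : ℤ) (hn : n ≠ 0) : Subsingleton (X ⟶ Y⟦n⟧) :=
    ⟨fun f g => (h n hn f).trans (h n hn g).symm⟩
  refine ⟨fun n => ?_, ?_⟩
  · obtain rfl | hn := eq_or_ne n 0
    · exact Module.Finite.equiv e
    · have := subsingleton_hom n hn
      infer_instance
  · rw [e.finrank_eq]
    refine hasAltSum_of_concentrated fun n hn => ?_
    have := subsingleton_hom n hn
    exact Module.finrank_zero_of_subsingleton

lemma hasEulerChar_zero_of_subsingleton (h : ∀ n : ℤ, Subsingleton (X ⟶ Y⟦n⟧)) :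
    HasEulerChar k X Y 0 :=
  ⟨fun n => have := h n; inferInstance, by
    simpa [Module.finrank_zero_of_subsingleton] using
      hasAltSum_of_concentrated (a := fun _ => 0) fun _ _ => rfl⟩

section Triangle

variable [HasZeroObject D] [∀ n : ℤ, (shiftFunctor D n).Additive] [Pretriangulated D]
  {T : Triangle D}

lemma exact_rightComp_mor₁_mor₂ (X : D) (hT : T ∈ distTriang D) (n : ℤ) :
    Function.Exact (Linear.rightComp k X (T.mor₁⟦n⟧')) (Linear.rightComp k X (T.mor₂⟦n⟧')) :=
  (ShortComplex.ab_exact_iff_function_exact _).1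
    ((preadditiveCoyoneda.obj (Opposite.op X)).homologySequence_exact₂ T hT n)

lemma exact_rightComp_mor₂_mor₃ (X : D) (hT : T ∈ distTriang D) (n : ℤ) :
    Function.Exact (Linear.rightComp k X (T.mor₂⟦n⟧')) (Linear.rightComp k X
      (T.mor₃⟦n⟧' ≫ (shiftFunctorAdd' D 1 n (n + 1) (by omega)).inv.app _)) := by
  intro x
  refine Iff.trans ?_ ((ShortComplex.ab_exact_iff_function_exact _).1
    ((preadditiveCoyoneda.obj (Opposite.op X)).homologySequence_exact₃ T hT n _ rfl) x)
  exact Eq.congr (preadditiveCoyoneda_homologySequenceδ_apply T n _ rfl (A := Opposite.op X) x).symm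
    rfl

lemma exact_rightComp_mor₃_mor₁ (X : D) (hT : T ∈ distTriang D) (n : ℤ) :
    Function.Exact (Linear.rightComp k X
      (T.mor₃⟦n⟧' ≫ (shiftFunctorAdd' D 1 n (n + 1) (by omega)).inv.app _))
      (Linear.rightComp k X (T.mor₁⟦n + 1⟧')) := by
  intro x
  refine ((ShortComplex.ab_exact_iff_function_exact _).1
    ((preadditiveCoyoneda.obj (Opposite.op X)).homologySequence_exact₁ T hT n _ rfl) x).trans ?_
  exact exists_congr fun y =>
    Eq.congr (preadditiveCoyoneda_homologySequenceδ_apply T n _ rfl (A := Opposite.op X) y) rfl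

lemma HasEulerChar.triangle_right {χ₁ χ₃ : ℤ} (h₁ : HasEulerChar k X T.obj₁ χ₁)
    (h₃ : HasEulerChar k X T.obj₃ χ₃) (hT : T ∈ distTriang D) :
    HasEulerChar k X T.obj₂ (χ₁ + χ₃) := by
  have := h₁.1
  have := h₃.1
  have finite_hom (n : ℤ) : Module.Finite k (X ⟶ T.obj₂⟦n⟧) :=
    finite_of_function_exact (exact_rightComp_mor₁_mor₂ (k := k) X hT n) (h₁.1 n) (h₃.1 n)
  exact ⟨finite_hom, hasAltSum_finrank_of_exact (exact_rightComp_mor₁_mor₂ (k := k) X hT)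
    (exact_rightComp_mor₂_mor₃ X hT) (exact_rightComp_mor₃_mor₁ X hT) h₁.2 h₃.2⟩

variable [∀ n : ℤ, (shiftFunctor D n).Linear k]

variable (k T) in
/-- The connecting map of the contravariant long exact sequence of a triangle. -/
noncomputable def leftConnecting (Y : D) (n : ℤ) :
    (T.obj₁ ⟶ Y⟦n⟧) →ₗ[k] (T.obj₃ ⟶ Y⟦n + 1⟧) :=
  Linear.rightComp k _ ((shiftFunctorAdd' D n 1 (n + 1) rfl).inv.app Y) ∘ₗ
    Linear.leftComp k _ T.mor₃ ∘ₗ (shiftFunctor D (1 : ℤ)).mapLinearMap k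

omit [HasZeroObject D] [Pretriangulated D] in
lemma leftConnecting_apply (Y : D) (n : ℤ) (x : T.obj₁ ⟶ Y⟦n⟧) :
    leftConnecting k T Y n x =
      (T.mor₃ ≫ x⟦(1 : ℤ)⟧') ≫ (shiftFunctorAdd' D n 1 (n + 1) rfl).inv.app Y := rfl

omit [∀ n : ℤ, (shiftFunctor D n).Linear k] in
lemma exact_leftComp_mor₂_mor₁ (Y : D) (hT : T ∈ distTriang D) :
    Function.Exact (Linear.leftComp k Y T.mor₂) (Linear.leftComp k Y T.mor₁) := by
  intro x
  constructor
  · intro hx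
    obtain ⟨g, hg⟩ := T.yoneda_exact₂ hT x hx
    exact ⟨g, hg.symm⟩
  · rintro ⟨g, rfl⟩
    change T.mor₁ ≫ T.mor₂ ≫ g = 0
    rw [comp_distTriang_mor_zero₁₂_assoc _ hT, zero_comp]

lemma exact_leftComp_mor₁_leftConnecting (Y : D) (hT : T ∈ distTriang D) (n : ℤ) :
    Function.Exact (Linear.leftComp k (Y⟦n⟧) T.mor₁) (leftConnecting k T Y n) := by
  intro x
  rw [leftConnecting_apply]
  constructor
  · intro hx
    have mor₃_comp : T.mor₃ ≫ x⟦(1 : ℤ)⟧' = 0 := by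
      rw [← cancel_mono ((shiftFunctorAdd' D n 1 (n + 1) rfl).inv.app Y), hx, zero_comp]
    obtain ⟨g, hg⟩ := Triangle.yoneda_exact₃ _ (rot_of_distTriang _ hT) (x⟦(1 : ℤ)⟧') mor₃_comp
    obtain ⟨g', rfl⟩ : ∃ g' : T.obj₂ ⟶ Y⟦n⟧, g'⟦(1 : ℤ)⟧' = g :=
      (shiftFunctor D (1 : ℤ)).map_surjective g
    refine ⟨-g', (shiftFunctor D (1 : ℤ)).map_injective ?_⟩
    change (T.mor₁ ≫ (-g'))⟦(1 : ℤ)⟧' = _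
    rw [hg]
    change _ = (-T.mor₁⟦(1 : ℤ)⟧') ≫ g'⟦(1 : ℤ)⟧'
    simp only [Preadditive.comp_neg, Functor.map_neg, Functor.map_comp, Preadditive.neg_comp]
  · rintro ⟨g, rfl⟩
    change (T.mor₃ ≫ (T.mor₁ ≫ g)⟦(1 : ℤ)⟧') ≫ _ = 0
    rw [Functor.map_comp, comp_distTriang_mor_zero₃₁_assoc _ hT, zero_comp, zero_comp]

lemma exact_leftConnecting_leftComp_mor₂ (Y : D) (hT : T ∈ distTriang D) (n : ℤ) :
    Function.Exact (leftConnecting k T Y n) (Linear.leftComp k (Y⟦n + 1⟧) T.mor₂) := by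
  intro x
  constructor
  · intro hx
    obtain ⟨g, hg⟩ := T.yoneda_exact₃ hT x hx
    obtain ⟨g', hg'⟩ := (shiftFunctor D (1 : ℤ)).map_surjective
      (g ≫ (shiftFunctorAdd' D n 1 (n + 1) rfl).hom.app Y)
    refine ⟨g', ?_⟩
    rw [leftConnecting_apply, hg']
    simp [hg]
  · rintro ⟨g, rfl⟩
    rw [leftConnecting_apply]
    change T.mor₂ ≫ _ = 0
    rw [Category.assoc, comp_distTriang_mor_zero₂₃_assoc _ hT, zero_comp]

lemma HasEulerChar.triangle_left {χ₁ χ₃ : ℤ} (h₁ : HasEulerChar k T.obj₁ Y χ₁)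
    (h₃ : HasEulerChar k T.obj₃ Y χ₃) (hT : T ∈ distTriang D) :
    HasEulerChar k T.obj₂ Y (χ₁ + χ₃) := by
  have := h₁.1
  have := h₃.1
  have finite_hom (n : ℤ) : Module.Finite k (T.obj₂ ⟶ Y⟦n⟧) :=
    finite_of_function_exact (exact_leftComp_mor₂_mor₁ (k := k) (Y⟦n⟧) hT) (h₃.1 n) (h₁.1 n)
  refine ⟨finite_hom, add_comm χ₃ χ₁ ▸ ?_⟩
  exact hasAltSum_finrank_of_exact (fun n => exact_leftComp_mor₂_mor₁ (k := k) (Y⟦n⟧) hT)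
    (exact_leftComp_mor₁_leftConnecting Y hT) (exact_leftConnecting_leftComp_mor₂ Y hT) h₃.2 h₁.2

end Triangle

end EulerForm

/-! ### Dévissage in the bounded derived category -/

section Truncation

open DerivedCategory Pretriangulated Limits

universe w v' u'

variable {C : Type u'} [Category.{v'} C] [Abelian C] [HasDerivedCategory.{w} C]
  {X₁ X₂ X₃ : DerivedCategory C} {f : X₁ ⟶ X₂} {g : X₂ ⟶ X₃} {h : X₃ ⟶ X₁⟦(1 : ℤ)⟧}

lemma isIso_homologyFunctor_map_mor₁ (hT : Triangle.mk f g h ∈ distTriang _) {a i : ℤ}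
    [X₃.IsGE (a + 1)] (hi : i ≤ a) : IsIso ((homologyFunctor C i).map f) := by
  have : Mono ((homologyFunctor C i).map f) :=
    (HomologySequence.mono_homologyMap_mor₁_iff _ hT (i - 1) i).2
      ((isZero_of_isGE X₃ (a + 1) (i - 1) (by omega)).eq_of_src _ _)
  have : Epi ((homologyFunctor C i).map f) :=
    (HomologySequence.epi_homologyMap_mor₁_iff _ hT i).2
      ((isZero_of_isGE X₃ (a + 1) i (by omega)).eq_of_tgt _ _)
  exact isIso_of_mono_of_epi _

lemma isIso_homologyFunctor_map_mor₂ (hT : Triangle.mk f g h ∈ distTriang _) {a i : ℤ}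
    [X₁.IsLE a] (hi : a < i) : IsIso ((homologyFunctor C i).map g) := by
  have : Mono ((homologyFunctor C i).map g) :=
    (HomologySequence.mono_homologyMap_mor₂_iff _ hT i).2
      ((isZero_of_isLE X₁ a i hi).eq_of_src _ _)
  have : Epi ((homologyFunctor C i).map g) :=
    (HomologySequence.epi_homologyMap_mor₂_iff _ hT i (i + 1)).2
      ((isZero_of_isLE X₁ a (i + 1) (by omega)).eq_of_tgt _ _)
  exact isIso_of_mono_of_epi _

variable (P : ObjectProperty (DerivedCategory C)) [P.IsTriangulated] [P.IsClosedUnderIsomorphisms]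

lemma prop_of_isGE_of_isLE_self {X : DerivedCategory C} {a : ℤ} [X.IsGE a] [X.IsLE a]
    (hX : P ((singleFunctor C 0).obj ((homologyFunctor C a).obj X))) : P X := by
  obtain ⟨M, ⟨e⟩⟩ := exists_iso_singleFunctor_obj_of_isGE_of_isLE X a
  have homologyIso : (homologyFunctor C a).obj X ≅ M :=
    (homologyFunctor C a).mapIso e ≪≫ (singleFunctorCompHomologyFunctorIso C a).app M
  have shiftIso : ((singleFunctor C 0).obj M)⟦-a⟧ ≅ X :=
    ((singleFunctors C).shiftIso (-a) a 0 (by omega)).app M ≪≫ e.symm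
  exact P.prop_of_iso shiftIso
    (P.le_shift (-a) _ (P.prop_of_iso ((singleFunctor C 0).mapIso homologyIso) hX))

lemma prop_of_forall_homology {X : DerivedCategory C} {a b : ℤ} [X.IsGE a] [X.IsLE b]
    (hX : ∀ n, P ((singleFunctor C 0).obj ((homologyFunctor C n).obj X))) : P X := by
  obtain ⟨m, hm⟩ : ∃ m : ℕ, b ≤ a - 1 + m := ⟨(b - a + 1).toNat, by omega⟩
  have isLE : X.IsLE (a - 1 + m) := TStructure.t.isLE_of_le X b _ hm
  clear! b
  induction m generalizing X a with
  | zero =>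
    have : X.IsLE (a - 1) := by simpa using isLE
    exact P.prop_of_isZero (TStructure.t.isZero X (a - 1) a (by omega))
  | succ m ih =>
    obtain ⟨X₁, X₂, hX₁, hX₂, f, g, h, hT⟩ := TStructure.t.exists_triangle X a (a + 1) rfl
    have : X₁.IsLE a := ⟨hX₁⟩
    have : X₂.IsGE (a + 1) := ⟨hX₂⟩
    have iso₁ {i : ℤ} (hi : i ≤ a) : (homologyFunctor C i).obj X₁ ≅ (homologyFunctor C i).obj X :=
      have := isIso_homologyFunctor_map_mor₁ hT hi
      asIso ((homologyFunctor C i).map f)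
    have iso₂ {i : ℤ} (hi : a < i) : (homologyFunctor C i).obj X ≅ (homologyFunctor C i).obj X₂ :=
      have := isIso_homologyFunctor_map_mor₂ hT hi
      asIso ((homologyFunctor C i).map g)
    have : X₁.IsGE a :=
      (isGE_iff X₁ a).2 fun i hi => (isZero_of_isGE X a i hi).of_iso (iso₁ hi.le)
    have isLE₂ : X₂.IsLE (a + 1 - 1 + m) := by
      refine (isLE_iff X₂ _).2 fun i hi => ?_
      exact (isZero_of_isLE X (a - 1 + (m + 1 : ℕ)) i (by push_cast; omega)).of_iso
        (iso₂ (by omega)).symm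
    refine P.ext_of_isTriangulatedClosed₂ _ hT (prop_of_isGE_of_isLE_self P (X := X₁) (a := a) ?_)
      (ih (X := X₂) (fun n => ?_) isLE₂)
    · exact P.prop_of_iso ((singleFunctor C 0).mapIso (iso₁ le_rfl).symm) (hX a)
    · obtain hn | hn := lt_or_ge a n
      · exact P.prop_of_iso ((singleFunctor C 0).mapIso (iso₂ hn)) (hX n)
      · exact P.prop_of_isZero
          (Functor.map_isZero _ (isZero_of_isGE X₂ (a + 1) n (by omega)))

end Truncation

section FiniteLength

open DerivedCategory Pretriangulated

universe w

variable {R : Type u} [Ring R] [HasDerivedCategory.{w} (ModuleCat.{u} R)]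
  (P : ObjectProperty (DerivedCategory (ModuleCat.{u} R))) [P.IsTriangulated]
  [P.IsClosedUnderIsomorphisms]

lemma prop_singleFunctor_of_isFiniteLength
    (hsimple : ∀ S : ModuleCat.{u} R, IsSimpleModule R S → P ((singleFunctor _ 0).obj S))
    {M : Type u} [AddCommGroup M] [Module R M] (hM : IsFiniteLength R M) :
    P ((singleFunctor _ 0).obj (ModuleCat.of R M)) := by
  induction hM with
  | of_subsingleton =>
    exact P.prop_of_isZero (Functor.map_isZero _ (ModuleCat.isZero_of_subsingleton _))
  | @of_simple_quotient M _ _ N simple _ ih =>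
    let S : ShortComplex (ModuleCat.{u} R) :=
      ShortComplex.mk (ModuleCat.ofHom N.subtype) (ModuleCat.ofHom N.mkQ) (by ext; simp)
    have shortExact : S.ShortExact := ModuleCat.shortComplex_shortExact S
      (LinearMap.exact_subtype_mkQ N) N.injective_subtype N.mkQ_surjective
    exact P.ext_of_isTriangulatedClosed₂ _ shortExact.singleTriangle_distinguished ih
      (hsimple _ simple)

lemma prop_of_finite_homology [IsArtinianRing R]
    (hsimple : ∀ S : ModuleCat.{u} R, IsSimpleModule R S → P ((singleFunctor _ 0).obj S))
    {X : DerivedCategory (ModuleCat.{u} R)} {a b : ℤ} [X.IsGE a] [X.IsLE b]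
    (hX : ∀ n, Module.Finite R ((homologyFunctor (ModuleCat.{u} R) n).obj X)) : P X :=
  prop_of_forall_homology P (a := a) (b := b) fun n =>
    have := hX n
    prop_singleFunctor_of_isFiniteLength P hsimple
      (isFiniteLength_iff_isNoetherian_isArtinian.2 ⟨inferInstance, inferInstance⟩)

end FiniteLength

/-! ### The Euler form on the bounded derived category -/

section EulerProperties

open Pretriangulated Limits

variable (k : Type*) [Field k] {D : Type*} [Category D] [Preadditive D] [Linear k D]
  [HasZeroObject D] [HasShift D ℤ] [∀ n : ℤ, (shiftFunctor D n).Additive] [Pretriangulated D]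
  [∀ n : ℤ, (shiftFunctor D n).Linear k]

/-- The objects `X` for which the Euler characteristic of the pair `(X, Y)` is defined. -/
def eulerCharExists (Y : D) : ObjectProperty D := fun X => ∃ χ, HasEulerChar k X Y χ

instance (Y : D) : (eulerCharExists k Y).IsClosedUnderIsomorphisms where
  of_iso e := fun ⟨χ, h⟩ => ⟨χ, h.of_iso_left e⟩

instance (Y : D) : (eulerCharExists k Y).IsTriangulated where
  exists_zero := ⟨_, isZero_zero D, 0,
    hasEulerChar_zero_of_subsingleton fun _ => ⟨(isZero_zero D).eq_of_src⟩⟩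
  isStableUnderShiftBy m := ⟨fun _ ⟨_, h⟩ => ⟨_, h.shift_left m⟩⟩
  toIsTriangulatedClosed₂ := .mk' fun _ hT ⟨_, h₁⟩ ⟨_, h₃⟩ => ⟨_, h₁.triangle_left h₃ hT⟩

/-- The objects `Y` for which the Euler characteristic of `(X, Y)` is `∑ j, v j * χ(Y, I j)`. -/
def eulerCharExpands {ι : Type*} [Fintype ι] (X : D) (I : ι → D) (v : ι → ℤ) : ObjectProperty D :=
  fun Y => ∃ w : ι → ℤ, (∀ j, HasEulerChar k Y (I j) (w j)) ∧ HasEulerChar k X Y (∑ j, v j * w j)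

variable {ι : Type*} [Fintype ι] (X : D) (I : ι → D) (v : ι → ℤ)

instance : (eulerCharExpands k X I v).IsClosedUnderIsomorphisms where
  of_iso e := fun ⟨w, hw, h⟩ => ⟨w, fun j => (hw j).of_iso_left e, h.of_iso_right e⟩

instance : (eulerCharExpands k X I v).IsTriangulated where
  exists_zero := ⟨_, isZero_zero D, 0,
    fun _ => hasEulerChar_zero_of_subsingleton fun _ => ⟨(isZero_zero D).eq_of_src⟩, by
      simpa using hasEulerChar_zero_of_subsingleton fun n =>
        ⟨((shiftFunctor D n).map_isZero (isZero_zero D)).eq_of_tgt⟩⟩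
  isStableUnderShiftBy m := ⟨fun _ ⟨w, hw, h⟩ =>
    ⟨fun j => m.negOnePow * w j, fun j => (hw j).shift_left m, by
      simpa only [Finset.mul_sum, mul_left_comm] using h.shift_right m⟩⟩
  toIsTriangulatedClosed₂ := .mk' fun _ hT ⟨w₁, hw₁, h₁⟩ ⟨w₃, hw₃, h₃⟩ =>
    ⟨fun j => w₁ j + w₃ j, fun j => (hw₁ j).triangle_left (hw₃ j) hT, by
      simpa only [mul_add, Finset.sum_add_distrib] using h₁.triangle_right h₃ hT⟩

end EulerProperties

section Concentration

open DerivedCategory Pretriangulated Limits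

universe w v' u'

variable {C : Type u'} [Category.{v'} C] [Abelian C] [HasDerivedCategory.{w} C]

lemma isZero_homologyFunctor_obj_singleFunctor_obj (M : C) {n : ℤ} (hn : n ≠ 0) :
    IsZero ((homologyFunctor C n).obj ((singleFunctor C 0).obj M)) := by
  obtain hn | hn := lt_or_gt_of_ne hn
  · exact isZero_of_isGE _ 0 n hn
  · exact isZero_of_isLE _ 0 n hn

variable {Y : DerivedCategory C} {n : ℤ}

lemma eq_zero_of_isZero_homologyFunctor_obj_of_projective {P : C} [Projective P]
    (h : IsZero ((homologyFunctor C n).obj Y)) (f : (singleFunctor C 0).obj P ⟶ Y⟦n⟧) : f = 0 :=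
  eq_zero_of_homologyFunctor_map_eq_zero_of_projective _ <|
    (h.of_iso (((homologyFunctor C 0).shiftIso n 0 n (add_zero n)).app Y)).eq_of_tgt _ _

lemma eq_zero_of_isZero_homologyFunctor_obj_of_injective {I : C} [Injective I]
    (h : IsZero ((homologyFunctor C (-n)).obj Y)) (f : Y ⟶ ((singleFunctor C 0).obj I)⟦n⟧) :
    f = 0 := by
  have comp_eq_zero : f⟦-n⟧' ≫
      (shiftFunctorCompIsoId (DerivedCategory C) n (-n) (by omega)).hom.app _ = 0 :=
    eq_zero_of_homologyFunctor_map_eq_zero_of_injective _ <|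
      (h.of_iso (((homologyFunctor C 0).shiftIso (-n) 0 (-n) (add_zero _)).app Y)).eq_of_src _ _
  rw [Preadditive.IsIso.comp_right_eq_zero] at comp_eq_zero
  exact (shiftFunctor (DerivedCategory C) (-n)).map_injective (by simpa using comp_eq_zero)

end Concentration

section FiniteDimensionalAlgebra

open DerivedCategory

universe w

variable (k : Type u) {R : Type u} [Field k] [Ring R] [Algebra k R] [Module.Finite k R]

lemma finite_moduleCat_hom (M N : ModuleCat.{u} R) [Module.Finite R M] [Module.Finite R N] :
    Module.Finite k (M ⟶ N) := by
  let : Module k M := ModuleCat.moduleOfAlgebraModule _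
  have : IsScalarTower k R M := ModuleCat.isScalarTower_of_algebra_moduleCat _
  let : Module k N := ModuleCat.moduleOfAlgebraModule _
  have : IsScalarTower k R N := ModuleCat.isScalarTower_of_algebra_moduleCat _
  have : Module.Finite k M := .trans R M
  have : Module.Finite k N := .trans R N
  let toLinearMap : (M ⟶ N) →ₗ[k] (M →ₗ[k] N) :=
    { toFun g := g.hom.restrictScalars k
      map_add' _ _ := rfl
      map_smul' c g := by ext x; exact (algebraMap_smul R c (g.hom x)).symm }
  exact .of_injective toLinearMap fun g g' h => by ext x; exact LinearMap.congr_fun h x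

variable [HasDerivedCategory.{w} (ModuleCat.{u} R)]

/-- The full embedding of modules into the derived category, on spaces of morphisms. -/
noncomputable def singleFunctorHomEquiv (M N : ModuleCat.{u} R) :
    (M ⟶ N) ≃ₗ[k] ((singleFunctor _ 0).obj M ⟶ (singleFunctor _ 0).obj N) :=
  .ofBijective ((singleFunctor (ModuleCat.{u} R) 0).mapLinearMap k)
    ⟨(singleFunctor _ 0).map_injective, (singleFunctor _ 0).map_surjective⟩

lemma hasEulerChar_singleFunctor_obj_of_injective (N I : ModuleCat.{u} R) [Injective I]
    [Module.Finite R N] [Module.Finite R I] :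
    HasEulerChar k ((singleFunctor _ 0).obj N) ((singleFunctor _ 0).obj I)
      (Module.finrank k (N ⟶ I)) := by
  have := finite_moduleCat_hom k N I
  have := Module.Finite.equiv (singleFunctorHomEquiv k N I)
  rw [(singleFunctorHomEquiv k N I).finrank_eq]
  exact hasEulerChar_of_concentrated fun n hn =>
    eq_zero_of_isZero_homologyFunctor_obj_of_injective
      (isZero_homologyFunctor_obj_singleFunctor_obj N (neg_ne_zero.2 hn))

variable {Y : DerivedCategory (ModuleCat.{u} R)} (a b : ℤ) [Y.IsGE a] [Y.IsLE b]
  (hY : ∀ n, Module.Finite R ((homologyFunctor (ModuleCat.{u} R) n).obj Y))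

include a b hY

lemma exists_hasEulerChar_of_injective (I : ModuleCat.{u} R) [Injective I] [Module.Finite R I] :
    ∃ χ, HasEulerChar k Y ((singleFunctor _ 0).obj I) χ :=
  have : IsArtinianRing R := .of_finite k R
  prop_of_finite_homology (eulerCharExists k _) (a := a) (b := b)
    (fun S _ => ⟨_, hasEulerChar_singleFunctor_obj_of_injective k S I⟩) hY

lemma finite_hom_singleFunctor_obj_shift (N : Type u) [AddCommGroup N] [Module R N]
    [Module.Finite R N] (n : ℤ) :
    Module.Finite k (Y ⟶ ((singleFunctor _ 0).obj (ModuleCat.of R N))⟦n⟧) := by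
  obtain ⟨m, hm⟩ : ∃ m : ℕ, n < -b + m := ⟨(n + b + 1).toNat, by omega⟩
  induction m generalizing n N with
  | zero =>
    have : (((singleFunctor (ModuleCat.{u} R) 0).obj (ModuleCat.of R N))⟦n⟧).IsGE (-n) :=
      TStructure.t.isGE_shift _ 0 n (-n) (by omega)
    have : Subsingleton (Y ⟶ ((singleFunctor _ 0).obj (ModuleCat.of R N))⟦n⟧) :=
      ⟨fun f g => (TStructure.t.zero f b (-n) (by omega)).trans
        (TStructure.t.zero g b (-n) (by omega)).symm⟩
    infer_instance
  | succ m ih =>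
    let : Module k N := .compHom N (algebraMap k R)
    have : IsScalarTower k R N := .of_algebraMap_smul fun _ _ => rfl
    have : Module.Finite k N := .trans R N
    have : Module.Finite R (Coind k R N) := .of_restrictScalars_finite k R _
    let ι : N →ₗ[R] Coind k R N := Coind.lift (LinearMap.id : N →ₗ[k] N)
    let S : ShortComplex (ModuleCat.{u} R) :=
      .mk (ModuleCat.ofHom ι) (ModuleCat.ofHom (LinearMap.range ι).mkQ)
        (ModuleCat.hom_ext ι.range_mkQ_comp)
    have shortExact : S.ShortExact := ModuleCat.shortComplex_shortExact S
      (LinearMap.exact_iff.2 (Submodule.ker_mkQ _)) Coind.lift_id_injective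
      (Submodule.mkQ_surjective _)
    obtain ⟨n, rfl⟩ : ∃ n', n = n' + 1 := ⟨n - 1, by omega⟩
    obtain ⟨_, finite_hom_coind, -⟩ :=
      exists_hasEulerChar_of_injective k a b hY (ModuleCat.of R (Coind k R N))
    exact finite_of_function_exact
      (exact_rightComp_mor₃_mor₁ (k := k) Y shortExact.singleTriangle_distinguished n)
      (ih _ n (by omega)) (finite_hom_coind (n + 1))

theorem exists_eulerChar_expansion {ι : Type*} [Fintype ι] [DecidableEq ι]
    (S I : ι → ModuleCat.{u} R) [∀ i, Injective (I i)] [∀ i, Module.Finite R (S i)]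
    [∀ i, Module.Finite R (I i)]
    (hS : ∀ N : ModuleCat.{u} R, IsSimpleModule R N → ∃ i, Nonempty (S i ≅ N))
    (hSI : ∀ i j, Module.finrank k (S i ⟶ I j) = if i = j then 1 else 0)
    {X : DerivedCategory (ModuleCat.{u} R)} {v : ι → ℤ}
    (hv : ∀ j, HasEulerChar k X ((singleFunctor _ 0).obj (S j)) (v j)) :
    ∃ w : ι → ℤ, (∀ j, HasEulerChar k Y ((singleFunctor _ 0).obj (I j)) (w j)) ∧
      HasEulerChar k X Y (∑ j, v j * w j) := by
  have : IsArtinianRing R := .of_finite k R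
  refine prop_of_finite_homology
    (eulerCharExpands k X (fun j => (singleFunctor (ModuleCat.{u} R) 0).obj (I j)) v)
    (a := a) (b := b) (fun N hN => ?_) hY
  obtain ⟨i, ⟨e⟩⟩ := hS N hN
  let e' := (singleFunctor (ModuleCat.{u} R) 0).mapIso e
  refine ⟨fun j => if i = j then 1 else 0, fun j => ?_, ?_⟩
  · have := (hasEulerChar_singleFunctor_obj_of_injective k (S i) (I j)).of_iso_left e'
    rwa [hSI, Nat.cast_ite, Nat.cast_one, Nat.cast_zero] at this
  · simpa using (hv i).of_iso_right e'

end FiniteDimensionalAlgebra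

/-! ### Lengths over endomorphism rings -/

section LocalRing

variable {B : Type*} [Ring B] [IsLocalRing B]

lemma eq_of_isMaximal_of_isLocalRing {m m' : Ideal B} (hm : m.IsMaximal) (hm' : m'.IsMaximal) :
    m = m' := by
  by_contra ne
  have one_mem : (1 : B) ∈ m ⊔ m' := by rw [hm.coprime_of_ne hm' ne]; trivial
  obtain ⟨a, ha, b, hb, add_eq_one⟩ := Submodule.mem_sup.1 one_mem
  obtain ha' | hb' := IsLocalRing.isUnit_or_isUnit_of_add_one add_eq_one
  · exact hm.ne_top (m.eq_top_of_isUnit_mem ha ha')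
  · exact hm'.ne_top (m'.eq_top_of_isUnit_mem hb hb')

lemma finrank_eq_finrank_quotient_mul_length (k : Type*) [Field k] [Algebra k B] {m : Ideal B}
    (hm : m.IsMaximal) {W : Type*} [AddCommGroup W] [Module B W] (hW : IsFiniteLength B W) :
    ∀ [Module k W] [IsScalarTower k B W] [Module.Finite k W],
      Module.finrank k W = Module.finrank k (B ⧸ m) * (Module.length B W).toNat := by
  induction hW with
  | of_subsingleton =>
    intros
    rw [Module.finrank_zero_of_subsingleton, Module.length_eq_zero]; simp
  | @of_simple_quotient W _ _ N simple hN ih =>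
    intro _ _ _
    have : Module.Finite k N :=
      .of_injective (N.subtype.restrictScalars k) N.injective_subtype
    have finrank_quotient :
        Module.finrank k (W ⧸ N.restrictScalars k) = Module.finrank k (B ⧸ m) := by
      obtain ⟨m', hm', ⟨e⟩⟩ := isSimpleModule_iff_quot_maximal.1 simple
      obtain rfl := eq_of_isMaximal_of_isLocalRing hm hm'
      exact (e.restrictScalars k).finrank_eq
    have length_eq := Module.length_eq_add_of_exact N.subtype N.mkQ N.injective_subtype
      N.mkQ_surjective (LinearMap.exact_subtype_mkQ N)
    rw [length_eq, Module.length_eq_one B (W ⧸ N),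
      ENat.toNat_add (Module.length_ne_top_iff.2 hN) ENat.one_ne_top, mul_add, ← ih,
      ← Submodule.finrank_quotient_add_finrank (N.restrictScalars k), finrank_quotient,
      ENat.toNat_one, mul_one]
    exact add_comm _ _

end LocalRing

section HomLength

variable {D D' : Type*} [Category D] [Category D'] [Preadditive D] [Preadditive D']

/-- The length of the morphisms from `T` to `Y` over the endomorphism ring of `T`. -/
noncomputable def homLength (T Y : D) : ℕ := (Module.length (End T)ᵐᵒᵖ (T ⟶ Y)).toNat

lemma homLength_map (F : D ⥤ D') [F.Additive] [F.Full] [F.Faithful] (T Y : D) :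
    homLength (F.obj T) (F.obj Y) = homLength T Y := by
  let σ : (End T)ᵐᵒᵖ →+* (End (F.obj T))ᵐᵒᵖ := (mapEndRingHom F T).op
  have : RingHomSurjective σ := ⟨fun f => by
    obtain ⟨g, hg⟩ := (mapEndRingHom_bijective F T).2 f.unop
    exact ⟨op g, congrArg op hg⟩⟩
  let φ : (T ⟶ Y) →ₛₗ[σ] (F.obj T ⟶ F.obj Y) :=
    { toFun := F.map
      map_add' _ _ := F.map_add
      map_smul' _ _ := F.map_comp _ _ }
  refine congrArg ENat.toNat (WithBot.coe_injective ?_)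
  rw [Module.coe_length, Module.coe_length, Order.krullDim_eq_of_orderIso
    (Submodule.orderIsoMapComapOfBijective φ ⟨F.map_injective, F.map_surjective⟩)]

lemma exists_finrank_hom_eq_mul_homLength (k : Type*) [Field k] [Linear k D] (T : D)
    [IsLocalRing (End T)ᵐᵒᵖ] :
    ∃ d : ℕ, ∀ Y : D, Module.Finite k (T ⟶ Y) → Module.finrank k (T ⟶ Y) = d * homLength T Y := by
  obtain ⟨m, hm⟩ := Ideal.exists_maximal (End T)ᵐᵒᵖ
  refine ⟨Module.finrank k ((End T)ᵐᵒᵖ ⧸ m), fun Y _ => ?_⟩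
  have : IsScalarTower k (End T)ᵐᵒᵖ (T ⟶ Y) := ⟨fun c f g => Linear.smul_comp _ _ _ c f.unop g⟩
  exact finrank_eq_finrank_quotient_mul_length k hm <|
    isFiniteLength_iff_isNoetherian_isArtinian.2
      ⟨isNoetherian_of_tower k inferInstance, isArtinian_of_tower k inferInstance⟩

end HomLength

/-! ### Modules attached to an idempotent -/

section Idempotent

variable (k : Type*) {R : Type*} [Field k] [Ring R] [Algebra k R] {e f : R}
  {V : Type*} [AddCommGroup V] [Module k V] [Module R V] [IsScalarTower k R V]

/-- The subspace of the vectors fixed by a ring element `e`; for an idempotent `e` it is `e V`. -/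
def fixedSubspace (e : R) (V : Type*) [AddCommGroup V] [Module k V] [Module R V]
    [IsScalarTower k R V] : Submodule k V :=
  LinearMap.eqLocus (Algebra.lsmul k k V e) LinearMap.id

variable {k} in
lemma mem_fixedSubspace {v : V} : v ∈ fixedSubspace k e V ↔ e • v = v := Iff.rfl

variable {k} in
lemma smul_mem_fixedSubspace (he : IsIdempotentElem e) (v : V) : e • v ∈ fixedSubspace k e V := by
  rw [mem_fixedSubspace, smul_smul, he.eq]

/-- The Peirce component `e R f` of idempotents `e` and `f`. -/
def peirceCorner (e f : R) : Submodule k R :=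
  LinearMap.eqLocus (LinearMap.mulLeft k e) LinearMap.id ⊓
    LinearMap.eqLocus (LinearMap.mulRight k f) LinearMap.id

variable {k} in
lemma mem_peirceCorner {x : R} : x ∈ peirceCorner k e f ↔ e * x = x ∧ x * f = x := Iff.rfl

variable {k} in
lemma mul_mul_mem_peirceCorner (he : IsIdempotentElem e) (hf : IsIdempotentElem f) (x : R) :
    e * x * f ∈ peirceCorner k e f :=
  mem_peirceCorner.2 ⟨by rw [← mul_assoc, ← mul_assoc, he.eq], by rw [mul_assoc, hf.eq]⟩

lemma mem_span_singleton_iff_mul_eq (he : IsIdempotentElem e) {x : R} :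
    x ∈ Ideal.span {e} ↔ x * e = x := by
  refine ⟨fun hx => ?_, fun hx => Ideal.mem_span_singleton'.2 ⟨x, hx⟩⟩
  obtain ⟨r, rfl⟩ := Ideal.mem_span_singleton'.1 hx
  rw [mul_assoc, he.eq]

/-- The idempotent `e` as a generator of the left ideal `R e`. -/
def spanGenerator (e : R) : Ideal.span {e} := ⟨e, Ideal.mem_span_singleton_self e⟩

lemma smul_spanGenerator (he : IsIdempotentElem e) (x : Ideal.span {e}) :
    (x : R) • spanGenerator e = x :=
  Subtype.ext ((mem_span_singleton_iff_mul_eq he).1 x.2)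

lemma self_smul_spanGenerator (he : IsIdempotentElem e) : e • spanGenerator e = spanGenerator e :=
  smul_spanGenerator he (spanGenerator e)

variable {k} in
lemma apply_spanGenerator_mem_fixedSubspace (he : IsIdempotentElem e)
    (φ : Ideal.span {e} →ₗ[R] V) : φ (spanGenerator e) ∈ fixedSubspace k e V := by
  rw [mem_fixedSubspace, ← map_smul, self_smul_spanGenerator he]

variable (V) in
/-- Homomorphisms out of `R e` correspond to vectors of `e V`, through the image of `e`. -/
noncomputable def spanHomEquiv (he : IsIdempotentElem e) :
    (Ideal.span {e} →ₗ[R] V) ≃ₗ[k] fixedSubspace k e V where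
  toFun φ := ⟨φ (spanGenerator e), apply_spanGenerator_mem_fixedSubspace he φ⟩
  invFun v := (LinearMap.toSpanSingleton R V v).domRestrict _
  map_add' _ _ := rfl
  map_smul' _ _ := rfl
  left_inv φ := by
    ext x
    exact (map_smul φ (x : R) _).symm.trans (congrArg φ (smul_spanGenerator he x))
  right_inv v := Subtype.ext v.2

/-- The subspace `e (R f)` is the Peirce component `e R f`. -/
noncomputable def fixedSubspaceSpanEquiv (hf : IsIdempotentElem f) :
    fixedSubspace k e (Ideal.span {f}) ≃ₗ[k] peirceCorner k e f where
  toFun x := ⟨(x : Ideal.span {f}), congrArg Subtype.val x.2,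
    (mem_span_singleton_iff_mul_eq hf).1 x.1.2⟩
  invFun x := ⟨⟨x, (mem_span_singleton_iff_mul_eq hf).2 x.2.2⟩, Subtype.ext x.2.1⟩
  map_add' _ _ := rfl
  map_smul' _ _ := rfl

end Idempotent

section DualIdempotent

variable (k : Type u) {R : Type u} [Field k] [Ring R] [Algebra k R] {e f : R}
  {V : Type*} [AddCommGroup V] [Module k V] [Module R V] [IsScalarTower k R V]

/-- The left module dual to the right ideal `e R`, realised as the functionals `φ` on `R` with
`φ (e x) = φ x`. -/
def dualIdeal (e : R) : Submodule R (Coind k R k) where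
  carrier := {φ | ∀ x, φ (e * x) = φ x}
  add_mem' {φ ψ} hφ hψ x := by rw [Coind.add_apply, hφ, hψ, Coind.add_apply]
  zero_mem' _ := rfl
  smul_mem' r φ hφ x := by rw [Coind.smul_apply, mul_assoc, hφ, Coind.smul_apply]

instance [Module.Finite k R] (e : R) : Module.Finite k (dualIdeal k e) :=
  .of_injective ((dualIdeal k e).subtype.restrictScalars k) (dualIdeal k e).injective_subtype

/-- The retraction of the dual of `R` onto the dual of `e R`. -/
def dualIdealRetraction (he : IsIdempotentElem e) : Coind k R k →ₗ[R] dualIdeal k e where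
  toFun φ := ⟨(show R →ₗ[k] k from φ) ∘ₗ LinearMap.mulLeft k e, fun x => by
    change φ (e * (e * x)) = φ (e * x)
    rw [← mul_assoc, he.eq]⟩
  map_add' _ _ := rfl
  map_smul' r φ := Subtype.ext <| Coind.ext fun x => congrArg φ (mul_assoc e x r)

variable (V) in
/-- Homomorphisms into the dual of `e R` are functionals on `e V`, through evaluation at `1`. -/
noncomputable def homDualIdealEquiv (he : IsIdempotentElem e) :
    (V →ₗ[R] dualIdeal k e) ≃ₗ[k] Module.Dual k (fixedSubspace k e V) where
  toFun φ := Coind.evalOne k R k ∘ₗ ((dualIdeal k e).subtype ∘ₗ φ).restrictScalars k ∘ₗ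
    (fixedSubspace k e V).subtype
  invFun ψ :=
    (Coind.lift <|
      ψ ∘ₗ (Algebra.lsmul k k V e).codRestrict _ (smul_mem_fixedSubspace he)).codRestrict _
        fun v x => congrArg ψ <| Subtype.ext <| by
        change e • (e * x) • v = e • x • v
        rw [smul_smul, ← mul_assoc, he.eq, mul_smul]
  map_add' _ _ := rfl
  map_smul' _ _ := rfl
  left_inv φ := by
    ext v x
    change (φ (e • x • v)).1 1 = (φ v).1 x
    rw [map_smul, map_smul]
    change (φ v).1 (1 * e * x) = (φ v).1 x
    rw [one_mul, (φ v).2]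
  right_inv ψ := by
    ext v
    refine congrArg ψ (Subtype.ext ?_)
    change e • (1 : R) • (v : V) = v
    rw [one_smul, mem_fixedSubspace.1 v.2]

/-- The vectors of the dual of `e R` fixed by `f` are the functionals on `e R f`. -/
noncomputable def fixedSubspaceDualIdealEquiv (he : IsIdempotentElem e) (hf : IsIdempotentElem f) :
    fixedSubspace k f (dualIdeal k e) ≃ₗ[k] Module.Dual k (peirceCorner k e f) where
  toFun φ := (show R →ₗ[k] k from φ.1.1) ∘ₗ (peirceCorner k e f).subtype
  invFun ψ := ⟨⟨ψ ∘ₗ (LinearMap.mulRight k f ∘ₗ LinearMap.mulLeft k e).codRestrict _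
        (mul_mul_mem_peirceCorner he hf),
      fun x => congrArg ψ <| Subtype.ext <| by
        change e * (e * x) * f = e * x * f
        rw [← mul_assoc, he.eq]⟩,
    Subtype.ext <| Coind.ext fun x => congrArg ψ <| Subtype.ext <| by
      change e * (x * f) * f = e * x * f
      rw [mul_assoc, mul_assoc, hf.eq, mul_assoc]⟩
  map_add' _ _ := rfl
  map_smul' _ _ := rfl
  left_inv φ := by
    refine Subtype.ext (Subtype.ext (Coind.ext fun x => ?_))
    change φ.1.1 (e * x * f) = φ.1.1 x
    rw [mul_assoc, φ.1.2]
    exact congrArg (fun ψ : dualIdeal k e => ψ.1 x) φ.2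
  right_inv ψ := by
    ext x
    refine congrArg ψ (Subtype.ext ?_)
    change e * (x : R) * f = x
    rw [(mem_peirceCorner.1 x.2).1, (mem_peirceCorner.1 x.2).2]

end DualIdempotent

section ModuleCat

variable (k : Type u) {R : Type u} [Field k] [Ring R] [Algebra k R] {e f : R}

/-- Morphisms of `ModuleCat R`, with the `k`-structure coming from `k → R`, in terms of linear maps
between modules that carry a `k`-structure of their own. -/
def moduleCatHomEquiv {M N : ModuleCat.{u} R} {V W : Type*} [AddCommGroup V] [Module R V]
    [AddCommGroup W] [Module k W] [Module R W] [IsScalarTower k R W]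
    (g : M ≃ₗ[R] V) (h : N ≃ₗ[R] W) : (M ⟶ N) ≃ₗ[k] (V →ₗ[R] W) where
  toFun φ := h.toLinearMap ∘ₗ φ.hom ∘ₗ g.symm.toLinearMap
  invFun ψ := ModuleCat.ofHom (h.symm.toLinearMap ∘ₗ ψ ∘ₗ g.toLinearMap)
  map_add' φ ψ := LinearMap.ext fun v => map_add h _ _
  map_smul' c φ := by
    ext v
    exact (map_smul h (algebraMap k R c) _).trans (algebraMap_smul R c _)
  left_inv φ := by ext v; simp
  right_inv ψ := by ext v; simp

/-- The projective module `R e`. -/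
def projModule (e : R) : ModuleCat.{u} R := ModuleCat.of R (Ideal.span {e})

/-- The identification of `projModule e` with `R e`. It is not used silently, so that the
`k`-structure on morphisms is always the one coming from `k → R`. -/
def projModuleEquiv (e : R) : projModule e ≃ₗ[R] Ideal.span {e} := LinearEquiv.refl R _

instance (e : R) : Module.Finite R (projModule e) := Module.Finite.span_singleton R e

lemma projective_projModule (he : IsIdempotentElem e) : Projective (projModule e) := by
  have : Module.Projective R (Ideal.span {e}) :=
    .of_split (Ideal.span {e}).subtype (LinearMap.toSpanSingleton R _ (spanGenerator e))
      (LinearMap.ext (smul_spanGenerator he))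
  exact (IsProjective.iff_projective _).1 this

/-- The injective module dual to `e R`. -/
def injModule (e : R) : ModuleCat.{u} R := ModuleCat.of R (dualIdeal k e)

/-- The identification of `injModule k e` with the dual of `e R`. -/
def injModuleEquiv (e : R) : injModule k e ≃ₗ[R] dualIdeal k e := LinearEquiv.refl R _

instance [Module.Finite k R] (e : R) : Module.Finite R (injModule k e) :=
  Module.Finite.of_restrictScalars_finite k R (dualIdeal k e)

lemma injective_injModule (he : IsIdempotentElem e) : Injective (injModule k e) := by
  have retract : Retract (injModule k e) (ModuleCat.of R (Coind k R k)) :=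
    { i := ModuleCat.ofHom (dualIdeal k e).subtype
      r := ModuleCat.ofHom (dualIdealRetraction k he)
      retract := ModuleCat.hom_ext <| LinearMap.ext fun φ => Subtype.ext (Coind.ext φ.2) }
  exact retract.injective

lemma finrank_projModule_hom_projModule (he : IsIdempotentElem e) (hf : IsIdempotentElem f) :
    Module.finrank k (projModule e ⟶ projModule f) = Module.finrank k (peirceCorner k e f) := by
  rw [(moduleCatHomEquiv k (projModuleEquiv e) (projModuleEquiv f)).finrank_eq,
    (spanHomEquiv k _ he).finrank_eq, (fixedSubspaceSpanEquiv k hf).finrank_eq]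

lemma finrank_hom_injModule (he : IsIdempotentElem e) {N : ModuleCat.{u} R} {V : Type*}
    [AddCommGroup V] [Module k V] [Module R V] [IsScalarTower k R V] (g : N ≃ₗ[R] V) :
    Module.finrank k (N ⟶ injModule k e) = Module.finrank k (fixedSubspace k e V) := by
  rw [(moduleCatHomEquiv k g (injModuleEquiv k e)).finrank_eq,
    (homDualIdealEquiv k V he).finrank_eq, Subspace.dual_finrank_eq]

lemma finrank_injModule_hom_injModule (he : IsIdempotentElem e) (hf : IsIdempotentElem f) :
    Module.finrank k (injModule k e ⟶ injModule k f) = Module.finrank k (peirceCorner k e f) := by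
  rw [finrank_hom_injModule k hf (injModuleEquiv k e),
    (fixedSubspaceDualIdealEquiv k he hf).finrank_eq, Subspace.dual_finrank_eq]

end ModuleCat

/-! ### Basic algebras and their Cartan matrices -/

section Indecomposable

open Limits

variable {C : Type*} [Category C]

lemma isZero_of_mono_biprod_fst [Preadditive C] {X Y : C} [HasBinaryBiproduct X Y]
    [Mono (biprod.fst : X ⊞ Y ⟶ X)] : IsZero Y := by
  have inr_eq_zero : (biprod.inr : Y ⟶ X ⊞ Y) = 0 := by
    rw [← cancel_mono (biprod.fst : X ⊞ Y ⟶ X), biprod.inr_fst, zero_comp]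
  rw [IsZero.iff_id_eq_zero, ← biprod.inr_snd (X := X), inr_eq_zero, zero_comp]

lemma isZero_of_mono_biprod_snd [Preadditive C] {X Y : C} [HasBinaryBiproduct X Y]
    [Mono (biprod.snd : X ⊞ Y ⟶ Y)] : IsZero X := by
  have inl_eq_zero : (biprod.inl : X ⟶ X ⊞ Y) = 0 := by
    rw [← cancel_mono (biprod.snd : X ⊞ Y ⟶ Y), biprod.inl_snd, zero_comp]
  rw [IsZero.iff_id_eq_zero, ← biprod.inl_fst (Y := Y), inl_eq_zero, zero_comp]

lemma indecomposable_of_isLocalRing_end [Preadditive C] [HasBinaryBiproducts C] (X : C)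
    [IsLocalRing (End X)ᵐᵒᵖ] : Indecomposable X := by
  refine ⟨fun hX => one_ne_zero (α := (End X)ᵐᵒᵖ) (congrArg op (hX.eq_of_src (𝟙 X) 0)),
    fun Y Z e => ?_⟩
  let p : End X := e.hom ≫ biprod.fst ≫ biprod.inl ≫ e.inv
  let q : End X := e.hom ≫ biprod.snd ≫ biprod.inr ≫ e.inv
  have p_add_q : op p + op q = 1 := by
    have total := congrArg (e.hom ≫ · ≫ e.inv) (biprod.total (X := Y) (Y := Z))
    simp only [Preadditive.add_comp, Preadditive.comp_add, Category.assoc, Category.id_comp,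
      Iso.hom_inv_id] at total
    exact congrArg op total
  obtain isUnit_p | isUnit_q := IsLocalRing.isUnit_or_isUnit_of_add_one p_add_q
  · have : IsIso p := (isUnit_iff_isIso p).1 isUnit_p.unop
    have fac : (biprod.fst : Y ⊞ Z ⟶ Y) ≫ biprod.inl = e.inv ≫ p ≫ e.hom := by simp [p]
    have := mono_of_mono_fac fac
    exact .inr (isZero_of_mono_biprod_fst (X := Y))
  · have : IsIso q := (isUnit_iff_isIso q).1 isUnit_q.unop
    have fac : (biprod.snd : Y ⊞ Z ⟶ Z) ≫ biprod.inr = e.inv ≫ q ≫ e.hom := by simp [q]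
    have := mono_of_mono_fac fac
    exact .inl (isZero_of_mono_biprod_snd (Y := Z))

lemma isIso_of_epi_of_indecomposable [Abelian C] {X P : C} [Projective P] (f : X ⟶ P) [Epi f]
    (hX : Indecomposable X) (hP : ¬ IsZero P) : IsIso f := by
  let S := ShortComplex.mk (kernel.ι f) f (kernel.condition f)
  have hS : S.ShortExact := { exact := ShortComplex.exact_of_f_is_kernel _ (kernelIsKernel f) }
  have : Projective S.X₃ := ‹_›
  have isZero_kernel : IsZero (kernel f) :=
    (hX.2 _ _ hS.splittingOfProjective.isoBinaryBiproduct).resolve_right hP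
  have : Mono f := Preadditive.mono_of_isZero_kernel f isZero_kernel
  exact isIso_of_mono_of_epi f

end Indecomposable

lemma isLocalRing_of_exists_mul_eq_one {A K : Type*} [Ring A] [DivisionRing K] (χ : A →+* K)
    (h : ∀ a, χ a ≠ 0 → ∃ b, b * a = 1) : IsLocalRing A := by
  have isUnit_of_ne_zero (a : A) (ha : χ a ≠ 0) : IsUnit a := by
    obtain ⟨b, hba⟩ := h a ha
    have χ_mul : χ b * χ a = 1 := by rw [← map_mul, hba, map_one]
    obtain ⟨c, hcb⟩ := h b (left_ne_zero_of_mul_eq_one χ_mul)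
    exact ⟨⟨a, b, left_inv_eq_right_inv hcb hba ▸ hcb, hba⟩, rfl⟩
  have : Nontrivial A := χ.domain_nontrivial
  refine IsLocalRing.of_isUnit_or_isUnit_one_sub_self fun a => ?_
  by_cases ha : χ a = 0
  · exact .inr (isUnit_of_ne_zero _ (by rw [map_sub, ha, map_one, sub_zero]; exact one_ne_zero))
  · exact .inl (isUnit_of_ne_zero a ha)

/-- The one-dimensional module on which `R` acts through the character `χ`. -/
def CharMod {k R : Type u} [Field k] [Ring R] [Algebra k R] (_χ : R →ₐ[k] k) : Type u := k

namespace CharMod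

variable {k R : Type u} [Field k] [Ring R] [Algebra k R] {χ : R →ₐ[k] k}

instance : AddCommGroup (CharMod χ) := inferInstanceAs (AddCommGroup k)
instance : Nontrivial (CharMod χ) := inferInstanceAs (Nontrivial k)
instance : Module k (CharMod χ) := inferInstanceAs (Module k k)
instance : Module.Finite k (CharMod χ) := inferInstanceAs (Module.Finite k k)
instance : Module R (CharMod χ) := Module.compHom k χ.toRingHom

lemma smul_def (r : R) (c : CharMod χ) : r • c = χ r • c := rfl

instance : IsScalarTower k R (CharMod χ) :=
  ⟨fun c r x => by rw [smul_def, smul_def, map_smul, smul_assoc]⟩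

instance : Module.Finite R (CharMod χ) := Module.Finite.of_restrictScalars_finite k R _

lemma finrank_fixedSubspace_of_eq_one {e : R} (he : χ e = 1) :
    Module.finrank k (fixedSubspace k e (CharMod χ)) = 1 := by
  have : fixedSubspace k e (CharMod χ) = ⊤ := Submodule.eq_top_iff'.2 fun x =>
    mem_fixedSubspace.2 (by rw [smul_def, he, one_smul])
  rw [this, finrank_top]
  exact Module.finrank_self k

lemma finrank_fixedSubspace_of_eq_zero {e : R} (he : χ e = 0) :
    Module.finrank k (fixedSubspace k e (CharMod χ)) = 0 := by
  have : fixedSubspace k e (CharMod χ) = ⊥ := (Submodule.eq_bot_iff _).2 fun x hx => by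
    rw [← mem_fixedSubspace.1 hx, smul_def, he, zero_smul]
  rw [this, finrank_bot]

end CharMod

/-- A complete set of primitive idempotents of a basic `k`-algebra all of whose simple modules are
one-dimensional: the idempotents `e i` come with the characters `χ i` of the simple modules, and
every element of `e i R e i` outside the kernel of `χ i` is left invertible in this corner. -/
structure BasicIdempotents (k R : Type u) [Field k] [Ring R] [Algebra k R] (ι : Type*)
    [Fintype ι] [DecidableEq ι] where
  /-- the idempotents -/
  e : ι → R
  /-- the characters -/
  χ : ι → R →ₐ[k] k
  isIdempotentElem (i : ι) : IsIdempotentElem (e i)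
  sum_eq_one : ∑ i, e i = 1
  χ_e (i j : ι) : χ i (e j) = if i = j then 1 else 0
  exists_mul_eq_of_mem_peirceCorner (i : ι) (x : R) (hx : x ∈ peirceCorner k (e i) (e i))
    (hχ : χ i x ≠ 0) : ∃ y, y * x = e i

namespace BasicIdempotents

variable {k R : Type u} [Field k] [Ring R] [Algebra k R] {ι : Type*} [Fintype ι] [DecidableEq ι]
  (d : BasicIdempotents k R ι)

/-- The indecomposable projective modules. -/
abbrev P (i : ι) : ModuleCat.{u} R := projModule (d.e i)

/-- The indecomposable injective modules. -/
abbrev I (i : ι) : ModuleCat.{u} R := injModule k (d.e i)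

/-- The simple modules. -/
def S (i : ι) : ModuleCat.{u} R := ModuleCat.of R (CharMod (d.χ i))

/-- The identification of `d.S i` with the module of the character `d.χ i`. -/
def SEquiv (i : ι) : d.S i ≃ₗ[R] CharMod (d.χ i) := LinearEquiv.refl R _

instance (i : ι) : Projective (d.P i) := projective_projModule (d.isIdempotentElem i)

instance (i : ι) : Injective (d.I i) := injective_injModule k (d.isIdempotentElem i)

instance (i : ι) : Module.Finite R (d.S i) := inferInstanceAs (Module.Finite R (CharMod (d.χ i)))

lemma χ_e_self (i : ι) : d.χ i (d.e i) = 1 := by rw [d.χ_e, if_pos rfl]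

lemma finrank_fixedSubspace_charMod (i j : ι) :
    Module.finrank k (fixedSubspace k (d.e j) (CharMod (d.χ i))) = if i = j then 1 else 0 := by
  split_ifs with h
  · exact CharMod.finrank_fixedSubspace_of_eq_one (by rw [d.χ_e, if_pos h])
  · exact CharMod.finrank_fixedSubspace_of_eq_zero (by rw [d.χ_e, if_neg h])

lemma finrank_S_hom_I (i j : ι) : Module.finrank k (d.S i ⟶ d.I j) = if i = j then 1 else 0 := by
  rw [finrank_hom_injModule k (d.isIdempotentElem j) (d.SEquiv i), finrank_fixedSubspace_charMod]

lemma finrank_P_hom_S (i j : ι) : Module.finrank k (d.P j ⟶ d.S i) = if i = j then 1 else 0 := by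
  rw [(moduleCatHomEquiv k (projModuleEquiv (d.e j)) (d.SEquiv i)).finrank_eq,
    (spanHomEquiv k _ (d.isIdempotentElem j)).finrank_eq, finrank_fixedSubspace_charMod]

lemma eq_of_iso_P {i j : ι} (φ : d.P i ≅ d.P j) : i = j := by
  have finrank_eq := (Linear.homCongr k φ (Iso.refl (d.S i))).finrank_eq
  rw [finrank_P_hom_S, finrank_P_hom_S, if_pos rfl] at finrank_eq
  by_contra ne
  rw [if_neg ne] at finrank_eq
  exact one_ne_zero finrank_eq

lemma exists_smul_eq_spanGenerator {i : ι} (x : Ideal.span {d.e i}) (hx : d.χ i x ≠ 0) :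
    ∃ r : R, r • x = spanGenerator (d.e i) := by
  have x_mul := (mem_span_singleton_iff_mul_eq (d.isIdempotentElem i)).1 x.2
  obtain ⟨y, hy⟩ := d.exists_mul_eq_of_mem_peirceCorner i (d.e i * x * d.e i)
    (mul_mul_mem_peirceCorner (d.isIdempotentElem i) (d.isIdempotentElem i) x)
    (by rwa [map_mul, map_mul, χ_e_self, one_mul, mul_one])
  exact ⟨y * d.e i, Subtype.ext <| by
    change y * d.e i * x = d.e i
    rw [mul_assoc, ← x_mul, ← mul_assoc (d.e i), hy]⟩

/-- The character `d.χ i` as a map from the projective module onto its simple top. -/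
def top (i : ι) : Ideal.span {d.e i} →ₗ[R] CharMod (d.χ i) where
  toFun x := d.χ i x
  map_add' _ _ := map_add (d.χ i) _ _
  map_smul' _ _ := map_mul (d.χ i) _ _

lemma top_surjective (i : ι) : Function.Surjective (d.top i) := fun c : k =>
  ⟨algebraMap k R c • spanGenerator (d.e i), by
    change d.χ i (algebraMap k R c * d.e i) = c
    rw [map_mul, AlgHom.commutes, χ_e_self]
    exact mul_one c⟩

lemma surjective_of_top_comp_ne_zero {i : ι} {V : Type*} [AddCommGroup V] [Module R V]
    (f : V →ₗ[R] Ideal.span {d.e i}) (hf : d.top i ∘ₗ f ≠ 0) : Function.Surjective f := by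
  obtain ⟨v, hv⟩ := DFunLike.ne_iff.1 hf
  obtain ⟨r, hr⟩ := d.exists_smul_eq_spanGenerator (f v) hv
  intro x
  refine ⟨(x : R) • r • v, ?_⟩
  rw [map_smul, map_smul, hr, smul_spanGenerator (d.isIdempotentElem i)]

lemma exists_linearMap_ne_zero (V : Type*) [AddCommGroup V] [Module R V] [Nontrivial V] :
    ∃ (i : ι) (f : Ideal.span {d.e i} →ₗ[R] V), f ≠ 0 := by
  obtain ⟨v, hv⟩ := exists_ne (0 : V)
  have sum_smul : ∑ i, d.e i • v ≠ 0 := by rwa [← Finset.sum_smul, d.sum_eq_one, one_smul]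
  obtain ⟨i, -, hi⟩ := Finset.exists_ne_zero_of_sum_ne_zero sum_smul
  exact ⟨i, (LinearMap.toSpanSingleton R V v).domRestrict _, fun h =>
    hi (LinearMap.congr_fun h (spanGenerator (d.e i)))⟩

lemma exists_linearEquiv_of_isSimpleModule (V : Type*) [AddCommGroup V] [Module R V]
    [IsSimpleModule R V] : ∃ i, Nonempty (CharMod (d.χ i) ≃ₗ[R] V) := by
  have := IsSimpleModule.nontrivial R V
  obtain ⟨i, f, f_ne_zero⟩ := d.exists_linearMap_ne_zero V
  have f_surjective : Function.Surjective f := f.surjective_or_eq_zero.resolve_right f_ne_zero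
  have ker_le : LinearMap.ker f ≤ LinearMap.ker (d.top i) := by
    intro x hx
    by_contra top_ne_zero
    obtain ⟨r, hr⟩ := d.exists_smul_eq_spanGenerator x top_ne_zero
    refine f_ne_zero (LinearMap.ext fun y => ?_)
    rw [← smul_spanGenerator (d.isIdempotentElem i) y, ← hr, map_smul, map_smul,
      LinearMap.mem_ker.1 hx, smul_zero, smul_zero, LinearMap.zero_apply]
  have ker_eq : LinearMap.ker f = LinearMap.ker (d.top i) :=
    ((LinearMap.isCoatom_ker_of_surjective f_surjective).le_iff_eq
      (mt LinearMap.ker_eq_top.1 (LinearMap.ne_zero_of_surjective (d.top_surjective i)))).1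
      ker_le |>.symm
  exact ⟨i, ⟨((d.top i).quotKerEquivOfSurjective (d.top_surjective i)).symm.trans <|
    (Submodule.quotEquivOfEq _ _ ker_eq.symm).trans (f.quotKerEquivOfSurjective f_surjective)⟩⟩

lemma exists_iso_of_isSimpleModule (N : ModuleCat.{u} R) [IsSimpleModule R N] :
    ∃ i, Nonempty (d.S i ≅ N) :=
  let ⟨i, ⟨φ⟩⟩ := d.exists_linearEquiv_of_isSimpleModule N
  ⟨i, ⟨((d.SEquiv i).trans φ).toModuleIso⟩⟩

/-- The action of the endomorphisms of a projective module on its simple top. -/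
def endCharacter (i : ι) : (Module.End R (Ideal.span {d.e i}))ᵐᵒᵖ →+* k where
  toFun f := d.χ i (f.unop (spanGenerator (d.e i)))
  map_one' := d.χ_e_self i
  map_zero' := map_zero (d.χ i)
  map_add' _ _ := map_add (d.χ i) _ _
  map_mul' f g := by
    change d.χ i (g.unop (f.unop (spanGenerator (d.e i)))) = _
    conv_lhs => rw [← smul_spanGenerator (d.isIdempotentElem i) (f.unop _), map_smul]
    exact map_mul (d.χ i) _ _

lemma exists_mul_eq_one_of_endCharacter_ne_zero {i : ι}
    (f : (Module.End R (Ideal.span {d.e i}))ᵐᵒᵖ) (hf : d.endCharacter i f ≠ 0) :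
    ∃ g, g * f = 1 := by
  obtain ⟨r, hr⟩ := d.exists_smul_eq_spanGenerator (f.unop (spanGenerator (d.e i))) hf
  let g := (LinearMap.toSpanSingleton R _ (r • spanGenerator (d.e i))).domRestrict
    (Ideal.span {d.e i})
  refine ⟨op g, MulOpposite.unop_injective ?_⟩
  refine (spanHomEquiv k (Ideal.span {d.e i}) (d.isIdempotentElem i)).injective (Subtype.ext ?_)
  change f.unop (d.e i • r • spanGenerator (d.e i)) = spanGenerator (d.e i)
  rw [map_smul, map_smul, hr, self_smul_spanGenerator (d.isIdempotentElem i)]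

instance isLocalRing_end_P (i : ι) : IsLocalRing (End (d.P i))ᵐᵒᵖ := by
  let σ : (End (d.P i))ᵐᵒᵖ ≃+* (Module.End R (Ideal.span {d.e i}))ᵐᵒᵖ :=
    RingEquiv.op (ModuleCat.endRingEquiv _)
  refine isLocalRing_of_exists_mul_eq_one ((d.endCharacter i).comp σ.toRingHom) fun f hf => ?_
  obtain ⟨g, hg⟩ := d.exists_mul_eq_one_of_endCharacter_ne_zero (σ f) hf
  exact ⟨σ.symm g, σ.injective (by rw [map_mul, σ.apply_symm_apply, hg, map_one])⟩

lemma exists_iso_P_of_indecomposable (Q : ModuleCat.{u} R) (hfinite : Module.Finite R Q)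
    (hQ : Projective Q) (hind : Indecomposable Q) : ∃ i, Nonempty (Q ≅ d.P i) := by
  have : Nontrivial Q := not_subsingleton_iff_nontrivial.1 fun _ =>
    hind.1 (ModuleCat.isZero_of_subsingleton Q)
  have : Module.Projective R Q := (IsProjective.iff_projective Q).2 hQ
  obtain ⟨m, hm, -⟩ := (eq_top_or_exists_le_coatom (⊥ : Submodule R Q)).resolve_left bot_ne_top
  have : IsSimpleModule R (Q ⧸ m) := isSimpleModule_iff_isCoatom.2 hm
  obtain ⟨i, ⟨φ⟩⟩ := d.exists_linearEquiv_of_isSimpleModule (Q ⧸ m)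
  let q : Q →ₗ[R] CharMod (d.χ i) := φ.symm.toLinearMap ∘ₗ m.mkQ
  have q_surjective : Function.Surjective q := φ.symm.surjective.comp m.mkQ_surjective
  obtain ⟨f, top_comp_f⟩ := Module.projective_lifting_property (d.top i) q (d.top_surjective i)
  have f_surjective : Function.Surjective f := d.surjective_of_top_comp_ne_zero f
    (top_comp_f ▸ LinearMap.ne_zero_of_surjective q_surjective)
  let f' : Q ⟶ d.P i := ModuleCat.ofHom f
  have : Epi f' := (ModuleCat.epi_iff_surjective _).2 f_surjective
  have := isIso_of_epi_of_indecomposable f' hind (indecomposable_of_isLocalRing_end (d.P i)).1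
  exact ⟨i, ⟨asIso f'⟩⟩

lemma isCartanMatrix {A : Type u} [Ring A] [Algebra k A] [Module.Finite k A] {n : ℕ}
    (d : BasicIdempotents k Aᵐᵒᵖ (Fin n)) (C : Matrix (Fin n) (Fin n) ℤ)
    (hC : ∀ i j, C i j = Module.finrank k (peirceCorner k (d.e i) (d.e j))) :
    IsCartanMatrix k A C :=
  ⟨d.P, fun i => ⟨inferInstance, inferInstance, indecomposable_of_isLocalRing_end (d.P i)⟩,
    fun _ _ ⟨φ⟩ => d.eq_of_iso_P φ, d.exists_iso_P_of_indecomposable, fun i j => by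
      rw [hC, finrank_projModule_hom_projModule k (d.isIdempotentElem i) (d.isIdempotentElem j)]⟩

end BasicIdempotents

/-! ### Equivalences of bounded derived categories -/

section Tilt

open DerivedCategory Limits

universe w w' v₁ v₂ u₁ u₂

variable {C : Type u₁} {C' : Type u₂} [Category.{v₁} C] [Abelian C] [HasDerivedCategory.{w} C]
  [Category.{v₂} C'] [Abelian C'] [HasDerivedCategory.{w'} C']
  (F : Bounded C ⥤ Bounded C') [F.CommShift ℤ] [F.IsTriangulated] [F.IsEquivalence]

/-- The images in the derived category of `C'` of the objects of `C` under an equivalence of bounded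
derived categories. On projective objects they form a tilting complex. -/
noncomputable def tiltFunctor : C ⥤ DerivedCategory C' :=
  boundedSingleFunctor C ⋙ F ⋙ Bounded.ι

instance : (tiltFunctor F).Full :=
  inferInstanceAs (boundedSingleFunctor C ⋙ F ⋙ Bounded.ι).Full

instance : (tiltFunctor F).Faithful :=
  inferInstanceAs (boundedSingleFunctor C ⋙ F ⋙ Bounded.ι).Faithful

instance : (tiltFunctor F).Additive :=
  inferInstanceAs (boundedSingleFunctor C ⋙ F ⋙ Bounded.ι).Additive

instance isLocalRing_end_tiltFunctor_obj (X : C) [IsLocalRing (End X)ᵐᵒᵖ] :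
    IsLocalRing (End ((tiltFunctor F).obj X))ᵐᵒᵖ :=
  let σ : (End X)ᵐᵒᵖ ≃+* (End ((tiltFunctor F).obj X))ᵐᵒᵖ :=
    (RingEquiv.ofBijective _ (mapEndRingHom_bijective (tiltFunctor F) X)).op
  RingHom.domain_isLocalRing (σ.symm : (End ((tiltFunctor F).obj X))ᵐᵒᵖ →+* (End X)ᵐᵒᵖ)

variable {P : C} [Projective P] {n : ℤ}

lemma eq_zero_of_isZero_homologyFunctor_obj_of_equivalence {Z : Bounded C}
    (h : IsZero ((homologyFunctor C n).obj Z.obj))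
    (f : (tiltFunctor F).obj P ⟶ ((F ⋙ Bounded.ι).obj Z)⟦n⟧) : f = 0 := by
  let shiftIso := (F ⋙ Bounded.ι).commShiftIso n
  obtain ⟨g, hg⟩ : ∃ g : (boundedSingleFunctor C).obj P ⟶ Z⟦n⟧,
      (F ⋙ Bounded.ι).map g = f ≫ shiftIso.inv.app Z := (F ⋙ Bounded.ι).map_surjective _
  have ι_map_g : Bounded.ι.map g ≫ (Bounded.ι.commShiftIso n).hom.app Z = 0 :=
    eq_zero_of_isZero_homologyFunctor_obj_of_projective h _
  rw [Preadditive.IsIso.comp_right_eq_zero] at ι_map_g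
  have g_eq_zero : g = 0 := Bounded.ι.map_injective (ι_map_g.trans (Functor.map_zero _ _ _).symm)
  have f_comp_eq_zero : f ≫ shiftIso.inv.app Z = 0 :=
    hg.symm.trans ((congrArg _ g_eq_zero).trans (Functor.map_zero _ _ _))
  rwa [Preadditive.IsIso.comp_right_eq_zero] at f_comp_eq_zero

lemma eq_zero_of_tiltFunctor_shift {Q : C} (hn : n ≠ 0)
    (f : (tiltFunctor F).obj P ⟶ ((tiltFunctor F).obj Q)⟦n⟧) : f = 0 :=
  eq_zero_of_isZero_homologyFunctor_obj_of_equivalence F (Z := (boundedSingleFunctor C).obj Q)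
    (isZero_homologyFunctor_obj_singleFunctor_obj Q hn) f

variable (P) in
lemma exists_forall_eq_zero_of_notMem_Icc (Y : Bounded C') :
    ∃ a b : ℤ, ∀ n ∉ Set.Icc a b, ∀ f : (tiltFunctor F).obj P ⟶ Y.obj⟦n⟧, f = 0 := by
  let Z := F.objPreimage Y
  let e : (F ⋙ Bounded.ι).obj Z ≅ Y.obj := Bounded.ι.mapIso (F.objObjPreimageIso Y)
  obtain ⟨a, _⟩ : ∃ a : ℤ, Z.obj.IsGE a := Z.property.1
  obtain ⟨b, _⟩ : ∃ b : ℤ, Z.obj.IsLE b := Z.property.2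
  refine ⟨a, b, fun n hn f => ?_⟩
  have isZero_homology : IsZero ((homologyFunctor C n).obj Z.obj) := by
    rw [Set.mem_Icc, not_and_or, not_le, not_le] at hn
    obtain hna | hbn := hn
    · exact isZero_of_isGE Z.obj a n hna
    · exact isZero_of_isLE Z.obj b n hbn
  have := eq_zero_of_isZero_homologyFunctor_obj_of_equivalence F isZero_homology (f ≫ e.inv⟦n⟧')
  rwa [Preadditive.IsIso.comp_right_eq_zero] at this

end Tilt

section BasicIdempotents

open DerivedCategory

universe w

variable (k : Type u) {R : Type u} [Field k] [Ring R] [Algebra k R] [Module.Finite k R]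
  {ι : Type*} [Fintype ι] [DecidableEq ι] (d : BasicIdempotents k R ι)

lemma finrank_P_hom_eq_homLength (i : ι) (Y : ModuleCat.{u} R) [Module.Finite R Y] :
    Module.finrank k (d.P i ⟶ Y) = homLength (d.P i) Y := by
  obtain ⟨δ, hδ⟩ := exists_finrank_hom_eq_mul_homLength k (d.P i)
  have finrank_hom_top : 1 = δ * homLength (d.P i) (d.S i) := by
    rw [← hδ (d.S i) (finite_moduleCat_hom k _ _), d.finrank_P_hom_S, if_pos rfl]
  rw [hδ Y (finite_moduleCat_hom k _ _), Nat.eq_one_of_mul_eq_one_right finrank_hom_top.symm,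
    one_mul]

variable [HasDerivedCategory.{w} (ModuleCat.{u} R)]

lemma finite_homologyFunctor_obj_singleFunctor_obj (M : ModuleCat.{u} R) [Module.Finite R M]
    (n : ℤ) :
    Module.Finite R ((homologyFunctor (ModuleCat.{u} R) n).obj ((singleFunctor _ 0).obj M)) := by
  obtain rfl | hn := eq_or_ne n 0
  · exact Module.Finite.equiv (M := M)
      ((singleFunctorCompHomologyFunctorIso (ModuleCat.{u} R) 0).app M).symm.toLinearEquiv
  · have := ModuleCat.subsingleton_of_isZero (isZero_homologyFunctor_obj_singleFunctor_obj M hn)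
    infer_instance

variable {k} {X Y : DerivedCategory (ModuleCat.{u} R)} {v w : ι → ℤ}

lemma hasEulerChar_I (hX : ∀ j, HasEulerChar k X ((singleFunctor _ 0).obj (d.S j)) (v j)) (j : ι) :
    HasEulerChar k X ((singleFunctor _ 0).obj (d.I j))
      (∑ m, v m * Module.finrank k (peirceCorner k (d.e j) (d.e m))) := by
  obtain ⟨w, hw, hasEulerChar⟩ := exists_eulerChar_expansion k 0 0
    (finite_homologyFunctor_obj_singleFunctor_obj (d.I j)) d.S d.I
    (fun N _ => d.exists_iso_of_isSimpleModule N) d.finrank_S_hom_I hX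
  have w_eq (m : ι) : w m = Module.finrank k (peirceCorner k (d.e j) (d.e m)) := by
    rw [(hw m).unique (hasEulerChar_singleFunctor_obj_of_injective k _ _),
      finrank_injModule_hom_injModule k (d.isIdempotentElem j) (d.isIdempotentElem m)]
  simpa only [w_eq] using hasEulerChar

theorem hasEulerChar_of_hasEulerChar_S (a b : ℤ) [Y.IsGE a] [Y.IsLE b]
    (hfinite : ∀ n, Module.Finite R ((homologyFunctor (ModuleCat.{u} R) n).obj Y))
    (hX : ∀ j, HasEulerChar k X ((singleFunctor _ 0).obj (d.S j)) (v j))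
    (hY : ∀ j, HasEulerChar k Y ((singleFunctor _ 0).obj (d.S j)) (w j)) :
    HasEulerChar k X Y
      (∑ j, v j * ∑ m, w m * Module.finrank k (peirceCorner k (d.e j) (d.e m))) := by
  obtain ⟨w', hw', hasEulerChar⟩ := exists_eulerChar_expansion k a b hfinite d.S d.I
    (fun N _ => d.exists_iso_of_isSimpleModule N) d.finrank_S_hom_I hX
  simpa only [fun j => (hw' j).unique (hasEulerChar_I d hY j)] using hasEulerChar

end BasicIdempotents

section CartanRelation

open DerivedCategory

universe w w'

variable (k : Type u) {R R' : Type u} [Field k] [Ring R] [Ring R'] [Algebra k R']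
  [Module.Finite k R'] [HasDerivedCategory.{w} (ModuleCat.{u} R)]
  [HasDerivedCategory.{w'} (ModuleCat.{u} R')]

include k in
lemma IsSmallObject.finite_homologyFunctor_obj {X : Bounded (ModuleCat.{u} R')}
    (hX : IsSmallObject X) (n : ℤ) :
    Module.Finite R' ((homologyFunctor (ModuleCat.{u} R') n).obj X.obj) := by
  let H := homologyFunctor (ModuleCat.{u} R') 0
  let shift := shiftFunctor (Bounded (ModuleCat.{u} R')) n
  have : Module.Finite R' (H.obj ((shift ⋙ Bounded.ι).obj X)) :=
    finite_homologyFunctor_obj_of_isSmallObject k (hX.map shift)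
  exact Module.Finite.equiv (H.mapIso ((Bounded.ι.commShiftIso n).app X) ≪≫
    (H.shiftIso n 0 n (add_zero n)).app X.obj).toLinearEquiv

variable (F : Bounded (ModuleCat.{u} R) ⥤ Bounded (ModuleCat.{u} R')) [F.CommShift ℤ]
  [F.IsTriangulated] [F.IsEquivalence]

include k in
lemma finite_homologyFunctor_obj_tiltFunctor_obj (P : ModuleCat.{u} R) [Projective P]
    [Module.Finite R P] (n : ℤ) :
    Module.Finite R' ((homologyFunctor (ModuleCat.{u} R') n).obj ((tiltFunctor F).obj P)) :=
  ((isSmallObject_boundedSingleFunctor_obj P).map F).finite_homologyFunctor_obj k n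

lemma exists_hasEulerChar_tiltFunctor_obj (P : ModuleCat.{u} R) [Projective P]
    [Module.Finite R P] (N : ModuleCat.{u} R') [Module.Finite R' N] :
    ∃ χ, HasEulerChar k ((tiltFunctor F).obj P) ((singleFunctor _ 0).obj N) χ := by
  let X := F.obj ((boundedSingleFunctor _).obj P)
  obtain ⟨a, _⟩ : ∃ a : ℤ, X.obj.IsGE a := X.property.1
  obtain ⟨b, _⟩ : ∃ b : ℤ, X.obj.IsLE b := X.property.2
  obtain ⟨a', b', eq_zero⟩ :=
    exists_forall_eq_zero_of_notMem_Icc F P ((boundedSingleFunctor _).obj N)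
  have finite_hom (n : ℤ) :=
    finite_hom_singleFunctor_obj_shift k (Y := X.obj) a b
      (finite_homologyFunctor_obj_tiltFunctor_obj k F P) N n
  refine ⟨_, finite_hom, (Set.finite_Icc a' b').subset fun n hn => ?_, rfl⟩
  by_contra hn_mem
  have : Subsingleton ((tiltFunctor F).obj P ⟶ ((singleFunctor _ 0).obj N)⟦n⟧) :=
    ⟨fun f g => (eq_zero n hn_mem f).trans (eq_zero n hn_mem g).symm⟩
  exact hn Module.finrank_zero_of_subsingleton

variable [Algebra k R] [Module.Finite k R] {ι : Type*} [Fintype ι] [DecidableEq ι]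
  (d : BasicIdempotents k R ι) (d' : BasicIdempotents k R' ι)

omit [Module.Finite k R'] in
lemma exists_finrank_tiltFunctor_hom_eq_mul (i : ι)
    (finite_hom : ∀ l,
      Module.Finite k ((tiltFunctor F).obj (d.P i) ⟶ (tiltFunctor F).obj (d.P l))) :
    ∃ δ : ℕ, δ ≠ 0 ∧
      (∀ l, Module.finrank k ((tiltFunctor F).obj (d.P i) ⟶ (tiltFunctor F).obj (d.P l)) =
        δ * Module.finrank k (peirceCorner k (d.e i) (d.e l))) ∧
      ∀ Y : DerivedCategory (ModuleCat.{u} R'), Module.Finite k ((tiltFunctor F).obj (d.P i) ⟶ Y) →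
        δ ∣ Module.finrank k ((tiltFunctor F).obj (d.P i) ⟶ Y) := by
  obtain ⟨δ, hδ⟩ := exists_finrank_hom_eq_mul_homLength k ((tiltFunctor F).obj (d.P i))
  refine ⟨δ, fun δ_eq_zero => ?_, fun l => ?_, fun Y hY => ⟨_, hδ Y hY⟩⟩
  · have finrank_eq_zero := hδ _ (finite_hom i)
    rw [δ_eq_zero, zero_mul, Module.finrank_zero_iff] at finrank_eq_zero
    have id_eq_zero : 𝟙 (d.P i) = 0 :=
      (tiltFunctor F).map_injective (finrank_eq_zero.elim _ _)
    exact one_ne_zero (α := (End (d.P i))ᵐᵒᵖ) (congrArg op id_eq_zero)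
  · rw [hδ _ (finite_hom l), homLength_map, ← finrank_P_hom_eq_homLength k d,
      finrank_projModule_hom_projModule k (d.isIdempotentElem i) (d.isIdempotentElem l)]

include F in
theorem exists_cartan_relation : ∃ (δ : ι → ℕ) (v : ι → ι → ℤ), ∀ i l,
    (Module.finrank k (peirceCorner k (d.e i) (d.e l)) : ℤ) =
      δ l * ∑ j, v i j * ∑ m, v l m * Module.finrank k (peirceCorner k (d'.e j) (d'.e m)) := by
  let T (i : ι) := (tiltFunctor F).obj (d.P i)
  choose w hw using fun i j => exists_hasEulerChar_tiltFunctor_obj k F (d.P i) (d'.S j)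
  have hasEulerChar_T (i l : ι) : HasEulerChar k (T i) (T l)
      (∑ j, w i j * ∑ m, w l m * Module.finrank k (peirceCorner k (d'.e j) (d'.e m))) := by
    let X := F.obj ((boundedSingleFunctor _).obj (d.P l))
    obtain ⟨a, _⟩ : ∃ a : ℤ, X.obj.IsGE a := X.property.1
    obtain ⟨b, _⟩ : ∃ b : ℤ, X.obj.IsLE b := X.property.2
    exact hasEulerChar_of_hasEulerChar_S d' (Y := X.obj) a b
      (finite_homologyFunctor_obj_tiltFunctor_obj k F (d.P l)) (hw i) (hw l)
  have finite_hom (i l : ι) : Module.Finite k (T i ⟶ T l) :=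
    have := (hasEulerChar_T i l).1 0
    Module.Finite.equiv (Linear.homCongr k (Iso.refl (T i)) ((shiftFunctorZero _ ℤ).app (T l)))
  choose δ δ_ne_zero finrank_hom dvd_finrank_hom using fun i =>
    exists_finrank_tiltFunctor_hom_eq_mul k F d i (finite_hom i)
  choose v hv using fun i j => (hw i j).2.dvd fun n => dvd_finrank_hom i _ ((hw i j).1 n)
  refine ⟨δ, v, fun i l => mul_left_cancel₀ (Nat.cast_ne_zero.2 (δ_ne_zero i)) ?_⟩
  have := (hasEulerChar_T i l).unique
    (hasEulerChar_of_concentrated fun _ hn => eq_zero_of_tiltFunctor_shift F hn)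
  rw [finrank_hom] at this
  push_cast at this
  rw [← this]
  simp only [hv, Finset.mul_sum]
  exact Finset.sum_congr rfl fun j _ => Finset.sum_congr rfl fun m _ => by ring

end CartanRelation

/-! ### Truncated polynomial algebras and triangular matrix algebras -/

namespace TruncPoly

variable {k : Type u} [Field k] {n : ℕ}

/-- The class of the variable in `k[x]/(x^n)`. -/
noncomputable def X : TruncPoly k n := Ideal.Quotient.mk _ Polynomial.X

lemma X_pow_eq_zero : (X : TruncPoly k n) ^ n = 0 := by
  rw [X, ← map_pow, Ideal.Quotient.eq_zero_iff_mem]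
  exact Ideal.mem_span_singleton_self _

lemma finrank_eq : Module.finrank k (TruncPoly k n) = n := by
  rw [finrank_quotient_span_eq_natDegree, Polynomial.natDegree_X_pow]

variable [NeZero n]

lemma aug_mk (p : Polynomial k) : aug k n (Ideal.Quotient.mk _ p) = p.eval 0 := by
  rw [← Polynomial.coe_aeval_eq_eval]
  rfl

lemma aug_X : aug k n X = 0 := by rw [X, aug_mk, Polynomial.eval_X]

lemma exists_eq_algebraMap_aug_add_X_mul (b : TruncPoly k n) :
    ∃ c, b = algebraMap k _ (aug k n b) + X * c := by
  obtain ⟨p, rfl⟩ := Ideal.Quotient.mk_surjective b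
  refine ⟨Ideal.Quotient.mk _ p.divX, ?_⟩
  rw [aug_mk, X, ← map_mul, ← Polynomial.coeff_zero_eq_eval_zero]
  conv_lhs => rw [← Polynomial.X_mul_divX_add p]
  rw [map_add, add_comm]
  rfl

lemma isUnit_of_aug_ne_zero {b : TruncPoly k n} (hb : aug k n b ≠ 0) : IsUnit b := by
  obtain ⟨c, hc⟩ := exists_eq_algebraMap_aug_add_X_mul b
  rw [hc]
  have isNilpotent_X_mul : IsNilpotent (X * c) := ⟨n, by rw [mul_pow, X_pow_eq_zero, zero_mul]⟩
  exact isNilpotent_X_mul.isUnit_add_left_of_commute ((IsUnit.mk0 _ hb).map _) (Commute.all _ _)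

end TruncPoly

namespace TriMat

section DiagIdempotent

variable (R S M : Type u) [Ring R] [Ring S] [AddCommGroup M]

/-- The diagonal idempotents of a triangular matrix ring, as elements of the opposite ring because
right modules are modules over the opposite ring. -/
def diagIdempotent : Fin 2 → (TriMat R S M)ᵐᵒᵖ := ![op ⟨1, 0, 0⟩, op ⟨0, 0, 1⟩]

lemma diagIdempotent_zero : diagIdempotent R S M 0 = op ⟨1, 0, 0⟩ := rfl

lemma diagIdempotent_one : diagIdempotent R S M 1 = op ⟨0, 0, 1⟩ := rfl

end DiagIdempotent

variable {k R S M : Type u} [Field k] [Ring R] [Ring S] [Algebra k R] [Algebra k S]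
  [AddCommGroup M] [Module k M] [Module R M] [Module Sᵐᵒᵖ M] [SMulCommClass R Sᵐᵒᵖ M]
  [IsScalarTower k R M] [IsScalarTower k Sᵐᵒᵖ M]

variable (k R S M) in
/-- The projection of a triangular matrix algebra to its upper left entry. -/
def aHom : TriMat R S M →ₐ[k] R :=
  AlgHom.ofLinearMap { toFun x := x.a, map_add' := add_a, map_smul' := smul_a } rfl mul_a

@[simp]
lemma aHom_apply (x : TriMat R S M) : aHom k R S M x = x.a := rfl

variable (k R S M) in
/-- The projection of a triangular matrix algebra to its lower right entry. -/
def bHom : TriMat R S M →ₐ[k] S :=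
  AlgHom.ofLinearMap { toFun x := x.b, map_add' := add_b, map_smul' := smul_b } rfl mul_b

@[simp]
lemma bHom_apply (x : TriMat R S M) : bHom k R S M x = x.b := rfl

lemma mem_peirceCorner_diagIdempotent {i j : Fin 2} {x : (TriMat R S M)ᵐᵒᵖ} :
    x ∈ peirceCorner k (diagIdempotent R S M i) (diagIdempotent R S M j) ↔
      unop x * unop (diagIdempotent R S M i) = unop x ∧
        unop (diagIdempotent R S M j) * unop x = unop x := by
  rw [mem_peirceCorner, ← unop_inj, ← unop_inj, unop_mul, unop_mul]

lemma mem_peirceCorner_zero_zero {x : (TriMat R S M)ᵐᵒᵖ} :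
    x ∈ peirceCorner k (diagIdempotent R S M 0) (diagIdempotent R S M 0) ↔
      (unop x).m = 0 ∧ (unop x).b = 0 := by
  rw [mem_peirceCorner_diagIdempotent, diagIdempotent_zero]
  simp [TriMat.ext_iff, eq_comm]

lemma mem_peirceCorner_one_one {x : (TriMat R S M)ᵐᵒᵖ} :
    x ∈ peirceCorner k (diagIdempotent R S M 1) (diagIdempotent R S M 1) ↔
      (unop x).a = 0 ∧ (unop x).m = 0 := by
  rw [mem_peirceCorner_diagIdempotent, diagIdempotent_one]
  simp [TriMat.ext_iff, eq_comm]

lemma mem_peirceCorner_one_zero {x : (TriMat R S M)ᵐᵒᵖ} :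
    x ∈ peirceCorner k (diagIdempotent R S M 1) (diagIdempotent R S M 0) ↔
      (unop x).a = 0 ∧ (unop x).b = 0 := by
  rw [mem_peirceCorner_diagIdempotent, diagIdempotent_zero, diagIdempotent_one]
  simp [TriMat.ext_iff, eq_comm]

lemma mem_peirceCorner_zero_one {x : (TriMat R S M)ᵐᵒᵖ} :
    x ∈ peirceCorner k (diagIdempotent R S M 0) (diagIdempotent R S M 1) ↔ x = 0 := by
  rw [mem_peirceCorner_diagIdempotent, diagIdempotent_zero, diagIdempotent_one]
  simp only [← unop_eq_zero_iff, TriMat.ext_iff, unop_op, mul_a, mul_m, mul_b, zero_a, zero_m,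
    zero_b, mul_zero, zero_mul, smul_zero, zero_smul, op_zero, add_zero, eq_comm (a := (0 : R)),
    eq_comm (a := (0 : M)), eq_comm (a := (0 : S)), mul_one, one_mul]
  tauto

/-- The Peirce component of the upper left entries. -/
def cornerEquivA :
    peirceCorner k (diagIdempotent R S M 0) (diagIdempotent R S M 0) ≃ₗ[k] R where
  toFun x := (unop x.1).a
  invFun r := ⟨op ⟨r, 0, 0⟩, mem_peirceCorner_zero_zero.2 ⟨rfl, rfl⟩⟩
  map_add' _ _ := rfl
  map_smul' _ _ := rfl
  left_inv x :=
    have ⟨hm, hb⟩ := mem_peirceCorner_zero_zero.1 x.2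
    Subtype.ext (unop_injective (TriMat.ext rfl hm.symm hb.symm))
  right_inv _ := rfl

/-- The Peirce component of the lower right entries. -/
def cornerEquivB :
    peirceCorner k (diagIdempotent R S M 1) (diagIdempotent R S M 1) ≃ₗ[k] S where
  toFun x := (unop x.1).b
  invFun s := ⟨op ⟨0, 0, s⟩, mem_peirceCorner_one_one.2 ⟨rfl, rfl⟩⟩
  map_add' _ _ := rfl
  map_smul' _ _ := rfl
  left_inv x :=
    have ⟨ha, hm⟩ := mem_peirceCorner_one_one.1 x.2
    Subtype.ext (unop_injective (TriMat.ext ha.symm hm.symm rfl))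
  right_inv _ := rfl

/-- The Peirce component of the upper right entries. -/
def cornerEquivM :
    peirceCorner k (diagIdempotent R S M 1) (diagIdempotent R S M 0) ≃ₗ[k] M where
  toFun x := (unop x.1).m
  invFun m := ⟨op ⟨0, m, 0⟩, mem_peirceCorner_one_zero.2 ⟨rfl, rfl⟩⟩
  map_add' _ _ := rfl
  map_smul' _ _ := rfl
  left_inv x :=
    have ⟨ha, hb⟩ := mem_peirceCorner_one_zero.1 x.2
    Subtype.ext (unop_injective (TriMat.ext ha.symm rfl hb.symm))
  right_inv _ := rfl

lemma finrank_peirceCorner_zero_one :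
    Module.finrank k (peirceCorner k (diagIdempotent R S M 0) (diagIdempotent R S M 1)) = 0 := by
  have : Subsingleton (peirceCorner k (diagIdempotent R S M 0) (diagIdempotent R S M 1)) :=
    ⟨fun x y => Subtype.ext
      ((mem_peirceCorner_zero_one.1 x.2).trans (mem_peirceCorner_zero_one.1 y.2).symm)⟩
  exact Module.finrank_zero_of_subsingleton

lemma finrank_peirceCorner (i j : Fin 2) :
    (Module.finrank k (peirceCorner k (diagIdempotent R S M i) (diagIdempotent R S M j)) : ℤ) =
      !![(Module.finrank k R : ℤ), 0; Module.finrank k M, Module.finrank k S] i j := by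
  fin_cases i <;> fin_cases j
  · exact congrArg Nat.cast cornerEquivA.finrank_eq
  · exact congrArg Nat.cast finrank_peirceCorner_zero_one
  · exact congrArg Nat.cast cornerEquivM.finrank_eq
  · exact congrArg Nat.cast cornerEquivB.finrank_eq

/-- The basic idempotents of a triangular matrix algebra whose diagonal entries are local algebras
with residue field `k`. -/
def basicIdempotents (α : R →ₐ[k] k) (β : S →ₐ[k] k) (hα : ∀ r, α r ≠ 0 → IsUnit r)
    (hβ : ∀ s, β s ≠ 0 → IsUnit s) : BasicIdempotents k (TriMat R S M)ᵐᵒᵖ (Fin 2) where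
  e := diagIdempotent R S M
  χ := ![(α.comp (aHom k R S M)).fromOpposite fun _ _ => Commute.all _ _,
    (β.comp (bHom k R S M)).fromOpposite fun _ _ => Commute.all _ _]
  isIdempotentElem i := by
    apply unop_injective
    fin_cases i <;> ext <;> simp [diagIdempotent]
  sum_eq_one := by
    apply unop_injective
    ext <;> simp [diagIdempotent]
  χ_e i j := by fin_cases i <;> fin_cases j <;> simp [diagIdempotent]
  exists_mul_eq_of_mem_peirceCorner
    | 0, x, hx, hχ => by
      obtain ⟨r, hr⟩ := (hα (unop x).a hχ).exists_right_inv
      obtain ⟨hm, -⟩ := mem_peirceCorner_zero_zero.1 hx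
      refine ⟨op ⟨r, 0, 0⟩, unop_injective (TriMat.ext hr ?_ ?_)⟩ <;>
        simp [diagIdempotent_zero, hm]
    | 1, x, hx, hχ => by
      obtain ⟨s, hs⟩ := (hβ (unop x).b hχ).exists_right_inv
      obtain ⟨-, hm⟩ := mem_peirceCorner_one_one.1 hx
      refine ⟨op ⟨0, 0, s⟩, unop_injective (TriMat.ext ?_ ?_ hs)⟩ <;>
        simp [diagIdempotent_one, hm]

variable {N : Type u} [AddCommGroup N] [Module k N] [Module R N] [Module Sᵐᵒᵖ N]
  [SMulCommClass R Sᵐᵒᵖ N] [IsScalarTower k R N] [IsScalarTower k Sᵐᵒᵖ N]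

/-- The isomorphism of triangular matrix algebras induced by an isomorphism of bimodules. -/
def congrBimodule (f : M ≃ₗ[k] N) (map_left_smul : ∀ (r : R) m, f (r • m) = r • f m)
    (map_right_smul : ∀ (s : Sᵐᵒᵖ) m, f (s • m) = s • f m) :
    TriMat R S M ≃ₐ[k] TriMat R S N :=
  AlgEquiv.ofLinearEquiv
    { toFun x := ⟨x.a, f x.m, x.b⟩
      invFun x := ⟨x.a, f.symm x.m, x.b⟩
      map_add' _ _ := TriMat.ext rfl (map_add f _ _) rfl
      map_smul' _ _ := TriMat.ext rfl (map_smul f _ _) rfl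
      left_inv _ := TriMat.ext rfl (f.symm_apply_apply _) rfl
      right_inv _ := TriMat.ext rfl (f.apply_symm_apply _) rfl }
    (TriMat.ext rfl (map_zero f) rfl)
    fun x y => TriMat.ext rfl (by simp [map_left_smul, map_right_smul]) rfl

end TriMat

/-! ### The Cartan matrices of the example -/

/-- The binary quadratic form of the Cartan matrix `(3 0; 1 2)`, of discriminant `-23`. -/
def mateForm (a b : ℤ) : ℤ := 3 * a ^ 2 + a * b + 2 * b ^ 2

lemma eq_of_mateForm_eq_two {a b : ℤ} (h : mateForm a b = 2) : a = 0 ∧ (b = 1 ∨ b = -1) := by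
  rw [mateForm] at h
  have b_le : b ≤ 1 := by nlinarith [sq_nonneg (6 * a + b)]
  have le_b : -1 ≤ b := by nlinarith [sq_nonneg (6 * a + b)]
  have a_le : a ≤ 0 := by nlinarith [sq_nonneg (a + 4 * b)]
  have le_a : 0 ≤ a := by nlinarith [sq_nonneg (a + 4 * b)]
  obtain rfl : a = 0 := le_antisymm a_le le_a
  interval_cases b <;> simp_all

lemma eq_of_mateForm_eq_three {a b : ℤ} (h : mateForm a b = 3) : (a = 1 ∨ a = -1) ∧ b = 0 := by
  rw [mateForm] at h
  have b_le : b ≤ 1 := by nlinarith [sq_nonneg (6 * a + b)]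
  have le_b : -1 ≤ b := by nlinarith [sq_nonneg (6 * a + b)]
  have a_le : a ≤ 1 := by nlinarith [sq_nonneg (a + 4 * b)]
  have le_a : -1 ≤ a := by nlinarith [sq_nonneg (a + 4 * b)]
  interval_cases b <;> interval_cases a <;> simp_all

lemma mateForm_ne_one (a b : ℤ) : mateForm a b ≠ 1 := by
  rw [mateForm]
  intro h
  have b_le : b ≤ 0 := by nlinarith [sq_nonneg (6 * a + b)]
  have le_b : 0 ≤ b := by nlinarith [sq_nonneg (6 * a + b)]
  obtain rfl : b = 0 := le_antisymm b_le le_b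
  omega

lemma not_intCongruent : ¬ IntCongruent !![2, 0; 1, 3] !![3, 0; 1, 2] := by
  rintro ⟨P, -, h⟩
  have entry (i j : Fin 2) :
      (2 * P 0 i + P 1 i) * P 0 j + 3 * P 1 i * P 1 j = !![3, 0; 1, 2] i j := by
    rw [← h]
    simp only [Matrix.mul_apply, Fin.sum_univ_two, Matrix.transpose_apply, Matrix.of_apply,
      Matrix.cons_val_zero, Matrix.cons_val_one, Matrix.cons_val', Matrix.cons_val_fin_one]
    ring
  have form_fst : mateForm (P 1 0) (P 0 0) = 3 := by
    rw [mateForm]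
    exact .trans (by ring) (entry 0 0)
  have form_snd : mateForm (P 1 1) (P 0 1) = 2 := by
    rw [mateForm]
    exact .trans (by ring) (entry 1 1)
  have entry_zero_one : (2 * P 0 0 + P 1 0) * P 0 1 + 3 * P 1 0 * P 1 1 = 0 := entry 0 1
  obtain ⟨h10 | h10, h00⟩ := eq_of_mateForm_eq_three form_fst <;>
    obtain ⟨h11, h01 | h01⟩ := eq_of_mateForm_eq_two form_snd <;>
    norm_num [h00, h01, h10, h11] at entry_zero_one

lemma not_cartan_relation {δ : Fin 2 → ℕ} {v : Fin 2 → Fin 2 → ℤ}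
    (h : ∀ i l, (!![2, 0; 1, 3] : Matrix (Fin 2) (Fin 2) ℤ) i l =
      δ l * ∑ j, v i j * ∑ m, v l m * (!![3, 0; 1, 2] : Matrix (Fin 2) (Fin 2) ℤ) j m) : False := by
  have entry (i l : Fin 2) : (!![2, 0; 1, 3] : Matrix (Fin 2) (Fin 2) ℤ) i l =
      δ l * (3 * v i 0 * v l 0 + v i 1 * v l 0 + 2 * v i 1 * v l 1) := by
    rw [h]
    simp only [Fin.sum_univ_two, Matrix.of_apply, Matrix.cons_val_zero, Matrix.cons_val_one,
      Matrix.cons_val', Matrix.cons_val_fin_one]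
    ring
  have form_eq (i : Fin 2) :
      (!![2, 0; 1, 3] : Matrix (Fin 2) (Fin 2) ℤ) i i = δ i * mateForm (v i 0) (v i 1) := by
    rw [entry, mateForm]
    ring
  have δ_zero : (δ 0 : ℤ) = 1 := Int.eq_one_of_dvd_one (by positivity) ⟨_, entry 1 0⟩
  have form_zero : mateForm (v 0 0) (v 0 1) = 2 := by
    rw [← one_mul (mateForm _ _), ← δ_zero, ← form_eq]
    rfl
  have form_one : 3 = δ 1 * mateForm (v 1 0) (v 1 1) := form_eq 1
  have δ_one_dvd : δ 1 ∣ 3 := Int.natCast_dvd_natCast.1 ⟨_, form_one⟩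
  obtain δ_one | δ_one := (Nat.dvd_prime Nat.prime_three).1 δ_one_dvd
  · have entry_zero_one :
        0 = (δ 1 : ℤ) * (3 * v 0 0 * v 1 0 + v 0 1 * v 1 0 + 2 * v 0 1 * v 1 1) := entry 0 1
    rw [δ_one, Nat.cast_one, one_mul] at form_one entry_zero_one
    obtain ⟨h00, h01 | h01⟩ := eq_of_mateForm_eq_two form_zero <;>
      obtain ⟨h10 | h10, h11⟩ := eq_of_mateForm_eq_three form_one.symm <;>
      norm_num [h00, h01, h10, h11] at entry_zero_one
  · rw [δ_one, Nat.cast_ofNat] at form_one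
    exact mateForm_ne_one (v 1 0) (v 1 1) (by linarith)

section Example

variable (k : Type u) [Field k]

lemma finrank_simpleBimod (n m : ℕ) : Module.finrank k (SimpleBimod k n m) = 1 :=
  Module.finrank_self k

/-- The identification of the `k`-dual of the simple bimodule with the simple bimodule with `x` and
`y` exchanged. -/
noncomputable def dualSimpleBimodEquiv (n m : ℕ) :
    DualBimod k (SimpleBimod k n m) ≃ₗ[k] SimpleBimod k m n :=
  LinearMap.ringLmapEquivSelf k k k

lemma finrank_dualBimod_simpleBimod (n m : ℕ) :
    Module.finrank k (DualBimod k (SimpleBimod k n m)) = 1 := by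
  rw [(dualSimpleBimodEquiv k n m).finrank_eq, finrank_simpleBimod]

lemma dualSimpleBimodEquiv_left_smul (n m : ℕ) [NeZero m] (r : TruncPoly k m)
    (φ : DualBimod k (SimpleBimod k n m)) :
    dualSimpleBimodEquiv k n m (r • φ) = r • dualSimpleBimodEquiv k n m φ := by
  rw [SimpleBimod.left_smul_def, ← map_smul]
  refine congrArg _ (DualBimod.ext fun c => ?_)
  rw [DualBimod.left_smul_apply, DualBimod.smul_apply, SimpleBimod.right_smul_def, unop_op,
    map_smul]

lemma dualSimpleBimodEquiv_right_smul (n m : ℕ) [NeZero n] (r : (TruncPoly k n)ᵐᵒᵖ)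
    (φ : DualBimod k (SimpleBimod k n m)) :
    dualSimpleBimodEquiv k n m (r • φ) = r • dualSimpleBimodEquiv k n m φ := by
  rw [SimpleBimod.right_smul_def, ← map_smul]
  refine congrArg _ (DualBimod.ext fun c => ?_)
  rw [DualBimod.right_smul_apply, DualBimod.smul_apply, SimpleBimod.left_smul_def, map_smul]

/-- The mate of the triangular matrix algebra of the simple bimodule is the triangular matrix
algebra of the simple bimodule with `x` and `y` exchanged. -/
noncomputable def mateSimpleBimodEquiv (n m : ℕ) [NeZero n] [NeZero m] :
    Mate k (TruncPoly k n) (TruncPoly k m) (SimpleBimod k n m) ≃ₐ[k]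
      TriMat (TruncPoly k m) (TruncPoly k n) (SimpleBimod k m n) :=
  TriMat.congrBimodule (dualSimpleBimodEquiv k n m) (dualSimpleBimodEquiv_left_smul k n m)
    (dualSimpleBimodEquiv_right_smul k n m)

/-- The basic idempotents of `ExLambda k`. -/
noncomputable def ExLambda.basicIdempotents : BasicIdempotents k (ExLambda k)ᵐᵒᵖ (Fin 2) :=
  TriMat.basicIdempotents (TruncPoly.aug k 2) (TruncPoly.aug k 3)
    (fun _ => TruncPoly.isUnit_of_aug_ne_zero) (fun _ => TruncPoly.isUnit_of_aug_ne_zero)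

/-- The basic idempotents of `ExMate k`. -/
noncomputable def ExMate.basicIdempotents : BasicIdempotents k (ExMate k)ᵐᵒᵖ (Fin 2) :=
  TriMat.basicIdempotents (TruncPoly.aug k 3) (TruncPoly.aug k 2)
    (fun _ => TruncPoly.isUnit_of_aug_ne_zero) (fun _ => TruncPoly.isUnit_of_aug_ne_zero)

lemma ExLambda.cartan_apply (i j : Fin 2) : (!![2, 0; 1, 3] : Matrix (Fin 2) (Fin 2) ℤ) i j =
    Module.finrank k (peirceCorner k ((ExLambda.basicIdempotents k).e i)
      ((ExLambda.basicIdempotents k).e j)) := by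
  refine .trans ?_ (TriMat.finrank_peirceCorner i j).symm
  rw [TruncPoly.finrank_eq, TruncPoly.finrank_eq, finrank_simpleBimod]
  rfl

lemma ExMate.cartan_apply (i j : Fin 2) : (!![3, 0; 1, 2] : Matrix (Fin 2) (Fin 2) ℤ) i j =
    Module.finrank k (peirceCorner k ((ExMate.basicIdempotents k).e i)
      ((ExMate.basicIdempotents k).e j)) := by
  refine .trans ?_ (TriMat.finrank_peirceCorner i j).symm
  rw [TruncPoly.finrank_eq, TruncPoly.finrank_eq, finrank_dualBimod_simpleBimod]
  rfl

theorem not_derivedEquivalent : ¬ DerivedEquivalent (ExLambda k) (ExMate k) := by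
  let := HasDerivedCategory.standard (ModuleCat.{u} (ExLambda k)ᵐᵒᵖ)
  let := HasDerivedCategory.standard (ModuleCat.{u} (ExMate k)ᵐᵒᵖ)
  rintro ⟨F, _, _, _⟩
  obtain ⟨δ, v, hv⟩ := exists_cartan_relation k F (ExLambda.basicIdempotents k)
    (ExMate.basicIdempotents k)
  refine not_cartan_relation (δ := δ) (v := v) fun i l => ?_
  rw [ExLambda.cartan_apply k, hv i l]
  simp only [ExMate.cartan_apply k]

end Example

/-! ### Self-injectivity and projective dimension -/

lemma projective_mulOpposite_self (R : Type*) [Ring R] : Module.Projective Rᵐᵒᵖ R :=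
  .of_equiv
    { toFun := unop
      invFun := op
      map_add' _ _ := rfl
      map_smul' _ _ := rfl
      left_inv _ := rfl
      right_inv _ := rfl : Rᵐᵒᵖ ≃ₗ[Rᵐᵒᵖ] R }

lemma not_hasProjectiveDimensionLE_of_shortExact {C : Type*} [Category C] [Abelian C]
    {V K P Q : C} [Projective P] [Projective Q] {i : K ⟶ P} {p : P ⟶ V} {j : V ⟶ Q} {q : Q ⟶ K}
    {i_p : i ≫ p = 0} {j_q : j ≫ q = 0} (hip : (ShortComplex.mk i p i_p).ShortExact)
    (hjq : (ShortComplex.mk j q j_q).ShortExact) (hV : ¬ Projective V) (d : ℕ) :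
    ¬ HasProjectiveDimensionLE V d := by
  induction d with
  | zero => exact fun h => hV (projective_iff_hasProjectiveDimensionLT_one.2 h)
  | succ d ih =>
    intro h
    have hK : HasProjectiveDimensionLT K (d + 1) :=
      (hip.hasProjectiveDimensionLT_X₃_iff d ‹Projective P›).1 h
    have hK' : HasProjectiveDimensionLT K (d + 2) :=
      hasProjectiveDimensionLT_of_ge K (d + 1) (d + 2) (by lia)
    exact ih ((hjq.hasProjectiveDimensionLT_X₃_iff d ‹Projective Q›).1 hK')

namespace TruncPoly

variable {k : Type u} [Field k] {n : ℕ} [NeZero n]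

variable (k n) in
/-- The coefficient of `x ^ (n - 1)`, which makes `k[x]/(x^n)` a Frobenius algebra. -/
noncomputable def frobeniusForm : TruncPoly k n →ₗ[k] k :=
  Submodule.liftQ ((Ideal.span {(Polynomial.X : Polynomial k) ^ n}).restrictScalars k)
    (Polynomial.lcoeff k (n - 1)) (fun _ hp =>
      Polynomial.X_pow_dvd_iff.1 (Ideal.mem_span_singleton.1 hp) (n - 1)
        (Nat.sub_lt (Nat.pos_of_neZero n) one_pos)) ∘ₗ
    (Submodule.Quotient.restrictScalarsEquiv k
      (Ideal.span {(Polynomial.X : Polynomial k) ^ n})).symm.toLinearMap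

lemma frobeniusForm_mk (p : Polynomial k) :
    frobeniusForm k n (Ideal.Quotient.mk _ p) = p.coeff (n - 1) := rfl

lemma eq_zero_of_frobeniusForm_mul_eq_zero {b : TruncPoly k n}
    (h : ∀ c, frobeniusForm k n (b * c) = 0) : b = 0 := by
  obtain ⟨p, rfl⟩ := Ideal.Quotient.mk_surjective b
  rw [Ideal.Quotient.eq_zero_iff_mem, Ideal.mem_span_singleton, Polynomial.X_pow_dvd_iff]
  intro i hi
  have coeff_eq_zero := h (Ideal.Quotient.mk _ (Polynomial.X ^ (n - 1 - i)))
  rwa [← map_mul, frobeniusForm_mk, show n - 1 = i + (n - 1 - i) by lia,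
    Nat.add_sub_cancel_left, Polynomial.coeff_mul_X_pow] at coeff_eq_zero

variable (k n) in
/-- The map `b ↦ (c ↦ frobeniusForm (b * c))` to the `k`-dual. -/
noncomputable def toCoind :
    TruncPoly k n →ₗ[(TruncPoly k n)ᵐᵒᵖ] Coind k (TruncPoly k n)ᵐᵒᵖ k :=
  Coind.lift (frobeniusForm k n)

lemma toCoind_bijective : Function.Bijective (toCoind k n) := by
  have injective : Function.Injective (toCoind k n) := by
    rw [injective_iff_map_eq_zero]
    exact fun b hb =>
      eq_zero_of_frobeniusForm_mul_eq_zero fun c => congrArg (fun φ => φ (op c)) hb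
  let f : TruncPoly k n →ₗ[k] ((TruncPoly k n)ᵐᵒᵖ →ₗ[k] k) :=
    (toCoind k n).restrictScalars k
  refine ⟨injective, (LinearMap.injective_iff_surjective_of_finrank_eq_finrank (f := f) ?_).1
    injective⟩
  rw [Module.finrank_linearMap_self, (opLinearEquiv k (M := TruncPoly k n)).finrank_eq]

theorem selfInjective : Module.Injective (TruncPoly k n)ᵐᵒᵖ (TruncPoly k n) :=
  .of_ringEquiv (.refl _) (LinearEquiv.ofBijective (toCoind k n) toCoind_bijective).symm

omit [NeZero n] in
lemma X_pow_ne_zero {i : ℕ} (hi : i < n) : (X : TruncPoly k n) ^ i ≠ 0 := by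
  rw [X, ← map_pow, Ne, Ideal.Quotient.eq_zero_iff_mem, Ideal.mem_span_singleton,
    Polynomial.X_pow_dvd_iff]
  intro h
  exact one_ne_zero ((Polynomial.coeff_X_pow_self i).symm.trans (h i hi))

lemma X_mul_X_pow_sub_one : X * X ^ (n - 1) = (0 : TruncPoly k n) := by
  rw [mul_pow_sub_one (NeZero.ne n), X_pow_eq_zero]

lemma X_pow_sub_one_mul (b : TruncPoly k n) :
    X ^ (n - 1) * b = aug k n b • (X : TruncPoly k n) ^ (n - 1) := by
  obtain ⟨c, hc⟩ := exists_eq_algebraMap_aug_add_X_mul b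
  conv_lhs => rw [hc, mul_add, ← mul_assoc, mul_comm _ X, X_mul_X_pow_sub_one, zero_mul, add_zero,
    mul_comm, ← Algebra.smul_def]

lemma exists_eq_smul_X_pow_of_X_mul_eq_zero {b : TruncPoly k n} (h : X * b = 0) :
    ∃ c : k, b = c • X ^ (n - 1) := by
  obtain ⟨p, rfl⟩ := Ideal.Quotient.mk_surjective b
  rw [X, ← map_mul, Ideal.Quotient.eq_zero_iff_mem, Ideal.mem_span_singleton,
    ← mul_pow_sub_one (NeZero.ne n), mul_dvd_mul_iff_left Polynomial.X_ne_zero] at h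
  obtain ⟨q, rfl⟩ := h
  exact ⟨aug k n (Ideal.Quotient.mk _ q), by rw [← X_pow_sub_one_mul, map_mul, map_pow, X]⟩

variable {m : ℕ}

variable (k n m) in
/-- The augmentation as a homomorphism of right modules to the simple module. -/
noncomputable def toSimple : TruncPoly k n →ₗ[(TruncPoly k n)ᵐᵒᵖ] SimpleBimod k m n where
  toFun := aug k n
  map_add' := map_add (aug k n)
  map_smul' s b := (map_mul (aug k n) b (unop s)).trans (mul_comm _ _)

variable (k n m) in
/-- The inclusion of the simple module as the socle. -/
noncomputable def ofSimple : SimpleBimod k m n →ₗ[(TruncPoly k n)ᵐᵒᵖ] TruncPoly k n where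
  toFun (c : k) := c • X ^ (n - 1)
  map_add' (c c' : k) := add_smul c c' _
  map_smul' s (c : k) := by
    change (aug k n (unop s) * c) • (X : TruncPoly k n) ^ (n - 1) = (c • X ^ (n - 1)) * unop s
    rw [smul_mul_assoc, X_pow_sub_one_mul, smul_smul, mul_comm]

variable (k n m) in
/-- Multiplication by the variable, as a map to the augmentation ideal. -/
noncomputable def mulX : TruncPoly k n →ₗ[(TruncPoly k n)ᵐᵒᵖ] LinearMap.ker (toSimple k n m) where
  toFun b := ⟨X * b, by
    change aug k n (X * b) = 0
    rw [map_mul, aug_X, zero_mul]⟩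
  map_add' b c := Subtype.ext (mul_add X b c)
  map_smul' s b := Subtype.ext (mul_assoc X b (unop s)).symm

lemma toSimple_surjective : Function.Surjective (toSimple k n m) := fun (c : k) =>
  ⟨algebraMap k (TruncPoly k n) c, (aug k n).commutes c⟩

lemma ofSimple_injective : Function.Injective (ofSimple k n m) := fun (_ _ : k) h =>
  smul_left_injective k (X_pow_ne_zero (Nat.sub_lt (Nat.pos_of_neZero n) one_pos)) h

lemma mulX_surjective : Function.Surjective (mulX k n m) := by
  rintro ⟨b, aug_eq_zero : aug k n b = 0⟩
  obtain ⟨c, hc⟩ := exists_eq_algebraMap_aug_add_X_mul b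
  rw [aug_eq_zero, map_zero, zero_add] at hc
  exact ⟨c, Subtype.ext hc.symm⟩

lemma exact_ofSimple_mulX : Function.Exact (ofSimple k n m) (mulX k n m) := by
  refine fun b => ⟨fun hb => ?_, ?_⟩
  · obtain ⟨c, hc⟩ := exists_eq_smul_X_pow_of_X_mul_eq_zero (congrArg Subtype.val hb)
    exact ⟨c, hc.symm⟩
  · rintro ⟨c, rfl⟩
    refine Subtype.ext ?_
    change (X : TruncPoly k n) * ((show k from c) • X ^ (n - 1)) = 0
    rw [mul_smul_comm, X_mul_X_pow_sub_one, smul_zero]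

lemma not_projective_simpleBimod (hn : 1 < n) :
    ¬ Projective (ModuleCat.of (TruncPoly k n)ᵐᵒᵖ (SimpleBimod k m n)) := by
  intro h
  have : Module.Projective (TruncPoly k n)ᵐᵒᵖ (SimpleBimod k m n) :=
    (IsProjective.iff_projective _).2 h
  obtain ⟨s, hs⟩ := Module.projective_lifting_property (toSimple k n m) LinearMap.id
    toSimple_surjective
  let v : SimpleBimod k m n := (1 : k)
  have aug_s : aug k n (s v) = 1 := LinearMap.congr_fun hs v
  have X_smul_v : op (X : TruncPoly k n) • v = 0 := by
    rw [SimpleBimod.right_smul_def, unop_op, aug_X, zero_smul]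
  have s_mul_X : s v * X = 0 := by
    rw [← op_smul_eq_mul, ← map_smul, X_smul_v, map_zero]
  have isUnit_s : IsUnit (s v) := isUnit_of_aug_ne_zero (aug_s ▸ one_ne_zero)
  refine X_pow_ne_zero (k := k) hn ?_
  rwa [pow_one, ← isUnit_s.mul_right_eq_zero]

theorem not_hasProjectiveDimensionLE (hn : 1 < n) (d : ℕ) :
    ¬ HasProjectiveDimensionLE (ModuleCat.of (TruncPoly k n)ᵐᵒᵖ (SimpleBimod k m n)) d := by
  let A := ModuleCat.of (TruncPoly k n)ᵐᵒᵖ (TruncPoly k n)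
  have : Projective A := (IsProjective.iff_projective _).1 (projective_mulOpposite_self _)
  let i : ModuleCat.of _ (LinearMap.ker (toSimple k n m)) ⟶ A :=
    ModuleCat.ofHom (LinearMap.ker (toSimple k n m)).subtype
  let q : A ⟶ ModuleCat.of _ (LinearMap.ker (toSimple k n m)) := ModuleCat.ofHom (mulX k n m)
  have comp_toSimple : i ≫ ModuleCat.ofHom (toSimple k n m) = 0 := by
    ext x
    exact x.2
  have ofSimple_comp : ModuleCat.ofHom (ofSimple k n m) ≫ q = 0 := by
    refine ModuleCat.hom_ext (LinearMap.ext fun c => ?_)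
    exact (exact_ofSimple_mulX (k := k) (n := n) (m := m)).apply_apply_eq_zero c
  exact not_hasProjectiveDimensionLE_of_shortExact
    (ModuleCat.shortComplex_shortExact (.mk _ _ comp_toSimple) (LinearMap.exact_subtype_ker_map _)
      (Submodule.injective_subtype _) toSimple_surjective)
    (ModuleCat.shortComplex_shortExact (.mk _ _ ofSimple_comp) exact_ofSimple_mulX
      ofSimple_injective mulX_surjective)
    (not_projective_simpleBimod hn) d

end TruncPoly

/-! ### Repetitive algebras of mates -/

lemma finite_support_of_finsupp {ι A B N : Type*} [Zero A] [Zero B] [Zero N] (u : ι →₀ A)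
    (v : ι →₀ B) {e : ι → ι} (he : Function.Injective e) {F : ι → N}
    (hF : ∀ i, u i = 0 → u (e i) = 0 → v i = 0 → v (e i) = 0 → F i = 0) : F.support.Finite := by
  have finite_union := u.hasFiniteSupport.union v.hasFiniteSupport
  refine (finite_union.union (finite_union.preimage he.injOn)).subset fun i hi => ?_
  by_contra h
  simp only [Set.mem_union, Set.mem_preimage, Function.mem_support, not_or, not_not] at h
  exact hi (hF i h.1.1 h.2.1 h.1.2 h.2.2)

namespace DualBimod

variable {k M N : Type u} [Field k] [AddCommGroup M] [Module k M] [AddCommGroup N] [Module k N]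

/-- The functional `φ ∘ f`. -/
def comp (φ : DualBimod k N) (f : M →ₗ[k] N) : DualBimod k M :=
  (show Module.Dual k N from φ) ∘ₗ f

@[simp] lemma comp_apply (φ : DualBimod k N) (f : M →ₗ[k] N) (m : M) : φ.comp f m = φ (f m) := rfl

variable (k) in
/-- Evaluation at `m`, as an element of the double dual. -/
def eval (m : M) : DualBimod k (DualBimod k M) :=
  ({ toFun φ := φ m, map_add' _ _ := rfl, map_smul' _ _ := rfl } : DualBimod k M →ₗ[k] k)

@[simp] lemma eval_apply (m : M) (φ : DualBimod k M) : eval k m φ = φ m := rfl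

variable (k M) in
/-- The canonical isomorphism from a finite-dimensional space to its double dual. -/
noncomputable def evalEquiv [Module.Finite k M] : M ≃ₗ[k] DualBimod k (DualBimod k M) :=
  .ofBijective
    { toFun := eval k
      map_add' m m' := DualBimod.ext fun φ => map_add φ m m'
      map_smul' c m := DualBimod.ext fun φ => by simp }
    (Module.evalEquiv k M).bijective

@[simp] lemma evalEquiv_apply [Module.Finite k M] (m : M) (φ : DualBimod k M) :
    evalEquiv k M m φ = φ m := rfl

@[simp] lemma apply_evalEquiv_symm [Module.Finite k M] (ψ : DualBimod k (DualBimod k M))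
    (φ : DualBimod k M) : φ ((evalEquiv k M).symm ψ) = ψ φ := by
  rw [← evalEquiv_apply, LinearEquiv.apply_symm_apply]

end DualBimod

namespace TriMat

variable (k R S M : Type u) [Field k] [Ring R] [Ring S] [Algebra k R] [Algebra k S]
  [AddCommGroup M] [Module k M]

/-- The inclusion of the upper left entry. -/
@[simps] def inA : R →ₗ[k] TriMat R S M where
  toFun r := ⟨r, 0, 0⟩
  map_add' _ _ := TriMat.ext rfl (add_zero _).symm (add_zero _).symm
  map_smul' _ _ := TriMat.ext rfl (smul_zero _).symm (smul_zero _).symm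

/-- The inclusion of the upper right entry. -/
@[simps] def inM : M →ₗ[k] TriMat R S M where
  toFun m := ⟨0, m, 0⟩
  map_add' _ _ := TriMat.ext (add_zero _).symm rfl (add_zero _).symm
  map_smul' _ _ := TriMat.ext (smul_zero _).symm rfl (smul_zero _).symm

/-- The inclusion of the lower right entry. -/
@[simps] def inB : S →ₗ[k] TriMat R S M where
  toFun s := ⟨0, 0, s⟩
  map_add' _ _ := TriMat.ext (add_zero _).symm (add_zero _).symm rfl
  map_smul' _ _ := TriMat.ext (smul_zero _).symm (smul_zero _).symm rfl

variable {k R S M}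

/-- The functional on triangular matrices with given restrictions to the three entries. -/
def functional (α : DualBimod k R) (μ : DualBimod k M) (β : DualBimod k S) :
    DualBimod k (TriMat R S M) :=
  ({ toFun := fun x => α x.a + μ x.m + β x.b
     map_add' := fun x y => by
       simp only [add_a, add_m, add_b, map_add]
       abel
     map_smul' := fun c x => by
       simp only [smul_a, smul_m, smul_b, map_smul, RingHom.id_apply, smul_add] } :
    TriMat R S M →ₗ[k] k)

@[simp] lemma functional_apply (α : DualBimod k R) (μ : DualBimod k M) (β : DualBimod k S)
    (x : TriMat R S M) : functional α μ β x = α x.a + μ x.m + β x.b := rfl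

lemma eq_inA_add_inM_add_inB (x : TriMat R S M) :
    x = inA k R S M x.a + inM k R S M x.m + inB k R S M x.b := by
  ext <;> simp

lemma apply_eq_add (φ : DualBimod k (TriMat R S M)) (x : TriMat R S M) :
    φ x = φ (inA k R S M x.a) + φ (inM k R S M x.m) + φ (inB k R S M x.b) := by
  rw [← map_add, ← map_add, ← eq_inA_add_inM_add_inB]

variable [Module R M] [Module Sᵐᵒᵖ M]

lemma inA_mul (r : R) (x : TriMat R S M) :
    inA k R S M r * x = inA k R S M (r * x.a) + inM k R S M (r • x.m) := by
  ext <;> simp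

lemma mul_inA (r : R) (x : TriMat R S M) : x * inA k R S M r = inA k R S M (x.a * r) := by
  ext <;> simp

lemma inM_mul (m : M) (x : TriMat R S M) : inM k R S M m * x = inM k R S M (op x.b • m) := by
  ext <;> simp

lemma mul_inM (m : M) (x : TriMat R S M) : x * inM k R S M m = inM k R S M (x.a • m) := by
  ext <;> simp

lemma inB_mul (s : S) (x : TriMat R S M) : inB k R S M s * x = inB k R S M (s * x.b) := by
  ext <;> simp

lemma mul_inB (s : S) (x : TriMat R S M) :
    x * inB k R S M s = inB k R S M (x.b * s) + inM k R S M (op s • x.m) := by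
  ext <;> simp

end TriMat

namespace RepetitiveAlgebra

open TriMat DualBimod

lemma ext_apply {k A : Type u} [Field k] [Ring A] [Algebra k A]
    {x y : RepetitiveAlgebra k A} (diag : ∀ i, x.diag i = y.diag i)
    (off : ∀ i a, x.off i a = y.off i a) : x = y :=
  RepetitiveAlgebra.ext (Finsupp.ext diag) (Finsupp.ext fun i => DualBimod.ext (off i))

variable {k R S M : Type u} [Field k] [Ring R] [Ring S] [Algebra k R] [Algebra k S]
  [AddCommGroup M] [Module k M] [Module R M] [Module Sᵐᵒᵖ M] [SMulCommClass R Sᵐᵒᵖ M]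
  [IsScalarTower k R M] [IsScalarTower k Sᵐᵒᵖ M]

/-- The matrix over the mate obtained by cutting a matrix over `TriMat R S M` along the diagonal
into its entries in `R`, `S`, `M` and their duals, and pairing the lower right entry at `i` with
the upper left entry at `i + 1`. -/
noncomputable def mate (x : RepetitiveAlgebra k (TriMat R S M)) :
    RepetitiveAlgebra k (Mate k R S M) where
  diag := Finsupp.ofSupportFinite
    (fun i => ⟨(x.diag i).b, (x.off i).comp (inM k R S M), (x.diag (i + 1)).a⟩)
    (finite_support_of_finsupp x.diag x.off (add_left_injective (1 : ℤ))
      fun i diag_i diag_succ off_i _ => by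
        rw [diag_i, diag_succ, off_i]
        rfl)
  off := Finsupp.ofSupportFinite
    (fun i => functional ((x.off i).comp (inB k R S M)) (eval k (x.diag (i + 1)).m)
      ((x.off (i + 1)).comp (inA k R S M)))
    (finite_support_of_finsupp x.diag x.off (add_left_injective (1 : ℤ))
      fun i _ diag_succ off_i off_succ => by
        ext z
        simp [diag_succ, off_i, off_succ])

lemma mate_diag_apply (x : RepetitiveAlgebra k (TriMat R S M)) (i : ℤ) : (mate x).diag i =
    ⟨(x.diag i).b, (x.off i).comp (inM k R S M), (x.diag (i + 1)).a⟩ := rfl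

lemma mate_off_apply (x : RepetitiveAlgebra k (TriMat R S M)) (i : ℤ) (z : Mate k R S M) :
    (mate x).off i z = x.off i (inB k R S M z.a) + z.m (x.diag (i + 1)).m +
      x.off (i + 1) (inA k R S M z.b) := rfl

lemma mate_smul (c : k) (x : RepetitiveAlgebra k (TriMat R S M)) : mate (c • x) = c • mate x := by
  refine ext_apply (fun i => rfl) fun i z => ?_
  simp [mate_off_apply, mul_add]

lemma mate_add (x y : RepetitiveAlgebra k (TriMat R S M)) : mate (x + y) = mate x + mate y := by
  refine ext_apply (fun i => rfl) fun i z => ?_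
  simp only [mate_off_apply, add_off, add_diag, Finsupp.add_apply, add_m, map_add,
    DualBimod.add_apply]
  abel

lemma mate_mul (x y : RepetitiveAlgebra k (TriMat R S M)) : mate (x * y) = mate x * mate y := by
  refine ext_apply (fun i => ?_) fun i z => ?_
  · refine TriMat.ext rfl (DualBimod.ext fun m => ?_) rfl
    simp [mate_diag_apply, inM_mul, mul_inM]
  · simp only [mate_off_apply, mul_off_apply, DualBimod.add_apply, left_smul_apply,
      smul_eq_mul_unop, unop_op, inB_mul, right_smul_apply, smul_eq_mul, mul_inB, map_add,
      mul_diag, Finsupp.mul_apply, mul_m, inA_mul, mul_inA, mate_diag_apply, mul_a,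
      DualBimod.comp_apply, mul_b]
    abel

variable (k R S M) in
/-- The homomorphism `mate` between the repetitive algebras of a triangular matrix algebra and of
its mate. -/
noncomputable def mateHom :
    RepetitiveAlgebra k (TriMat R S M) →ₙₐ[k] RepetitiveAlgebra k (Mate k R S M) where
  toFun := mate
  map_smul' := mate_smul
  map_zero' := by simpa using mate_smul (0 : k) (0 : RepetitiveAlgebra k (TriMat R S M))
  map_add' := mate_add
  map_mul' := mate_mul

variable [Module.Finite k M]

/-- The inverse of `mate`. -/
noncomputable def ofMate (y : RepetitiveAlgebra k (Mate k R S M)) :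
    RepetitiveAlgebra k (TriMat R S M) where
  diag := Finsupp.ofSupportFinite
    (fun i => ⟨(y.diag (i - 1)).b,
      (evalEquiv k M).symm ((y.off (i - 1)).comp (inM k S R (DualBimod k M))), (y.diag i).a⟩)
    (finite_support_of_finsupp y.diag y.off (sub_left_injective (b := (1 : ℤ)))
      fun i diag_i diag_pred _ off_pred => by
        rw [diag_i, diag_pred, off_pred]
        exact TriMat.ext rfl (map_zero (evalEquiv k M).symm) rfl)
  off := Finsupp.ofSupportFinite
    (fun i => functional ((y.off (i - 1)).comp (inB k S R (DualBimod k M))) (y.diag i).m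
      ((y.off i).comp (inA k S R (DualBimod k M))))
    (finite_support_of_finsupp y.diag y.off (sub_left_injective (b := (1 : ℤ)))
      fun i diag_i _ off_i off_pred => by
        ext z
        simp [diag_i, off_i, off_pred])

lemma ofMate_diag_apply (y : RepetitiveAlgebra k (Mate k R S M)) (i : ℤ) : (ofMate y).diag i =
    ⟨(y.diag (i - 1)).b,
      (evalEquiv k M).symm ((y.off (i - 1)).comp (inM k S R (DualBimod k M))), (y.diag i).a⟩ := rfl

lemma ofMate_off_apply (y : RepetitiveAlgebra k (Mate k R S M)) (i : ℤ) (x : TriMat R S M) :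
    (ofMate y).off i x = y.off (i - 1) (inB k S R (DualBimod k M) x.a) + (y.diag i).m x.m +
      y.off i (inA k S R (DualBimod k M) x.b) := rfl

lemma ofMate_mate (x : RepetitiveAlgebra k (TriMat R S M)) : ofMate (mate x) = x := by
  refine ext_apply (fun i => ?_) fun i a => ?_
  · rw [ofMate_diag_apply, mate_diag_apply, sub_add_cancel]
    refine TriMat.ext rfl ((evalEquiv k M).symm_apply_eq.2 (DualBimod.ext fun φ => ?_)) rfl
    simp [mate_off_apply]
  · rw [ofMate_off_apply, apply_eq_add (x.off i), mate_off_apply, mate_off_apply, mate_diag_apply,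
      sub_add_cancel]
    simp

lemma mate_ofMate (y : RepetitiveAlgebra k (Mate k R S M)) : mate (ofMate y) = y := by
  refine ext_apply (fun i => ?_) fun i z => ?_
  · rw [mate_diag_apply, ofMate_diag_apply, ofMate_diag_apply, add_sub_cancel_right]
    refine TriMat.ext rfl (DualBimod.ext fun m => ?_) rfl
    simp [ofMate_off_apply]
  · rw [mate_off_apply, ofMate_off_apply, ofMate_off_apply, ofMate_diag_apply,
      add_sub_cancel_right, apply_eq_add (y.off i) z]
    simp

variable (k R S M) in
theorem mateHom_bijective : Function.Bijective (mateHom k R S M) :=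
  ⟨Function.LeftInverse.injective ofMate_mate, Function.RightInverse.surjective mate_ofMate⟩

end RepetitiveAlgebra

theorem mainTheorem6 (k : Type u) [Field k] :
    ¬ DerivedEquivalent (ExLambda k) (ExMate k) ∧
    (∃ f : RepetitiveAlgebra k (ExLambda k) →ₙₐ[k] RepetitiveAlgebra k (ExMate k),
      Function.Bijective f) ∧
    Nonempty (ExMate k ≃ₐ[k] TriMat (TruncPoly k 3) (TruncPoly k 2) (SimpleBimod k 3 2)) ∧
    IsCartanMatrix k (ExLambda k) !![2, 0; 1, 3] ∧
    IsCartanMatrix k (ExMate k) !![3, 0; 1, 2] ∧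
    ¬ IntCongruent !![2, 0; 1, 3] !![3, 0; 1, 2] ∧
    Module.Injective (TruncPoly k 2)ᵐᵒᵖ (TruncPoly k 2) ∧
    Module.Injective (TruncPoly k 3)ᵐᵒᵖ (TruncPoly k 3) ∧
    ∀ d : ℕ, ¬ HasProjectiveDimensionLE
      (ModuleCat.of (TruncPoly k 3)ᵐᵒᵖ (SimpleBimod k 2 3)) d := by
  exact ⟨not_derivedEquivalent k,
    ⟨RepetitiveAlgebra.mateHom _ _ _ _, RepetitiveAlgebra.mateHom_bijective _ _ _ _⟩,
    ⟨mateSimpleBimodEquiv k 2 3⟩,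
    (ExLambda.basicIdempotents k).isCartanMatrix _ (ExLambda.cartan_apply k),
    (ExMate.basicIdempotents k).isCartanMatrix _ (ExMate.cartan_apply k),
    not_intCongruent, TruncPoly.selfInjective, TruncPoly.selfInjective,
    TruncPoly.not_hasProjectiveDimensionLE (by norm_num)⟩
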